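/- **Setting.** Let $D\ge 1$ (the case $D=0$ is also allowed), $T\ge 1$, $N\ge 1$, and write $N(x;m,S)$ for the Gaussian density on $\mathbb R^D$. For $t=1,\dots,T$ let $F_t\in\mathbb R^{D\times D}$, $b_t\in\mathbb R^D$, let $C_t\in\mathbb R^{D\times D}$ be symmetric positive definite, $\delta_t>0$, $\kappa\in\{0,1\}$, and let $G_t(x_{t-1:t})>0$ be a differentiable function of $(x_{t-1},x_t)$. Quantities with a time index $\le 0$ or $>T$ are ignored (so $G_1$ depends on $x_1$ only, and factors with index $T+1$ equal $1$). Put $$M_t(x_t\mid x_{t-1})=N(x_t;F_tx_{t-1}+b_t,C_t)\ (t>1),\qquad M_1(x_1)=N(x_1;b_1,C_1),\qquad Q_t(x_{t-1:t})=M_t(x_t\mid x_{t-1})\,G_t(x_{t-1:t}),$$ assume that $\prod_{t=1}^TQ_t(x_{t-1:t})$ is integrable, and let $\pi_T$ be the probability distribution on $(\mathbb R^D)^T$ with density $\pi_T(x_{1:T})\propto\prod_{t=1}^TQ_t(x_{t-1:t})$. **Twisted proposal.** In the state-space model with transitions $M_t$ and observations $u_t\mid x_t\sim N(x_t,\tfrac{\delta_t}2I)$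 let $$M'_t(x_t\mid x_{t-1};u_{t:T})=p(x_t\mid x_{t-1},u_{t:T})\propto\int\prod_{s=t}^TM_s(x_s\mid x_{s-1})\,N(u_s;x_s,\tfrac{\delta_s}2I)\,dx_{t+1:T},$$ normalised as a density in $x_t$. **Potentials.** Let $\varphi_t(x_{t-1:t})=\nabla_{x_t}\log G_t(x_{t-1:t})$ and $\sigma_t(x_{t-1:t+1})=\nabla_{x_t}[\log G_t(x_{t-1:t})+\log G_{t+1}(x_{t:t+1})]=\nabla_{x_t}\log\prod_{s=1}^TG_s(x_{s-1:s})$, and write $n_t(u;x,g)=N(u;x+\kappa\tfrac{\delta_t}2g,\tfrac{\delta_t}2I)$. For twisted Particle-aGRAD, $$G'_t(x_{t-1:t})=Q_t(x_{t-1:t})\,\frac{n_t(u_t;x_t,\varphi_t(x_{t-1:t}))}{M'_t(x_t\mid x_{t-1};u_{t:T})}.$$ For twisted Particle-aGRAD+, this is multiplied, when $t>1$, by $$\frac{n_{t-1}(u_{t-1};x_{t-1},\sigma_{t-1}(x_{t-2:t}))}{n_{t-1}(u_{t-1};x_{t-1},\varphi_{t-1}(x_{t-2:t-1}))},$$ so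 that $G'_t$ is then a function of $x_{t-2:t}$. In both cases $Q'_t=M'_tG'_t$. **Algorithms.** Given $x_{1:T}$, sample independently $u_t\sim N(x_t+\kappa\tfrac{\delta_t}2g_t,\tfrac{\delta_t}2I)$ for $t=1,\dots,T$, where $g_t=\varphi_t(x_{t-1:t})$ for aGRAD and $g_t=\sigma_t(x_{t-1:t+1})$ for aGRAD+. Then: 1. For $t=1,\dots,T$: sample $k_t$ uniformly on $\{0,\dots,N\}$ and set $x_t^{k_t}=x_t$. If $t>1$, set $a_{t-1}^{k_t}=k_{t-1}$ and, for $n\ne k_t$, sample $a_{t-1}^n=i$ with probability $W_{t-1}^i$. For $n\neq k_t$ sample $x_t^n\sim M'_t(\cdot\mid x_{t-1}^{a_{t-1}^n};u_{t:T})$. For every $n$ let $w_t^n$ be the value of $G'_t$ at the last states of the lineage $x_{1:t}^{(n)}=(x_{1:t-1}^{(a_{t-1}^n)},x_t^n)$, and $W_t^n=w_t^n/\sum_{m}w_t^m$. 2. Sample $i\ne k_T$ with probability $W_T^i/(1-W_T^{k_T})$; set $l_T=i$ with probability $1\wedge\frac{1-W_T^{k_T}}{1-W_T^i}$, otherwise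 $l_T=k_T$. 3. For $t=T-1,\dots,1$ sample $l_t=i$ with probability proportional to $W_t^i\,Q'_{t+1}(x_t^i,x_{t+1}^{l_{t+1}})$ for aGRAD, and to $W_t^i\,Q'_{t+1}(x_{t-1:t}^{(i)},x_{t+1}^{l_{t+1}})\,Q'_{t+2}(x_t^i,x_{t+1}^{l_{t+1}},x_{t+2}^{l_{t+2}})$ for aGRAD+. 4. Return $(x_1^{l_1},\dots,x_T^{l_T})$. **Kalman recursions.** Let $\mu_1=b_1$, $\Sigma_1=C_1$, $\mu_t=F_t\mu_{t-1}+b_t$, $\Sigma_t=F_t\Sigma_{t-1}F_t^{\top}+C_t$. For $t<T$ let $$F_t^\leftarrow=\Sigma_tF_{t+1}^{\top}\Sigma_{t+1}^{-1},\qquad b_t^\leftarrow=\mu_t-F_t^\leftarrow\mu_{t+1},\qquad C_t^\leftarrow=\Sigma_t-F_t^\leftarrow F_{t+1}\Sigma_t.$$ For $t=T,\dots,1$ let $(m_t,P_t)$ be the mean and covariance computed by the Kalman filter of the time-reversed model: with $(\hat m_T,\hat P_T)=(\mu_T,\Sigma_T)$, and $\hat m_t=F_t^\leftarrow m_{t+1}+b_t^\leftarrow$,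 $\hat P_t=F_t^\leftarrow P_{t+1}(F_t^\leftarrow)^{\top}+C_t^\leftarrow$ for $t<T$, and $K_t=\hat P_t(\hat P_t+\tfrac{\delta_t}2I)^{-1}$, set $m_t=\hat m_t+K_t(u_t-\hat m_t)$ and $P_t=(I-K_t)\hat P_t$. Finally let $F'_1=0$, $b'_1=m_1$, $C'_1=P_1$ and, for $t\ge 2$, $$F'_t=P_t(F_{t-1}^\leftarrow)^{\top}\bigl(C_{t-1}^\leftarrow+F_{t-1}^\leftarrow P_t(F_{t-1}^\leftarrow)^{\top}\bigr)^{-1},\quad b'_t=m_t-F'_t(F_{t-1}^\leftarrow m_t+b_{t-1}^\leftarrow),\quad C'_t=(I-F'_tF_{t-1}^\leftarrow)P_t.$$ **Proposition.** (i) For all $u_{1:T}$ and all $t$, the matrix $C'_t$ is positive definite and $M'_t(x_t\mid x_{t-1};u_{t:T})=N(x_t;F'_tx_{t-1}+b'_t,C'_t)$ for all $x_{t-1},x_t$. (ii) Sampling the output path given $x_{1:T}$ by twisted Particle-aGRAD induces a Markov kernel on $(\mathbb R^D)^T$ which leaves $\pi_T$ invariant. (iii) The same holds for twisted Particle-aGRAD+.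 -/

import Mathlib

open MeasureTheory ProbabilityTheory

noncomputable section

/-- The state space `ℝ^D`. -/
abbrev State (D : ℕ) : Type := EuclideanSpace ℝ (Fin D)

/-- Matrix-vector product on `ℝ^D`. -/
def matVec {D : ℕ} (A : Matrix (Fin D) (Fin D) ℝ) (x : State D) : State D :=
  Matrix.toEuclideanCLM (𝕜 := ℝ) A x

/-- The density `N(x; m, S)` at `x` of the Gaussian with mean `m` and covariance matrix `S`. -/
def gaussianDensity {D : ℕ} (x m : State D) (S : Matrix (Fin D) (Fin D) ℝ) : ℝ :=
  (Real.sqrt ((2 * Real.pi) ^ D * S.det))⁻¹ *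
    Real.exp (-(1 / 2) * inner ℝ (x - m) (matVec S⁻¹ (x - m)))

/-- The law on `ℝ^D` with Lebesgue density `p`. -/
def lawOfDensity {D : ℕ} (p : State D → ℝ) : Measure (State D) :=
  volume.withDensity fun x => ENNReal.ofReal (p x)

/-- The law on `{0, …, n - 1}` with point masses `p`. -/
def discreteLaw {n : ℕ} (p : Fin n → ℝ) : Measure (Fin n) :=
  ∑ i, ENNReal.ofReal (p i) • Measure.dirac i

/-- A finite sequence as a function of all times, with the (never used) value `0` out of range. -/
def extendPath {D T : ℕ} (x : Fin T → State D) (t : ℕ) : State D :=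
  if h : t < T then x ⟨t, h⟩ else 0

/-- The state before time `t`; at the initial time this is a placeholder that is ignored. -/
def previous {D : ℕ} (x : ℕ → State D) : ℕ → State D
  | 0 => 0
  | t + 1 => x t

/-! ### The model

Times are numbered `0, …, T - 1` (instead of `1, …, T`). -/

/-- Data of a Feynman--Kac model with affine Gaussian dynamics, with the tuning parameters
`δ` (step sizes) and `κ` (gradient indicator). The initial law is `N(b 0, C 0)`, and the entries
`F 0` and `stepPotential 0` are not used. -/
structure AffineGaussianModel (D : ℕ) where
  F : ℕ → Matrix (Fin D) (Fin D) ℝ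
  b : ℕ → State D
  C : ℕ → Matrix (Fin D) (Fin D) ℝ
  initialPotential : State D → ℝ
  stepPotential : ℕ → State D → State D → ℝ
  δ : ℕ → ℝ
  κ : ℝ

/-- The three ingredients in which conditional sequential Monte Carlo algorithms differ:
the proposal density `(t, x_{t-1}, x_t) ↦ M'_t(x_t | x_{t-1})`,
the potential `(t, x_{t-2}, x_{t-1}, x_t) ↦ G'_t(x_{t-2:t})`, and the factor
`(t, x_{t-1}, x_t, x_{t+1}, x_{t+2}) ↦ …` that multiplies `W_t` in backward sampling. -/
structure CSMCIngredients (D : ℕ) where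
  proposal : ℕ → State D → State D → ℝ
  potential : ℕ → State D → State D → State D → ℝ
  backward : ℕ → State D → State D → State D → State D → ℝ

namespace AffineGaussianModel

variable {D : ℕ} (M : AffineGaussianModel D)

/-- The mean of `x_t` given `x_{t-1} = xp` (where `xp` is ignored at the initial time). -/
def transitionMean : ℕ → State D → State D
  | 0, _ => M.b 0
  | t + 1, xp => matVec (M.F (t + 1)) xp + M.b (t + 1)

/-- The transition density `M_t(x_t | x_{t-1})`. -/
def transition (t : ℕ) (xp x : State D) : ℝ :=
  gaussianDensity x (M.transitionMean t xp) (M.C t)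

/-- The potential `G_t(x_{t-1:t})`. -/
def G : ℕ → State D → State D → ℝ
  | 0, _, x => M.initialPotential x
  | t + 1, xp, x => M.stepPotential (t + 1) xp x

/-- `Q_t(x_{t-1:t}) = M_t(x_t | x_{t-1}) G_t(x_{t-1:t})`. -/
def Q (t : ℕ) (xp x : State D) : ℝ := M.transition t xp x * M.G t xp x

/-- The unnormalised density of the target. -/
def unnormalizedTarget (T : ℕ) (x : Fin T → State D) : ℝ :=
  ∏ t ∈ Finset.range T, M.Q t (previous (extendPath x) t) (extendPath x t)

/-- The joint smoothing distribution `π_T`. -/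
def target (T : ℕ) : Measure (Fin T → State D) :=
  (∫⁻ x, ENNReal.ofReal (M.unnormalizedTarget T x))⁻¹ •
    volume.withDensity fun x => ENNReal.ofReal (M.unnormalizedTarget T x)

/-- The covariance matrix `(δ_t / 2) I` of the auxiliary variable `u_t`. -/
def auxCov (t : ℕ) : Matrix (Fin D) (Fin D) ℝ := (M.δ t / 2) • 1

/-! ### The twisted proposal -/

/-- `∏_{s ≥ t} N(x_s; F_s x_{s-1} + b_s, C_s) N(u_s; x_s, (δ_s / 2) I)` as a function of
`x_{t-1} = xp`, `x_t = x` and the later states `y`. -/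
def lookaheadIntegrand (T : ℕ) (u : ℕ → State D) (t : ℕ) (xp x : State D)
    (y : Fin (T - t - 1) → State D) : ℝ :=
  let z : ℕ → State D := fun j =>
    match j with
    | 0 => xp
    | 1 => x
    | i + 2 => extendPath y i
  ∏ j ∈ Finset.range (T - t),
    M.transition (t + j) (z j) (z (j + 1)) *
      gaussianDensity (u (t + j)) (z (j + 1)) (M.auxCov (t + j))

/-- The density of `(x_t, u_{t:T})` given `x_{t-1}` in the pseudo-observation model. -/
def lookahead (T : ℕ) (u : ℕ → State D) (t : ℕ) (xp x : State D) : ℝ :=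
  ∫ y : Fin (T - t - 1) → State D, M.lookaheadIntegrand T u t xp x y

/-- `M'_t(x_t | x_{t-1}; u_{t:T}) = p(x_t | x_{t-1}, u_{t:T})`. -/
def twistedProposal (T : ℕ) (u : ℕ → State D) (t : ℕ) (xp x : State D) : ℝ :=
  M.lookahead T u t xp x / ∫ x' : State D, M.lookahead T u t xp x'

/-! ### Gradients and potentials of the two algorithms -/

/-- `∇_{x_t} log G_t(x_{t-1:t})`. -/
def filterGradient (t : ℕ) (xp x : State D) : State D :=
  gradient (fun y => Real.log (M.G t xp y)) x

/-- `∇_{x_t} log G_{1:T}(x_{1:T})`: only the factors `G_t(x_{t-1:t})` and, if `t` is not the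
final time, `G_{t+1}(x_{t:t+1})` depend on `x_t`. -/
def smoothingGradient (T t : ℕ) (xp x xn : State D) : State D :=
  gradient (fun y => Real.log (M.G t xp y) +
    if t + 1 < T then Real.log (M.G (t + 1) y xn) else 0) x

/-- `N(u_t; x_t + κ (δ_t / 2) g, (δ_t / 2) I)` for a gradient `g`. -/
def auxDensity (t : ℕ) (x g u : State D) : ℝ :=
  gaussianDensity u (x + (M.κ * (M.δ t / 2)) • g) (M.auxCov t)

/-- `G'_t(x_{t-1:t}; u_{t:T})`. -/
def twistedPotential (T : ℕ) (u : ℕ → State D) (t : ℕ) (xp x : State D) : ℝ :=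
  M.Q t xp x * M.auxDensity t x (M.filterGradient t xp x) (u t) / M.twistedProposal T u t xp x

/-- `Q'_t(x_{t-1:t}; u_{t:T})`. -/
def twistedQ (T : ℕ) (u : ℕ → State D) (t : ℕ) (xp x : State D) : ℝ :=
  M.twistedProposal T u t xp x * M.twistedPotential T u t xp x

/-- `G'_t(x_{t-2:t}; u_{t-1:T})` with `x_{t-2} = xpp`, `x_{t-1} = xp` and `x_t = x`. -/
def twistedPotentialPlus (T : ℕ) (u : ℕ → State D) : ℕ → State D → State D → State D → ℝ
  | 0, _, xp, x => M.twistedPotential T u 0 xp x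
  | t + 1, xpp, xp, x =>
      M.twistedPotential T u (t + 1) xp x *
        (M.auxDensity t xp (M.smoothingGradient T t xpp xp x) (u t) /
          M.auxDensity t xp (M.filterGradient t xpp xp) (u t))

/-- `Q'_t(x_{t-2:t}; u_{t-1:T})`. -/
def twistedQPlus (T : ℕ) (u : ℕ → State D) (t : ℕ) (xpp xp x : State D) : ℝ :=
  M.twistedProposal T u t xp x * M.twistedPotentialPlus T u t xpp xp x

/-- Ingredients of twisted Particle-aGRAD, given `u_{1:T}`. -/
def twistedIngredients (T : ℕ) (u : ℕ → State D) : CSMCIngredients D where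
  proposal := M.twistedProposal T u
  potential t _ xp x := M.twistedPotential T u t xp x
  backward t _ x xn _ := M.twistedQ T u (t + 1) x xn

/-- Ingredients of twisted Particle-aGRAD+, given `u_{1:T}`. -/
def twistedIngredientsPlus (T : ℕ) (u : ℕ → State D) : CSMCIngredients D where
  proposal := M.twistedProposal T u
  potential := M.twistedPotentialPlus T u
  backward t xp x xn xnn :=
    M.twistedQPlus T u (t + 1) xp x xn *
      if t + 2 < T then M.twistedQPlus T u (t + 2) x xn xnn else 1

end AffineGaussianModel

/-! ### Conditional sequential Monte Carlo -/

/-- Reference indices `k_t`, ancestor indices `a_t^n` (the index at time `t` of the parent of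
particle `n` at time `t + 1`), and particles `x_t^n`, for `n = 0, …, N`. Entries that have not
been sampled yet are `0`. -/
abbrev ParticleSystem (N D : ℕ) : Type :=
  (ℕ → Fin (N + 1)) × (ℕ → Fin (N + 1) → Fin (N + 1)) × (ℕ → Fin (N + 1) → State D)

namespace ParticleSystem

variable {N D : ℕ}

def refIndex (S : ParticleSystem N D) : ℕ → Fin (N + 1) := S.1

def ancestor (S : ParticleSystem N D) : ℕ → Fin (N + 1) → Fin (N + 1) := S.2.1

def particle (S : ParticleSystem N D) : ℕ → Fin (N + 1) → State D := S.2.2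

/-- The system before anything is sampled. -/
def empty : ParticleSystem N D := (fun _ => 0, fun _ _ => 0, fun _ _ => 0)

/-- The time-`(t-1)` state of the lineage of particle `n` at time `t`. -/
def parent (S : ParticleSystem N D) : ℕ → Fin (N + 1) → State D
  | 0, _ => 0
  | t + 1, n => S.particle t (S.ancestor t n)

/-- The time-`(t-2)` state of the lineage of particle `n` at time `t`. -/
def grandparent (S : ParticleSystem N D) : ℕ → Fin (N + 1) → State D
  | 0, _ => 0
  | t + 1, n => S.parent t (S.ancestor t n)

end ParticleSystem

namespace CSMCIngredients

variable {N D : ℕ} (A : CSMCIngredients D)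

/-- The unnormalised weight `w_t^n`. -/
def weight (S : ParticleSystem N D) (t : ℕ) (n : Fin (N + 1)) : ℝ :=
  A.potential t (S.grandparent t n) (S.parent t n) (S.particle t n)

/-- The normalised weight `W_t^n`. -/
def normWeight (S : ParticleSystem N D) (t : ℕ) (n : Fin (N + 1)) : ℝ :=
  A.weight S t n / ∑ m, A.weight S t m

/-- The law of the time-`t` particles given the time-`t` reference index `k` and the parent states
`p` of all particles: particle `k` is set to the reference state `x`, the others are proposed. -/
def particleLaw (t : ℕ) (k : Fin (N + 1)) (x : State D) (p : Fin (N + 1) → State D) :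
    Measure (Fin (N + 1) → State D) :=
  Measure.pi fun n => if n = k then Measure.dirac x else lawOfDensity (A.proposal t (p n))

/-- The law of the ancestor indices at time `t` of the time-`(t+1)` particles, given the
time-`(t+1)` reference index `k`. -/
def ancestorLaw (S : ParticleSystem N D) (t : ℕ) (k : Fin (N + 1)) :
    Measure (Fin (N + 1) → Fin (N + 1)) :=
  Measure.pi fun n =>
    if n = k then Measure.dirac (S.refIndex t) else discreteLaw (A.normWeight S t)

/-- One forward step: sample `k_t` uniformly, then the ancestor indices (except at the
initial time), then the particles. `x` is the reference path. -/
def forwardStep (x : ℕ → State D) : ℕ → ParticleSystem N D → Measure (ParticleSystem N D)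
  | 0, S =>
      (discreteLaw fun _ : Fin (N + 1) => 1 / ((N : ℝ) + 1)).bind fun k =>
        (A.particleLaw 0 k (x 0) fun _ => 0).map fun z =>
          (Function.update S.refIndex 0 k, S.ancestor, Function.update S.particle 0 z)
  | t + 1, S =>
      (discreteLaw fun _ : Fin (N + 1) => 1 / ((N : ℝ) + 1)).bind fun k =>
        (A.ancestorLaw S t k).bind fun a =>
          (A.particleLaw (t + 1) k (x (t + 1)) fun n => S.particle t (a n)).map fun z =>
            (Function.update S.refIndex (t + 1) k, Function.update S.ancestor t a,
              Function.update S.particle (t + 1) z)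

/-- The law of the particle system after `t` forward steps. -/
def forwardLaw (N : ℕ) (x : ℕ → State D) : ℕ → Measure (ParticleSystem N D)
  | 0 => Measure.dirac ParticleSystem.empty
  | t + 1 => (forwardLaw N x t).bind (A.forwardStep x t)

/-- The forced-move law of the final index `l_t` (with `t` the final time): propose `i ≠ k_t` with
probability `W_t^i / (1 - W_t^{k_t})`, accept it with probability
`1 ∧ (1 - W_t^{k_t}) / (1 - W_t^i)`, and otherwise take `k_t`. -/
def finalIndexLaw (S : ParticleSystem N D) (t : ℕ) : Measure (Fin (N + 1)) :=
  let k := S.refIndex t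
  let W := A.normWeight S t
  (discreteLaw fun i => if i = k then 0 else W i / (1 - W k)).bind fun i =>
    ENNReal.ofReal (min 1 ((1 - W k) / (1 - W i))) • Measure.dirac i +
      ENNReal.ofReal (1 - min 1 ((1 - W k) / (1 - W i))) • Measure.dirac k

/-- The backward-sampling weight of index `i` at time `t`, given the later indices `l`. -/
def backwardWeight (S : ParticleSystem N D) (l : ℕ → Fin (N + 1)) (t : ℕ) (i : Fin (N + 1)) : ℝ :=
  A.normWeight S t i *
    A.backward t (S.parent t i) (S.particle t i) (S.particle (t + 1) (l (t + 1)))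
      (S.particle (t + 2) (l (t + 2)))

/-- Given the indices `l_s` for `s ≥ t`, sample `l_{t-1}, …, l_0` in this order. -/
def backwardLaw (S : ParticleSystem N D) : ℕ → (ℕ → Fin (N + 1)) → Measure (ℕ → Fin (N + 1))
  | 0, l => Measure.dirac l
  | t + 1, l =>
      (discreteLaw fun i => A.backwardWeight S l t i / ∑ n, A.backwardWeight S l t n).bind
        fun i => backwardLaw S t (Function.update l t i)

/-- The law of the output path given the reference path `x`. -/
def outputLaw (N : ℕ) {T : ℕ} (x : Fin T → State D) : Measure (Fin T → State D) :=
  (A.forwardLaw N (extendPath x) T).bind fun S =>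
    (A.finalIndexLaw S (T - 1)).bind fun i =>
      (A.backwardLaw S (T - 1) (Function.update (fun _ => 0) (T - 1) i)).map fun l t =>
        S.particle t (l t)

end CSMCIngredients

namespace AffineGaussianModel

variable {D : ℕ} (M : AffineGaussianModel D)

/-! ### The two algorithms -/

/-- The law of `u_{1:T}` given `x_{1:T}` in twisted Particle-aGRAD. -/
def auxLaw {T : ℕ} (x : Fin T → State D) : Measure (Fin T → State D) :=
  Measure.pi fun t => lawOfDensity <|
    M.auxDensity t (x t) (M.filterGradient t (previous (extendPath x) t) (x t))

/-- The law of `u_{1:T}` given `x_{1:T}` in twisted Particle-aGRAD+. -/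
def auxLawPlus {T : ℕ} (x : Fin T → State D) : Measure (Fin T → State D) :=
  Measure.pi fun t => lawOfDensity <|
    M.auxDensity t (x t)
      (M.smoothingGradient T t (previous (extendPath x) t) (x t) (extendPath x (t + 1)))

/-- The law of the output of twisted Particle-aGRAD (with `N + 1` particles) started at `x`. -/
def twistedParticleAGRAD (N : ℕ) {T : ℕ} (x : Fin T → State D) : Measure (Fin T → State D) :=
  (M.auxLaw x).bind fun u => (M.twistedIngredients T (extendPath u)).outputLaw N x

/-- The law of the output of twisted Particle-aGRAD+ (with `N + 1` particles) started at `x`. -/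
def twistedParticleAGRADPlus (N : ℕ) {T : ℕ} (x : Fin T → State D) :
    Measure (Fin T → State D) :=
  (M.auxLawPlus x).bind fun u => (M.twistedIngredientsPlus T (extendPath u)).outputLaw N x

/-! ### Kalman recursions for the parameters of the twisted proposal -/

/-- Prior mean of `x_t`. -/
def priorMean : ℕ → State D
  | 0 => M.b 0
  | t + 1 => matVec (M.F (t + 1)) (priorMean t) + M.b (t + 1)

/-- Prior covariance matrix of `x_t`. -/
def priorCov : ℕ → Matrix (Fin D) (Fin D) ℝ
  | 0 => M.C 0
  | t + 1 => M.F (t + 1) * priorCov t * (M.F (t + 1)).transpose + M.C (t + 1)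

/-- The matrix `F_t^←` of the time-reversed transition
`p(x_t | x_{t+1}) = N(x_t; F_t^← x_{t+1} + b_t^←, C_t^←)`. -/
def revF (t : ℕ) : Matrix (Fin D) (Fin D) ℝ :=
  M.priorCov t * (M.F (t + 1)).transpose * (M.priorCov (t + 1))⁻¹

/-- The vector `b_t^←` of the time-reversed transition. -/
def revb (t : ℕ) : State D := M.priorMean t - matVec (M.revF t) (M.priorMean (t + 1))

/-- The covariance matrix `C_t^←` of the time-reversed transition. -/
def revC (t : ℕ) : Matrix (Fin D) (Fin D) ℝ :=
  M.priorCov t - M.revF t * M.F (t + 1) * M.priorCov t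

/-- Kalman update of `N(m, S)` by the observation `u_t` of `x_t` with noise `(δ_t / 2) I`. -/
def kalmanUpdate (t : ℕ) (u m : State D) (S : Matrix (Fin D) (Fin D) ℝ) :
    State D × Matrix (Fin D) (Fin D) ℝ :=
  let K := S * (S + M.auxCov t)⁻¹
  (m + matVec K (u - m), (1 - K) * S)

/-- Kalman filter of the time-reversed model, started at the final time `T - 1`; after `j` further
steps it yields mean and covariance matrix of `p(x_t | u_{t:T})` at time `t = T - 1 - j`. -/
def revFilter (T : ℕ) (u : ℕ → State D) : ℕ → State D × Matrix (Fin D) (Fin D) ℝ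
  | 0 => M.kalmanUpdate (T - 1) (u (T - 1)) (M.priorMean (T - 1)) (M.priorCov (T - 1))
  | j + 1 =>
      let t := T - 1 - (j + 1)
      let f := revFilter T u j
      M.kalmanUpdate t (u t) (matVec (M.revF t) f.1 + M.revb t)
        (M.revF t * f.2 * (M.revF t).transpose + M.revC t)

/-- The mean of `p(x_t | u_{t:T})`. -/
def filterMean (T : ℕ) (u : ℕ → State D) (t : ℕ) : State D := (M.revFilter T u (T - 1 - t)).1

/-- The covariance matrix of `p(x_t | u_{t:T})`. -/
def filterCov (T : ℕ) (u : ℕ → State D) (t : ℕ) : Matrix (Fin D) (Fin D) ℝ :=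
  (M.revFilter T u (T - 1 - t)).2

/-- The matrix `F'_t`. -/
def twistedF (T : ℕ) (u : ℕ → State D) : ℕ → Matrix (Fin D) (Fin D) ℝ
  | 0 => 0
  | t + 1 =>
      M.filterCov T u (t + 1) * (M.revF t).transpose *
        (M.revC t + M.revF t * M.filterCov T u (t + 1) * (M.revF t).transpose)⁻¹

/-- The vector `b'_t`. -/
def twistedb (T : ℕ) (u : ℕ → State D) : ℕ → State D
  | 0 => M.filterMean T u 0
  | t + 1 =>
      M.filterMean T u (t + 1) - matVec (M.twistedF T u (t + 1))
        (matVec (M.revF t) (M.filterMean T u (t + 1)) + M.revb t)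

/-- The covariance matrix `C'_t`. -/
def twistedC (T : ℕ) (u : ℕ → State D) : ℕ → Matrix (Fin D) (Fin D) ℝ
  | 0 => M.filterCov T u 0
  | t + 1 => (1 - M.twistedF T u (t + 1) * M.revF t) * M.filterCov T u (t + 1)

end AffineGaussianModel

end

/-! Part (i) is Bayes' rule for Gaussians. Write p for densities in the pseudo-observation model.
Integrating out the future leaves M_t(x_t | x_{t-1}) p(u_{t:T} | x_t), where p(u_{t:T} | x_t) =
p(u_{t:T}) p(x_t | u_{t:T}) / p(x_t); the last quotient is `filterRatio`. By time reversal, M_t(x_t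
| x_{t-1}) / p(x_t) equals p(x_{t-1} | x_t) / p(x_{t-1}). Swapping the order of conditioning in
p(x_t | u_{t:T}) p(x_{t-1} | x_t) then produces N(x_t; F'_t x_{t-1} + b'_t, C'_t) times a function
of x_{t-1}, and normalisation removes that function. Every such swap is an instance of
`gaussianDensity_mul_gaussianDensity`, which rests on completing the square and on the matrix
inversion and determinant lemmas.

For (ii) and (iii), fix u. In the product of the Q'_t = M'_t G'_t the proposals cancel, and what
remains is the unnormalised target times the density of u given the path
(`pathDensity_twistedIngredients`; for aGRAD+ the correction factors telescope). Sampling u is thus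
a Gibbs step for the joint law, and by Tonelli (`exists_kernel_invariant_of_joint`) it suffices
that, for each u, conditional SMC preserves the path density with factors Q'_t.

The heart of that is `IsRegular.lmarginal_forwardLaw_congr`. Once the reference path up to time t is
integrated against its density, the reference particle is distinguished from the others only by its
weight: the expectation of h(S, k_t) depends on h only through the sum over k of w_t^k h(S, k).
Indeed, choosing the reference ancestor with probability W_t^k makes all ancestors i.i.d., and the
proposal part of the density makes all particles proposals, so that only the potential of the
reference particle is left over.

Hence the reference index may be redrawn by any mechanism that preserves the weights. The forced
move does so by detailed balance. Backward sampling at time t does so once the weights are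
multiplied by the factors of the path density that link the state at time t to later states, which
is the content of `IsCompatible`. Undoing these redraws one time at a time
(`IsRegular.lintegral_pathBackward`) ends with the reference path itself. -/

noncomputable section

/-! ### Gaussian densities -/

section Gaussian

open Matrix
open scoped MatrixOrder

variable {D : ℕ}

theorem matVec_sub (A : Matrix (Fin D) (Fin D) ℝ) (x y : State D) :
    matVec A (x - y) = matVec A x - matVec A y := map_sub _ _ _

theorem matVec_one (x : State D) : matVec 1 x = x := by simp [matVec]

theorem inner_matVec (A : Matrix (Fin D) (Fin D) ℝ) (x y : State D) :
    inner ℝ x (matVec A y) = x.ofLp ⬝ᵥ A *ᵥ y.ofLp := inner_toEuclideanCLM _ _ _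

@[fun_prop]
theorem continuous_matVec (A : Matrix (Fin D) (Fin D) ℝ) : Continuous (matVec A) :=
  (toEuclideanCLM (𝕜 := ℝ) A).continuous

theorem continuous_gaussianDensity (S : Matrix (Fin D) (Fin D) ℝ) :
    Continuous fun p : State D × State D => gaussianDensity p.1 p.2 S := by
  unfold gaussianDensity; fun_prop

@[fun_prop]
theorem measurable_gaussianDensity {α : Type*} [MeasurableSpace α] {f g : α → State D}
    (hf : Measurable f) (hg : Measurable g) (S : Matrix (Fin D) (Fin D) ℝ) :
    Measurable fun a => gaussianDensity (f a) (g a) S := by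
  have h := (continuous_gaussianDensity S).measurable.comp (hf.prodMk hg)
  exact h

theorem gaussianDensity_pos {S : Matrix (Fin D) (Fin D) ℝ} (hS : S.PosDef) (x m : State D) :
    0 < gaussianDensity x m S := by
  have := hS.det_pos
  unfold gaussianDensity; positivity

/-- Substituting by the square root A of S⁻¹ turns the quadratic form into ‖A x‖², and the Jacobian
|det A|⁻¹ = √(det S) cancels against the normalising constant. -/
theorem integral_gaussianDensity {S : Matrix (Fin D) (Fin D) ℝ} (hS : S.PosDef) (m : State D) :
    ∫ x, gaussianDensity x m S = 1 := by
  have hd := hS.det_pos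
  set A := CFC.sqrt S⁻¹ with hA
  have hAA : A * A = S⁻¹ := CFC.sqrt_mul_sqrt_self _ hS.inv.posSemidef.nonneg
  have hAs : Aᵀ = A := (CFC.sqrt_nonneg S⁻¹).posSemidef.isHermitian
  have hdet : A.det * A.det = S.det⁻¹ := by
    rw [← det_mul, hAA, det_nonsing_inv, Ring.inverse_eq_inv']
  have hA0 : A.det ≠ 0 := by
    rintro h; rw [h, mul_zero] at hdet; exact (inv_pos.2 hd).ne hdet
  have hnorm : ∀ x : State D, inner ℝ x (matVec S⁻¹ x) = ‖matVec A x‖ ^ 2 := by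
    intro x
    rw [← real_inner_self_eq_norm_sq, inner_matVec, inner_matVec, ← hAA, ← mulVec_mulVec,
      dotProduct_mulVec, ← mulVec_transpose, hAs]
    rfl
  unfold gaussianDensity
  rw [integral_const_mul]
  rw [integral_sub_right_eq_self (fun x => Real.exp (-(1 / 2) * inner ℝ x (matVec S⁻¹ x))) m]
  simp_rw [hnorm]
  have hlin : LinearMap.det (toEuclideanLin A) = A.det := by
    rw [toEuclideanLin_eq_toLin_orthonormal, LinearMap.det_toLin]
  have hmap := Measure.map_linearMap_addHaar_eq_smul_addHaar (volume : Measure (State D))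
    (f := toEuclideanLin A) (by rwa [hlin])
  have h1 : ∫ x : State D, Real.exp (-(1 / 2) * ‖matVec A x‖ ^ 2) =
      |A.det|⁻¹ * ∫ x : State D, Real.exp (-(1 / 2) * ‖x‖ ^ 2) := by
    have h2 := integral_map (μ := volume) (φ := toEuclideanLin A)
      (f := fun x : State D => Real.exp (-(1 / 2) * ‖x‖ ^ 2))
      (continuous_matVec A).measurable.aemeasurable
      (by apply Continuous.aestronglyMeasurable; fun_prop)
    rw [hmap, integral_smul_measure, hlin] at h2
    rw [ENNReal.toReal_ofReal (abs_nonneg _), abs_inv] at h2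
    exact h2.symm
  rw [h1, GaussianFourier.integral_rexp_neg_mul_sq_norm (by norm_num)]
  simp only [finrank_euclideanSpace, Fintype.card_fin]
  have h3 : |A.det|⁻¹ = Real.sqrt S.det := by
    rw [← Real.sqrt_sq_eq_abs, sq, hdet, Real.sqrt_inv, inv_inv]
  have h4 : (Real.pi / (1 / 2)) ^ ((D : ℝ) / 2) = Real.sqrt ((2 * Real.pi) ^ D) := by
    rw [Real.sqrt_eq_rpow, ← Real.rpow_natCast_mul (by positivity)]
    congr 1 <;> ring
  rw [h3, h4, Real.sqrt_mul (by positivity), mul_comm (Real.sqrt S.det), inv_mul_cancel₀]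
  have := Real.pi_pos
  positivity

theorem integrable_gaussianDensity {S : Matrix (Fin D) (Fin D) ℝ} (hS : S.PosDef) (m : State D) :
    Integrable fun x => gaussianDensity x m S :=
  Integrable.of_integral_ne_zero (by rw [integral_gaussianDensity hS]; norm_num)

/-! #### Conditioning in affine Gaussian models -/

/-- The gain `P Fᵀ (C + F P Fᵀ)⁻¹` of observing `F x + noise`, with noise covariance `C` and
prior covariance `P`. -/
def gain (F P C : Matrix (Fin D) (Fin D) ℝ) : Matrix (Fin D) (Fin D) ℝ :=
  P * Fᵀ * (C + F * P * Fᵀ)⁻¹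

variable {F P C : Matrix (Fin D) (Fin D) ℝ}

theorem posDef_add_mul_mul_transpose (hP : P.PosDef) (hC : C.PosDef)
    (F : Matrix (Fin D) (Fin D) ℝ) : (C + F * P * Fᵀ).PosDef :=
  hC.add_posSemidef (by simpa using hP.posSemidef.mul_mul_conjTranspose_same F)

theorem posDef_precision (hP : P.PosDef) (hC : C.PosDef)
    (F : Matrix (Fin D) (Fin D) ℝ) : (P⁻¹ + Fᵀ * C⁻¹ * F).PosDef :=
  hP.inv.add_posSemidef (by simpa using hC.inv.posSemidef.conjTranspose_mul_mul_same F)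

/-- The Woodbury identity. The gain K satisfies K (C + F P Fᵀ) = P Fᵀ, that is, P Fᵀ - K F P Fᵀ = K
C; multiplying by C⁻¹ collapses the terms of the product that contain C⁻¹ to K F. -/
theorem conditional_cov_mul_precision (hP : P.PosDef) (hC : C.PosDef)
    (F : Matrix (Fin D) (Fin D) ℝ) :
    (1 - gain F P C * F) * P * (P⁻¹ + Fᵀ * C⁻¹ * F) = 1 := by
  have hS := posDef_add_mul_mul_transpose hP hC F
  have hP1 := P.mul_nonsing_inv ((isUnit_iff_isUnit_det _).1 hP.isUnit)
  have hC1 := C.mul_nonsing_inv ((isUnit_iff_isUnit_det _).1 hC.isUnit)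
  have hS1 : gain F P C * (C + F * P * Fᵀ) = P * Fᵀ := by
    rw [gain, Matrix.mul_assoc,
      nonsing_inv_mul _ ((isUnit_iff_isUnit_det _).1 hS.isUnit), Matrix.mul_one]
  have h2 : P * Fᵀ * C⁻¹ - gain F P C * (F * P * Fᵀ) * C⁻¹ = gain F P C := by
    rw [← Matrix.sub_mul, ← hS1, ← Matrix.mul_sub, add_sub_cancel_right, Matrix.mul_assoc, hC1,
      Matrix.mul_one]
  calc _ = (1 - gain F P C * F) * (P * P⁻¹)
        + (P * Fᵀ * C⁻¹ - gain F P C * (F * P * Fᵀ) * C⁻¹) * F := by noncomm_ring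
    _ = 1 := by rw [h2, hP1]; noncomm_ring

theorem conditional_cov_eq_inv (hP : P.PosDef) (hC : C.PosDef)
    (F : Matrix (Fin D) (Fin D) ℝ) :
    (1 - gain F P C * F) * P = (P⁻¹ + Fᵀ * C⁻¹ * F)⁻¹ :=
  (inv_eq_left_inv (conditional_cov_mul_precision hP hC F)).symm

theorem posDef_conditional_cov (hP : P.PosDef) (hC : C.PosDef)
    (F : Matrix (Fin D) (Fin D) ℝ) : ((1 - gain F P C * F) * P).PosDef := by
  rw [conditional_cov_eq_inv hP hC]; exact (posDef_precision hP hC F).inv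

/-- Both sides are the determinant of the joint covariance of state and observation, computed by
eliminating one or the other. The proof uses det(1 + A B) = det(1 + B A). -/
theorem det_mul_det_conditional_cov (hP : P.PosDef) (hC : C.PosDef)
    (F : Matrix (Fin D) (Fin D) ℝ) :
    (C + F * P * Fᵀ).det * ((1 - gain F P C * F) * P).det = P.det * C.det := by
  have hP1 := P.mul_nonsing_inv ((isUnit_iff_isUnit_det _).1 hP.isUnit)
  have hC1 := C.mul_nonsing_inv ((isUnit_iff_isUnit_det _).1 hC.isUnit)
  have h := congrArg det (conditional_cov_mul_precision hP hC F)
  rw [det_mul, det_one] at h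
  have h1 : (C + F * P * Fᵀ).det = C.det * P.det * (P⁻¹ + Fᵀ * C⁻¹ * F).det := by
    have e1 : C + F * P * Fᵀ = C * (1 + C⁻¹ * F * (P * Fᵀ)) := by
      rw [Matrix.mul_add, Matrix.mul_one, ← Matrix.mul_assoc, ← Matrix.mul_assoc,
        ← Matrix.mul_assoc, hC1, Matrix.one_mul]
    have e2 : 1 + P * Fᵀ * (C⁻¹ * F) = P * (P⁻¹ + Fᵀ * C⁻¹ * F) := by
      rw [Matrix.mul_add, hP1]; simp only [Matrix.mul_assoc]
    rw [e1, det_mul, det_one_add_mul_comm, e2, det_mul, ← mul_assoc]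
  rw [h1]
  linear_combination C.det * P.det * h

/-- Completing the square in r. With Λ = P⁻¹ + Fᵀ C⁻¹ F, K the gain and S = C + F P Fᵀ, the cross
terms match because Λ K = Fᵀ C⁻¹, and the terms in s match because Kᵀ Λ K = C⁻¹ - S⁻¹. -/
theorem quadratic_form_conditioning (hP : P.PosDef) (hC : C.PosDef)
    (F : Matrix (Fin D) (Fin D) ℝ) (r s : Fin D → ℝ) :
    r ⬝ᵥ P⁻¹ *ᵥ r + (s - F *ᵥ r) ⬝ᵥ C⁻¹ *ᵥ (s - F *ᵥ r) =
      s ⬝ᵥ (C + F * P * Fᵀ)⁻¹ *ᵥ s +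
        (r - gain F P C *ᵥ s) ⬝ᵥ ((1 - gain F P C * F) * P)⁻¹ *ᵥ (r - gain F P C *ᵥ s) := by
  have hS := posDef_add_mul_mul_transpose hP hC F
  have hPu := (isUnit_iff_isUnit_det _).1 hP.isUnit
  have hCu := (isUnit_iff_isUnit_det _).1 hC.isUnit
  have hSu := (isUnit_iff_isUnit_det _).1 hS.isUnit
  have hΛu := (isUnit_iff_isUnit_det _).1 (posDef_precision hP hC F).isUnit
  have hSt : (C + F * P * Fᵀ)⁻¹ᵀ = (C + F * P * Fᵀ)⁻¹ := hS.inv.isHermitian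
  have hPt : Pᵀ = P := hP.isHermitian
  have hCt : C⁻¹ᵀ = C⁻¹ := hC.inv.isHermitian
  rw [conditional_cov_eq_inv hP hC, nonsing_inv_nonsing_inv _ hΛu]
  set S := C + F * P * Fᵀ with hSdef
  set K := gain F P C with hK
  have hΛK : (P⁻¹ + Fᵀ * C⁻¹ * F) * K = Fᵀ * C⁻¹ := by
    have : (P⁻¹ + Fᵀ * C⁻¹ * F) * (P * Fᵀ) = Fᵀ * C⁻¹ * S := by
      rw [hSdef, Matrix.mul_add, Matrix.add_mul, Matrix.mul_assoc _ C⁻¹ C, nonsing_inv_mul _ hCu,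
        ← Matrix.mul_assoc, nonsing_inv_mul _ hPu, Matrix.one_mul, Matrix.mul_one]
      simp only [Matrix.mul_assoc]
    rw [hK, gain, ← Matrix.mul_assoc, this, ← hSdef, Matrix.mul_assoc, mul_nonsing_inv _ hSu,
      Matrix.mul_one]
  have hKK : Kᵀ * (Fᵀ * C⁻¹) = C⁻¹ - S⁻¹ := by
    have h1 : Kᵀ = S⁻¹ * (F * P) := by
      rw [hK, gain, transpose_mul, transpose_mul, transpose_transpose, hSt, hPt]
    rw [h1, ← Matrix.mul_assoc, Matrix.mul_assoc S⁻¹, show F * P * Fᵀ = S - C by rw [hSdef]; abel,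
      Matrix.mul_sub, nonsing_inv_mul _ hSu, Matrix.sub_mul, Matrix.one_mul, Matrix.mul_assoc,
      mul_nonsing_inv _ hCu, Matrix.mul_one]
  have swap : ∀ (A : Matrix (Fin D) (Fin D) ℝ) (v w : Fin D → ℝ),
      (A *ᵥ v) ⬝ᵥ w = v ⬝ᵥ Aᵀ *ᵥ w := fun A v w => by
    rw [dotProduct_mulVec, vecMul_transpose]
  have comm : ∀ (A : Matrix (Fin D) (Fin D) ℝ) (v w : Fin D → ℝ),
      v ⬝ᵥ A *ᵥ w = w ⬝ᵥ Aᵀ *ᵥ v := fun A v w => by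
    rw [← swap, dotProduct_comm]
  have e1 : (F *ᵥ r) ⬝ᵥ C⁻¹ *ᵥ F *ᵥ r = r ⬝ᵥ (Fᵀ * C⁻¹ * F) *ᵥ r := by
    rw [swap, mulVec_mulVec, mulVec_mulVec, Matrix.mul_assoc]
  have e2 : (F *ᵥ r) ⬝ᵥ C⁻¹ *ᵥ s = r ⬝ᵥ (Fᵀ * C⁻¹) *ᵥ s := by rw [swap, mulVec_mulVec]
  have e3 : s ⬝ᵥ C⁻¹ *ᵥ F *ᵥ r = r ⬝ᵥ (Fᵀ * C⁻¹) *ᵥ s := by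
    rw [mulVec_mulVec, comm, transpose_mul, hCt]
  have e4 : r ⬝ᵥ (P⁻¹ + Fᵀ * C⁻¹ * F) *ᵥ K *ᵥ s = r ⬝ᵥ (Fᵀ * C⁻¹) *ᵥ s := by
    rw [mulVec_mulVec, hΛK]
  have e5 : (K *ᵥ s) ⬝ᵥ (P⁻¹ + Fᵀ * C⁻¹ * F) *ᵥ K *ᵥ s = s ⬝ᵥ C⁻¹ *ᵥ s - s ⬝ᵥ S⁻¹ *ᵥ s := by
    rw [mulVec_mulVec, hΛK, swap, mulVec_mulVec, hKK, sub_mulVec, dotProduct_sub]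
  have hΛt : (P⁻¹ + Fᵀ * C⁻¹ * F)ᵀ = P⁻¹ + Fᵀ * C⁻¹ * F :=
    (posDef_precision hP hC F).isHermitian
  have e6 : (K *ᵥ s) ⬝ᵥ (P⁻¹ + Fᵀ * C⁻¹ * F) *ᵥ r = r ⬝ᵥ (Fᵀ * C⁻¹) *ᵥ s := by
    rw [comm, hΛt, e4]
  have e7 : r ⬝ᵥ (P⁻¹ + Fᵀ * C⁻¹ * F) *ᵥ r = r ⬝ᵥ P⁻¹ *ᵥ r + r ⬝ᵥ (Fᵀ * C⁻¹ * F) *ᵥ r := by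
    rw [add_mulVec, dotProduct_add]
  simp only [mulVec_sub, dotProduct_sub, sub_dotProduct]
  linear_combination e1 - e2 - e3 + e4 - e5 + e6 - e7

/-- Swapping the order of conditioning in an affine Gaussian model. -/
theorem gaussianDensity_mul_gaussianDensity (hP : P.PosDef) (hC : C.PosDef)
    (F : Matrix (Fin D) (Fin D) ℝ) (m b x y : State D) :
    gaussianDensity x m P * gaussianDensity y (matVec F x + b) C =
      gaussianDensity y (matVec F m + b) (C + F * P * Fᵀ) *
        gaussianDensity x (m + matVec (gain F P C) (y - (matVec F m + b)))
          ((1 - gain F P C * F) * P) := by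
  have hq := quadratic_form_conditioning hP hC F (x - m).ofLp (y - (matVec F m + b)).ofLp
  have hdet := det_mul_det_conditional_cov hP hC F
  have h1 := hP.det_pos
  have h2 := hC.det_pos
  have h3 := (posDef_add_mul_mul_transpose hP hC F).det_pos
  have h4 := (posDef_conditional_cov hP hC F).det_pos
  have hx : y - (matVec F x + b) = (y - (matVec F m + b)) - matVec F (x - m) := by
    rw [matVec_sub]; abel
  have hy : x - (m + matVec (gain F P C) (y - (matVec F m + b))) =
      (x - m) - matVec (gain F P C) (y - (matVec F m + b)) := by abel
  -- Merging two Gaussian factors into one square root and one exponential leaves only the product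
  -- of the determinants and the sum of the quadratic forms to compare.
  have key : ∀ A B p q : ℝ, 0 ≤ A →
      (Real.sqrt ((2 * Real.pi) ^ D * A))⁻¹ * Real.exp (-(1 / 2) * p) *
        ((Real.sqrt ((2 * Real.pi) ^ D * B))⁻¹ * Real.exp (-(1 / 2) * q)) =
      (Real.sqrt ((2 * Real.pi) ^ D * (2 * Real.pi) ^ D * (A * B)))⁻¹ *
        Real.exp (-(1 / 2) * (p + q)) := by
    intro A B p q hA
    have := Real.pi_pos
    have h : Real.sqrt ((2 * Real.pi) ^ D * (2 * Real.pi) ^ D * (A * B)) =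
        Real.sqrt ((2 * Real.pi) ^ D * A) * Real.sqrt ((2 * Real.pi) ^ D * B) := by
      rw [mul_mul_mul_comm, Real.sqrt_mul (by positivity)]
    rw [mul_add, Real.exp_add, h, mul_inv, mul_mul_mul_comm]
  unfold gaussianDensity
  rw [hx, hy, key _ _ _ _ h1.le, key _ _ _ _ h3.le, hdet]
  simp only [inner_matVec]
  exact congrArg (fun z => _ * Real.exp (-(1 / 2) * z)) hq

end Gaussian

/-! ### Paths -/

section Path

variable {D : ℕ}

theorem extendPath_of_lt {T t : ℕ} (x : Fin T → State D) (h : t < T) :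
    extendPath x t = x ⟨t, h⟩ := dif_pos h

theorem extendPath_val {T : ℕ} (x : Fin T → State D) (t : Fin T) : extendPath x t = x t :=
  dif_pos t.2

@[fun_prop]
theorem measurable_extendPath {T : ℕ} :
    Measurable (extendPath : (Fin T → State D) → ℕ → State D) := by
  refine measurable_pi_lambda _ fun t => ?_
  by_cases h : t < T
  · simpa only [extendPath, h, dif_pos] using measurable_pi_apply _
  · simp [extendPath, h]

/-- The path that starts at `x` and continues with `y`. -/
def consPath (x : State D) (y : ℕ → State D) : ℕ → State D
  | 0 => x
  | i + 1 => y i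

@[fun_prop]
theorem measurable_consPath {α : Type*} [MeasurableSpace α] {f : α → State D} {g : α → ℕ → State D}
    (hf : Measurable f) (hg : Measurable g) : Measurable fun a => consPath (f a) (g a) := by
  refine measurable_pi_lambda _ fun t => ?_
  cases t with
  | zero => exact hf
  | succ t => exact (measurable_pi_apply t).comp hg

theorem extendPath_cons {n : ℕ} (x : State D) (y : Fin n → State D) :
    extendPath (Fin.cons x y : Fin (n + 1) → State D) = consPath x (extendPath y) := by
  funext t
  cases t with
  | zero => rfl
  | succ t =>
    by_cases h : t < n
    · simp only [extendPath, consPath, h, Nat.succ_lt_succ h, dif_pos]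
      exact Fin.cons_succ (α := fun _ => State D) x y ⟨t, h⟩
    · simp [extendPath, consPath, h]

/-- Tonelli for the first coordinate. The integrand is a function of infinite sequences, so the
length of the path does not enter its type and recursions over the horizon need no casts. -/
theorem lintegral_extendPath_succ {n : ℕ} {f : (ℕ → State D) → ENNReal} (hf : Measurable f) :
    ∫⁻ y : Fin (n + 1) → State D, f (extendPath y) =
      ∫⁻ x : State D, ∫⁻ y : Fin n → State D, f (consPath x (extendPath y)) := by
  have h := volume_preserving_piFinSuccAbove (fun _ : Fin (n + 1) => State D) 0
  rw [← h.symm.lintegral_comp_emb (MeasurableEquiv.measurableEmbedding _), Measure.volume_eq_prod,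
    lintegral_prod]
  · refine lintegral_congr fun x => lintegral_congr fun y => ?_
    rw [← extendPath_cons]
    congr 2
    exact Fin.insertNth_zero' x y
  · exact (hf.comp (measurable_extendPath.comp (MeasurableEquiv.measurable _))).aemeasurable

end Path

/-! ### The Kalman form of the twisted proposal -/

namespace AffineGaussianModel

variable {D : ℕ} (M : AffineGaussianModel D)

/-- The lookahead integrand as a function of an infinite sequence of later states. -/
def lookaheadProd (T : ℕ) (u : ℕ → State D) (t : ℕ) (xp x : State D) (y : ℕ → State D) : ℝ :=
  ∏ j ∈ Finset.range (T - t),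
    M.transition (t + j) (consPath xp (consPath x y) j) (consPath xp (consPath x y) (j + 1)) *
      gaussianDensity (u (t + j)) (consPath xp (consPath x y) (j + 1)) (M.auxCov (t + j))

theorem lookaheadIntegrand_eq (T : ℕ) (u : ℕ → State D) (t : ℕ) (xp x : State D)
    (y : Fin (T - t - 1) → State D) :
    M.lookaheadIntegrand T u t xp x y = M.lookaheadProd T u t xp x (extendPath y) := by
  have hz : (fun j : ℕ => match j with
      | 0 => xp
      | 1 => x
      | i + 2 => extendPath y i) = consPath xp (consPath x (extendPath y)) := by
    funext j
    rcases j with _ | _ | j <;> rfl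
  unfold lookaheadIntegrand lookaheadProd
  rw [← hz]

theorem continuous_transitionMean (t : ℕ) : Continuous (M.transitionMean t) := by
  cases t with
  | zero => exact continuous_const
  | succ t => exact (continuous_matVec _).add continuous_const

theorem continuous_transition (t : ℕ) :
    Continuous fun p : State D × State D => M.transition t p.1 p.2 := by
  have h := (continuous_gaussianDensity (M.C t)).comp
    (continuous_snd.prodMk ((M.continuous_transitionMean t).comp continuous_fst))
  exact h

@[fun_prop]
theorem measurable_transition {α : Type*} [MeasurableSpace α] {f g : α → State D}
    (hf : Measurable f) (hg : Measurable g) (t : ℕ) :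
    Measurable fun a => M.transition t (f a) (g a) := by
  have h := (M.continuous_transition t).measurable.comp (hf.prodMk hg)
  exact h

@[fun_prop]
theorem measurable_lookaheadProd {α : Type*} [MeasurableSpace α] {u : α → ℕ → State D}
    {f g : α → State D} {y : α → ℕ → State D} (hu : Measurable u) (hf : Measurable f)
    (hg : Measurable g) (hy : Measurable y) (T t : ℕ) :
    Measurable fun a => M.lookaheadProd T (u a) t (f a) (g a) (y a) := by
  unfold lookaheadProd
  fun_prop

theorem lookaheadProd_succ (T : ℕ) (u : ℕ → State D) {t : ℕ} (ht : t + 1 < T)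
    (xp x x' : State D) (y : ℕ → State D) :
    M.lookaheadProd T u t xp x (consPath x' y) =
      M.transition t xp x * gaussianDensity (u t) x (M.auxCov t) *
        M.lookaheadProd T u (t + 1) x x' y := by
  unfold lookaheadProd
  rw [show T - t = T - (t + 1) + 1 by omega, Finset.prod_range_succ', mul_comm]
  refine congrArg _ (Finset.prod_congr rfl fun j _ => ?_)
  rw [← add_assoc, add_right_comm t j 1]
  rfl

variable {M} {T : ℕ} (hC : ∀ t < T, (M.C t).PosDef) (hδ : ∀ t < T, 0 < M.δ t)

include hδ in
theorem posDef_auxCov {t : ℕ} (ht : t < T) : (M.auxCov t).PosDef :=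
  Matrix.PosDef.one.smul (half_pos (hδ t ht))

include hC in
theorem posDef_priorCov {t : ℕ} (ht : t < T) : (M.priorCov t).PosDef := by
  induction t with
  | zero => exact hC 0 ht
  | succ t ih =>
    rw [priorCov, add_comm]
    exact posDef_add_mul_mul_transpose (ih (by omega)) (hC _ ht) _

theorem revF_eq_gain (t : ℕ) : M.revF t = gain (M.F (t + 1)) (M.priorCov t) (M.C (t + 1)) := by
  rw [revF, gain, priorCov, add_comm (M.C _)]

theorem revC_eq (t : ℕ) : M.revC t =
    (1 - gain (M.F (t + 1)) (M.priorCov t) (M.C (t + 1)) * M.F (t + 1)) * M.priorCov t := by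
  rw [revC, revF_eq_gain, Matrix.sub_mul, Matrix.one_mul]

include hC in
theorem posDef_revC {t : ℕ} (ht : t + 1 < T) : (M.revC t).PosDef := by
  rw [revC_eq]
  exact posDef_conditional_cov (posDef_priorCov hC (by omega)) (hC _ ht) _

include hC in
/-- The time-reversed transitions. -/
theorem prior_mul_transition {t : ℕ} (ht : t + 1 < T) (x x' : State D) :
    gaussianDensity x (M.priorMean t) (M.priorCov t) * M.transition (t + 1) x x' =
      gaussianDensity x' (M.priorMean (t + 1)) (M.priorCov (t + 1)) *
        gaussianDensity x (matVec (M.revF t) x' + M.revb t) (M.revC t) := by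
  have h := gaussianDensity_mul_gaussianDensity (posDef_priorCov hC (by omega : t < T)) (hC _ ht)
    (M.F (t + 1)) (M.priorMean t) (M.b (t + 1)) x x'
  rw [← revF_eq_gain, show (1 - M.revF t * M.F (t + 1)) * M.priorCov t = M.revC t by
    rw [revC_eq, revF_eq_gain], add_comm (M.C _)] at h
  rw [transition, transitionMean, h, priorMean, priorCov]
  congr 2
  rw [revb, matVec_sub, priorMean]
  abel

/-- The swap of conditioning when the state itself is observed: F = 1 and b = 0. -/
theorem gaussianDensity_mul_aux (hδ : ∀ t < T, 0 < M.δ t) {t : ℕ} (ht : t < T)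
    {P : Matrix (Fin D) (Fin D) ℝ} (hP : P.PosDef) (u m x : State D) :
    gaussianDensity x m P * gaussianDensity u x (M.auxCov t) =
      gaussianDensity u m (M.auxCov t + P) *
        gaussianDensity x (M.kalmanUpdate t u m P).1 (M.kalmanUpdate t u m P).2 := by
  have h := gaussianDensity_mul_gaussianDensity hP (posDef_auxCov hδ ht) 1 m 0 x u
  simp only [matVec_one, add_zero, Matrix.one_mul, Matrix.transpose_one, Matrix.mul_one, gain] at h
  rw [h, kalmanUpdate, add_comm P]

include hδ in
theorem posDef_kalmanUpdate {t : ℕ} (ht : t < T)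
    {P : Matrix (Fin D) (Fin D) ℝ} (hP : P.PosDef) (u m : State D) :
    (M.kalmanUpdate t u m P).2.PosDef := by
  have h := posDef_conditional_cov hP (posDef_auxCov hδ ht) 1
  simpa only [Matrix.one_mul, Matrix.transpose_one, Matrix.mul_one, gain, kalmanUpdate,
    add_comm P] using h

theorem revFilter_last (u : ℕ → State D) {t : ℕ} (ht : t + 1 = T) :
    M.revFilter T u (T - 1 - t) = M.kalmanUpdate t (u t) (M.priorMean t) (M.priorCov t) := by
  subst ht
  simp [revFilter]

theorem revFilter_step (u : ℕ → State D) {t : ℕ} (ht : t + 1 < T) :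
    M.revFilter T u (T - 1 - t) =
      M.kalmanUpdate t (u t) (matVec (M.revF t) (M.filterMean T u (t + 1)) + M.revb t)
        (M.revC t + M.revF t * M.filterCov T u (t + 1) * (M.revF t).transpose) := by
  rw [show T - 1 - t = T - 1 - (t + 1) + 1 by omega, revFilter, add_comm (M.revC t)]
  simp only [show T - 1 - (T - 1 - (t + 1) + 1) = t by omega]
  rfl

include hC hδ in
theorem posDef_filterCov (u : ℕ → State D) {t : ℕ} (ht : t < T) :
    (M.filterCov T u t).PosDef := by
  obtain ⟨n, hn⟩ : ∃ n, T = t + n + 1 := ⟨T - t - 1, by omega⟩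
  induction n generalizing t with
  | zero =>
    rw [filterCov, revFilter_last u hn.symm]
    exact posDef_kalmanUpdate hδ ht (posDef_priorCov hC ht) _ _
  | succ n ih =>
    have ht' : t + 1 < T := by omega
    rw [filterCov, revFilter_step u ht']
    exact posDef_kalmanUpdate hδ ht
      (posDef_add_mul_mul_transpose (ih ht' (by omega)) (posDef_revC hC ht') _) _ _

/-- `p(x_t | u_{t:T}) / p(x_t)`. -/
def filterRatio (M : AffineGaussianModel D) (T : ℕ) (u : ℕ → State D) (t : ℕ) (x : State D) : ℝ :=
  gaussianDensity x (M.filterMean T u t) (M.filterCov T u t) /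
    gaussianDensity x (M.priorMean t) (M.priorCov t)

include hC hδ in
theorem filterRatio_pos (u : ℕ → State D) {t : ℕ} (ht : t < T) (x : State D) :
    0 < M.filterRatio T u t x :=
  div_pos (gaussianDensity_pos (posDef_filterCov hC hδ u ht) _ _)
    (gaussianDensity_pos (posDef_priorCov hC ht) _ _)

include hC in
theorem transition_pos {t : ℕ} (ht : t < T) (xp x : State D) : 0 < M.transition t xp x :=
  gaussianDensity_pos (hC t ht) _ _

include hC hδ in
/-- `p(x_{t+1} | x_t) p(x_{t+1} | u_{t+1:T}) / p(x_{t+1})` in terms of the twisted proposal. -/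
theorem transition_mul_filterRatio (u : ℕ → State D) {t : ℕ} (ht : t + 1 < T) (x x' : State D) :
    M.transition (t + 1) x x' * M.filterRatio T u (t + 1) x' =
      gaussianDensity x (matVec (M.revF t) (M.filterMean T u (t + 1)) + M.revb t)
        (M.revC t + M.revF t * M.filterCov T u (t + 1) * (M.revF t).transpose) /
        gaussianDensity x (M.priorMean t) (M.priorCov t) *
      gaussianDensity x' (matVec (M.twistedF T u (t + 1)) x + M.twistedb T u (t + 1))
        (M.twistedC T u (t + 1)) := by
  have h1 := prior_mul_transition hC ht x x'
  -- The second swap: x' has its filtering law, and x plays the role of an observation of x' through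
  -- the reversed transition. The gain of this observation is F'_{t+1}.
  have h2 := gaussianDensity_mul_gaussianDensity (posDef_filterCov hC hδ u ht) (posDef_revC hC ht)
    (M.revF t) (M.filterMean T u (t + 1)) (M.revb t) x' x
  have p1 := gaussianDensity_pos (posDef_priorCov hC (by omega : t < T)) x (M.priorMean t)
  have p2 := gaussianDensity_pos (posDef_priorCov hC ht) x' (M.priorMean (t + 1))
  have h3 : matVec (M.twistedF T u (t + 1)) x + M.twistedb T u (t + 1) =
      M.filterMean T u (t + 1) + matVec (gain (M.revF t) (M.filterCov T u (t + 1)) (M.revC t))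
        (x - (matVec (M.revF t) (M.filterMean T u (t + 1)) + M.revb t)) := by
    rw [matVec_sub, twistedb, twistedF, gain]
    abel
  rw [h3, show M.twistedC T u (t + 1) = (1 - gain (M.revF t) (M.filterCov T u (t + 1))
    (M.revC t) * M.revF t) * M.filterCov T u (t + 1) from rfl, div_mul_eq_mul_div, ← h2,
    filterRatio, eq_div_iff p1.ne', mul_div_assoc', div_mul_eq_mul_div, div_eq_iff p2.ne']
  linear_combination gaussianDensity x' (M.filterMean T u (t + 1)) (M.filterCov T u (t + 1)) * h1

include hC hδ in
theorem posDef_twistedC (u : ℕ → State D) {t : ℕ} (ht : t < T) :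
    (M.twistedC T u t).PosDef := by
  cases t with
  | zero => exact posDef_filterCov hC hδ u ht
  | succ t => exact posDef_conditional_cov (posDef_filterCov hC hδ u ht) (posDef_revC hC ht) _

theorem lintegral_gaussianDensity {S : Matrix (Fin D) (Fin D) ℝ} (hS : S.PosDef) (m : State D) :
    ∫⁻ x, ENNReal.ofReal (gaussianDensity x m S) = 1 := by
  rw [← ofReal_integral_eq_lintegral_ofReal (integrable_gaussianDensity hS m)
    (Filter.Eventually.of_forall fun x => (gaussianDensity_pos hS x m).le),
    integral_gaussianDensity hS, ENNReal.ofReal_one]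

include hC hδ in
-- Backward induction over t for the identity p(u_{t:T} | x_t) = p(u_{t:T}) p(x_t | u_{t:T}) /
-- p(x_t). The constant c is p(u_{t:T}); what matters is that it does not depend on the states.
theorem lintegral_lookaheadProd (u : ℕ → State D) {t : ℕ} (ht : t < T) :
    ∃ c : ℝ, 0 < c ∧ ∀ xp x,
      ∫⁻ y : Fin (T - t - 1) → State D, ENNReal.ofReal (M.lookaheadProd T u t xp x (extendPath y))
        = ENNReal.ofReal (c * (M.transition t xp x * M.filterRatio T u t x)) := by
  obtain ⟨n, hn⟩ : ∃ n, T = t + n + 1 := ⟨T - t - 1, by omega⟩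
  induction n generalizing t with
  | zero =>
    refine ⟨gaussianDensity (u t) (M.priorMean t) (M.auxCov t + M.priorCov t),
      gaussianDensity_pos ((posDef_auxCov hδ ht).add (posDef_priorCov hC ht)) _ _,
      fun xp x => ?_⟩
    rw [show T - t - 1 = 0 by omega, lintegral_unique, Measure.volume_pi_eq_dirac, measure_univ,
      mul_one, lookaheadProd, show T - t = 1 by omega, Finset.prod_range_one]
    have h := gaussianDensity_mul_aux hδ ht (posDef_priorCov hC ht) (u t) (M.priorMean t) x
    have p2 := gaussianDensity_pos (posDef_priorCov hC ht) x (M.priorMean t)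
    rw [← revFilter_last u hn.symm] at h
    congr 1
    change M.transition t xp x * gaussianDensity (u t) x (M.auxCov t) = _
    rw [filterRatio, mul_div_assoc', mul_div_assoc', eq_div_iff p2.ne', filterMean, filterCov]
    linear_combination M.transition t xp x * h
  | succ n ih =>
    have ht' : t + 1 < T := by omega
    obtain ⟨c, hc, h⟩ := ih ht' (by omega)
    set m := matVec (M.revF t) (M.filterMean T u (t + 1)) + M.revb t with hm
    set P := M.revC t + M.revF t * M.filterCov T u (t + 1) * (M.revF t).transpose with hP
    have hPd : P.PosDef :=
      posDef_add_mul_mul_transpose (posDef_filterCov hC hδ u ht') (posDef_revC hC ht') _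
    -- This is p(u_{t+1:T}) p(u_t | u_{t+1:T}): given the later observations, x_t has predictive law
    -- N(m, P), and u_t adds the observation noise.
    refine ⟨c * gaussianDensity (u t) m (M.auxCov t + P),
      mul_pos hc (gaussianDensity_pos ((posDef_auxCov hδ ht).add hPd) _ _), fun xp x => ?_⟩
    have p1 := gaussianDensity_pos (posDef_priorCov hC ht) x (M.priorMean t)
    have p2 := gaussianDensity_pos hPd x m
    have p3 := M.transition_pos hC ht xp x
    have p4 := gaussianDensity_pos (posDef_auxCov hδ ht) (u t) x
    rw [show T - t - 1 = T - (t + 1) - 1 + 1 by omega, lintegral_extendPath_succ (f := fun y =>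
      ENNReal.ofReal (M.lookaheadProd T u t xp x y))]
    · simp_rw [M.lookaheadProd_succ T u ht']
      simp_rw [ENNReal.ofReal_mul (mul_pos p3 p4).le]
      simp_rw [lintegral_const_mul' _ _ ENNReal.ofReal_ne_top]
      simp_rw [h, transition_mul_filterRatio hC hδ u ht', ← hm, ← hP, ← mul_assoc c]
      simp_rw [ENNReal.ofReal_mul (mul_pos hc (div_pos p2 p1)).le]
      -- The next state now enters only through a normalised Gaussian density, which integrates to
      -- 1.
      rw [lintegral_const_mul' _ _ ENNReal.ofReal_ne_top,
        lintegral_gaussianDensity (posDef_twistedC hC hδ u ht'), mul_one,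
        ← ENNReal.ofReal_mul (mul_pos p3 p4).le]
      congr 1
      have h5 := gaussianDensity_mul_aux hδ ht hPd (u t) m x
      rw [← revFilter_step u ht'] at h5
      rw [filterRatio, filterMean, filterCov]
      field_simp
      linear_combination h5
    · fun_prop

include hC hδ in
theorem lookahead_eq (u : ℕ → State D) {t : ℕ} (ht : t < T) :
    ∃ c : ℝ, 0 < c ∧ ∀ xp x,
      M.lookahead T u t xp x = c * (M.transition t xp x * M.filterRatio T u t x) := by
  obtain ⟨c, hc, h⟩ := lintegral_lookaheadProd hC hδ u ht
  refine ⟨c, hc, fun xp x => ?_⟩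
  unfold lookahead
  simp_rw [lookaheadIntegrand_eq]
  rw [integral_eq_lintegral_of_nonneg_ae, h, ENNReal.toReal_ofReal]
  · have := M.transition_pos hC ht xp x
    have := filterRatio_pos hC hδ u ht x
    positivity
  · refine Filter.Eventually.of_forall fun y => Finset.prod_nonneg fun j hj => ?_
    have hj' : t + j < T := by have := Finset.mem_range.1 hj; omega
    exact (mul_pos (M.transition_pos hC hj' _ _)
      (gaussianDensity_pos (posDef_auxCov hδ hj') _ _)).le
  · exact Measurable.aestronglyMeasurable (by fun_prop)

include hC hδ in
/-- The twisted proposal is the affine Gaussian kernel given by the Kalman recursions. -/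
theorem twistedProposal_eq (u : ℕ → State D) {t : ℕ} (ht : t < T) (xp x : State D) :
    M.twistedProposal T u t xp x =
      gaussianDensity x (matVec (M.twistedF T u t) xp + M.twistedb T u t) (M.twistedC T u t) := by
  obtain ⟨c, hc, h⟩ := lookahead_eq hC hδ u ht
  have hd := posDef_twistedC hC hδ u ht
  obtain ⟨a, ha, h'⟩ : ∃ a : ℝ, 0 < a ∧ ∀ x, M.lookahead T u t xp x = a *
      gaussianDensity x (matVec (M.twistedF T u t) xp + M.twistedb T u t) (M.twistedC T u t) := by
    cases t with
    | zero =>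
      -- At the initial time the transition is the prior, so the ratio leaves just the filtering
      -- density.
      refine ⟨c, hc, fun x => ?_⟩
      have p := gaussianDensity_pos (hC 0 ht) x (M.b 0)
      have h0 : matVec (0 : Matrix (Fin D) (Fin D) ℝ) xp = 0 := by simp [matVec]
      rw [h, filterRatio, priorMean, priorCov, transition, transitionMean, twistedF, twistedb,
        twistedC, h0, zero_add, mul_div_cancel₀ _ p.ne']
    | succ t =>
      have hP := posDef_add_mul_mul_transpose (posDef_filterCov hC hδ u ht) (posDef_revC hC ht)
        (M.revF t)
      -- The factor split off depends on `xp` alone and is therefore cancelled by the normalisation.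
      refine ⟨_, mul_pos hc (div_pos (gaussianDensity_pos hP xp
        (matVec (M.revF t) (M.filterMean T u (t + 1)) + M.revb t))
        (gaussianDensity_pos (posDef_priorCov hC (by omega : t < T)) xp (M.priorMean t))),
        fun x => ?_⟩
      rw [h, transition_mul_filterRatio hC hδ u ht, mul_assoc c]
  rw [twistedProposal]
  simp_rw [h']
  rw [integral_const_mul, integral_gaussianDensity hd, mul_one, mul_div_cancel_left₀ _ ha.ne']

@[fun_prop]
theorem measurable_lookahead {α : Type*} [MeasurableSpace α] {u : α → ℕ → State D}
    {f g : α → State D} (hu : Measurable u) (hf : Measurable f) (hg : Measurable g) (T t : ℕ) :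
    Measurable fun a => M.lookahead T (u a) t (f a) (g a) := by
  have : StronglyMeasurable fun p : α × (Fin (T - t - 1) → State D) =>
      M.lookaheadProd T (u p.1) t (f p.1) (g p.1) (extendPath p.2) :=
    Measurable.stronglyMeasurable (by fun_prop)
  unfold lookahead
  simp_rw [lookaheadIntegrand_eq]
  exact this.integral_prod_right'.measurable

@[fun_prop]
theorem measurable_twistedProposal {α : Type*} [MeasurableSpace α] {u : α → ℕ → State D}
    {f g : α → State D} (hu : Measurable u) (hf : Measurable f) (hg : Measurable g) (T t : ℕ) :
    Measurable fun a => M.twistedProposal T (u a) t (f a) (g a) := by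
  have : StronglyMeasurable fun p : α × State D => M.lookahead T (u p.1) t (f p.1) p.2 :=
    Measurable.stronglyMeasurable (by fun_prop)
  exact (measurable_lookahead hu hf hg T t).div this.integral_prod_right'.measurable

end AffineGaussianModel

/-! ### Parametrised measures -/

section MeasureTools

variable {α β γ : Type*} [MeasurableSpace α] [MeasurableSpace β] [MeasurableSpace γ]

/-- The algorithms are built by iterating bind, map and finite products of laws that depend on
parameters. This and the following lemmas carry joint measurability through these constructions. -/
theorem Measurable.lintegral_param {m : α → Measure β} (hm : Measurable m)
    (hm1 : ∀ a, IsProbabilityMeasure (m a)) {f : α → β → ENNReal}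
    (hf : Measurable fun p : α × β => f p.1 p.2) : Measurable fun a => ∫⁻ b, f a b ∂m a := by
  let K : Kernel α β := ⟨m, hm⟩
  have : IsMarkovKernel K := ⟨hm1⟩
  exact Measurable.lintegral_kernel_prod_right (κ := K) hf

theorem Measurable.measure_bind {m : α → Measure β} (hm : Measurable m)
    (hm1 : ∀ a, IsProbabilityMeasure (m a)) {κ : α → β → Measure γ}
    (hκ : Measurable fun p : α × β => κ p.1 p.2) : Measurable fun a => (m a).bind (κ a) := by
  refine Measure.measurable_of_measurable_coe _ fun s hs => ?_
  have h : ∀ a, (m a).bind (κ a) s = ∫⁻ b, κ a b s ∂m a := fun a =>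
    Measure.bind_apply hs (hκ.comp measurable_prodMk_left).aemeasurable
  simp_rw [h]
  exact hm.lintegral_param hm1 ((Measure.measurable_coe hs).comp hκ)

theorem Measurable.measure_map {m : α → Measure β} (hm : Measurable m)
    (hm1 : ∀ a, IsProbabilityMeasure (m a)) {f : α → β → γ}
    (hf : Measurable fun p : α × β => f p.1 p.2) : Measurable fun a => (m a).map (f a) := by
  have h : ∀ a, (m a).map (f a) = (m a).bind fun b => Measure.dirac (f a b) := fun a =>
    (Measure.bind_dirac_eq_map _ (hf.comp measurable_prodMk_left)).symm
  simp_rw [h]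
  exact hm.measure_bind hm1 (Measure.measurable_dirac.comp hf)

/-- It suffices to look at boxes, a generating π-system on which the product law is a finite product
of measurable functions. -/
theorem Measurable.measure_pi {ι : Type*} [Fintype ι] {m : α → ι → Measure β}
    (hm : ∀ i, Measurable fun a => m a i) (hm1 : ∀ a i, IsProbabilityMeasure (m a i)) :
    Measurable fun a => Measure.pi (m a) := by
  refine Measurable.measure_of_isPiSystem_of_isProbabilityMeasure generateFrom_pi.symm
    isPiSystem_pi ?_
  rintro _ ⟨s, hs, rfl⟩
  simp_rw [Measure.pi_pi]
  exact Finset.measurable_prod _ fun i _ =>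
    (Measure.measurable_coe (hs i (Set.mem_univ i))).comp (hm i)

theorem ae_bind {m : Measure α} {κ : α → Measure β} (hκ : Measurable κ) {p : β → Prop}
    (hp : MeasurableSet {b | p b}) (h : ∀ᵐ a ∂m, ∀ᵐ b ∂κ a, p b) : ∀ᵐ b ∂m.bind κ, p b := by
  rw [ae_iff, Measure.bind_apply (by exact hp.compl) hκ.aemeasurable]
  refine lintegral_eq_zero_of_ae_eq_zero ?_
  filter_upwards [h] with a ha using ae_iff.1 ha

theorem ae_pi_dirac {n : ℕ} [MeasurableSingletonClass β] (m : Fin n → Measure β)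
    (hm1 : ∀ i, IsProbabilityMeasure (m i)) (k : Fin n) (x : β) (h : m k = Measure.dirac x) :
    ∀ᵐ z ∂Measure.pi m, z k = x := by
  have h1 : ∀ᵐ y ∂m k, y = x := by rw [h, ae_dirac_eq]; rfl
  exact (measurePreserving_eval m k).quasiMeasurePreserving.ae h1

/-- Sampling one coordinate of a product law first and the others afterwards. -/
theorem lintegral_pi_dirac {n : ℕ} (m : Fin n → Measure β)
    (hm1 : ∀ i, IsProbabilityMeasure (m i)) (k : Fin n) {f : (Fin n → β) → ENNReal}
    (hf : Measurable f) :
    ∫⁻ x, ∫⁻ z, f z ∂Measure.pi (fun i => if i = k then Measure.dirac x else m i) ∂m k =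
      ∫⁻ z, f z ∂Measure.pi m := by
  have hp : ∀ x i, IsProbabilityMeasure (if i = k then Measure.dirac x else m i) := by
    intro x i; split_ifs <;> infer_instance
  have hmeas : Measurable fun x => Measure.pi fun i => if i = k then Measure.dirac x else m i := by
    refine Measurable.measure_pi (fun i => ?_) hp
    split_ifs
    · exact Measure.measurable_dirac
    · exact measurable_const
  rw [← Measure.lintegral_bind hmeas.aemeasurable hf.aemeasurable]
  congr 1
  refine (Measure.pi_eq fun s hs => ?_).symm
  rw [Measure.bind_apply (MeasurableSet.univ_pi hs) hmeas.aemeasurable]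
  have h : ∀ x, (Measure.pi fun i => if i = k then Measure.dirac x else m i) (Set.univ.pi s) =
      (s k).indicator 1 x * ∏ i ∈ Finset.univ.erase k, m i (s i) := by
    intro x
    rw [Measure.pi_pi, ← Finset.mul_prod_erase _ _ (Finset.mem_univ k), if_pos rfl,
      Measure.dirac_apply' _ (hs k)]
    refine congrArg _ (Finset.prod_congr rfl fun i hi => ?_)
    rw [if_neg (Finset.ne_of_mem_erase hi)]
  simp_rw [h]
  rw [lintegral_mul_const _ (measurable_one.indicator (hs k)), lintegral_indicator_one (hs k),
    Finset.mul_prod_erase _ (fun i => m i (s i)) (Finset.mem_univ k)]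

theorem measurable_eval_index {ι : Type*} [Countable ι] [MeasurableSpace ι]
    [DiscreteMeasurableSpace ι] {f : α → ι → β} {i : α → ι} (hf : ∀ j, Measurable fun a => f a j)
    (hi : Measurable i) : Measurable fun a => f a (i a) := by
  have h : Measurable fun p : α × ι => f p.1 p.2 := measurable_from_prod_countable_left hf
  exact h.comp (measurable_id.prodMk hi)

variable {n : ℕ}

theorem lintegral_discreteLaw (p : Fin n → ℝ) (f : Fin n → ENNReal) :
    ∫⁻ i, f i ∂discreteLaw p = ∑ i, ENNReal.ofReal (p i) * f i := by
  simp [discreteLaw]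

theorem isProbabilityMeasure_discreteLaw {p : Fin n → ℝ} (hp : ∀ i, 0 ≤ p i) (h : ∑ i, p i = 1) :
    IsProbabilityMeasure (discreteLaw p) := by
  constructor
  rw [← lintegral_one, lintegral_discreteLaw]
  simp [← ENNReal.ofReal_sum_of_nonneg fun i _ => hp i, h]

theorem measurable_discreteLaw {p : α → Fin n → ℝ} (hp : ∀ i, Measurable fun a => p a i) :
    Measurable fun a => discreteLaw (p a) := by
  refine Measure.measurable_of_measurable_coe _ fun s hs => ?_
  simp only [discreteLaw, Measure.coe_finsetSum, Finset.sum_apply, Measure.smul_apply, smul_eq_mul]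
  exact Finset.measurable_sum _ fun i _ => (hp i).ennreal_ofReal.mul_const _

variable {D : ℕ}

theorem lintegral_lawOfDensity {p : State D → ℝ} (hp : Measurable p) {f : State D → ENNReal}
    (hf : Measurable f) :
    ∫⁻ x, f x ∂lawOfDensity p = ∫⁻ x, ENNReal.ofReal (p x) * f x := by
  rw [lawOfDensity, lintegral_withDensity_eq_lintegral_mul _ hp.ennreal_ofReal hf]
  rfl

theorem isProbabilityMeasure_lawOfDensity {p : State D → ℝ}
    (h : ∫⁻ x, ENNReal.ofReal (p x) = 1) : IsProbabilityMeasure (lawOfDensity p) :=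
  ⟨by rw [lawOfDensity, withDensity_apply _ MeasurableSet.univ, setLIntegral_univ, h]⟩

theorem measurable_lawOfDensity {p : α → State D → ℝ}
    (hp : Measurable fun q : α × State D => p q.1 q.2) :
    Measurable fun a => lawOfDensity (p a) := by
  refine Measure.measurable_of_measurable_coe _ fun s hs => ?_
  simp_rw [lawOfDensity, withDensity_apply _ hs]
  exact hp.ennreal_ofReal.lintegral_prod_right'

/-- Tonelli, by induction over the set of coordinates that have already been integrated out. -/
theorem lintegral_fintype_prod {ι : Type*} [Fintype ι] {m : ι → Measure β}
    [∀ i, SigmaFinite (m i)] {p : ι → β → ENNReal} (hp : ∀ i, Measurable (p i)) :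
    ∫⁻ x, ∏ i, p i (x i) ∂Measure.pi m = ∏ i, ∫⁻ x, p i x ∂m i := by
  classical
  have hmeas : Measurable fun x : ι → β => ∏ i, p i (x i) :=
    Finset.measurable_prod _ fun i _ => (hp i).comp (measurable_pi_apply i)
  have key : ∀ (s : Finset ι) (x : ι → β), (∫⋯∫⁻_s, (fun x => ∏ i, p i (x i)) ∂m) x =
      (∏ i ∈ s, ∫⁻ x, p i x ∂m i) * ∏ i ∈ sᶜ, p i (x i) := by
    intro s
    induction s using Finset.induction_on with
    | empty => simp
    | insert i s hi ih =>
      intro x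
      rw [lmarginal_insert _ hmeas hi, Finset.prod_insert hi]
      have h : sᶜ = insert i (insert i s)ᶜ := by
        ext j; by_cases hj : j = i <;> simp [hj, hi]
      have h2 : ∀ y, ∏ j ∈ sᶜ, p j (Function.update x i y j) =
          p i y * ∏ j ∈ (insert i s)ᶜ, p j (x j) := by
        intro y
        rw [h, Finset.prod_insert (by simp), Function.update_self]
        refine congrArg _ (Finset.prod_congr rfl fun j hj => ?_)
        rw [Function.update_of_ne]
        rintro rfl
        simp at hj
      simp_rw [ih, h2, ← mul_assoc]
      rw [lintegral_mul_const _ ((hp i).const_mul _), lintegral_const_mul _ (hp i)]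
      ring
  -- Marginals are evaluated at a point. If there is none, some factor space is empty and both sides
  -- vanish.
  rcases isEmpty_or_nonempty (ι → β) with h | ⟨⟨x⟩⟩
  · obtain ⟨i, hi⟩ : ∃ i : ι, IsEmpty β := by simpa using h
    rw [lintegral_of_isEmpty, Finset.prod_eq_zero (Finset.mem_univ i) (lintegral_of_isEmpty _ _)]
  · rw [lintegral_eq_lmarginal_univ x, key]
    simp

theorem lintegral_pi_withDensity {ι : Type*} [Fintype ι] {p : ι → State D → ENNReal}
    (hp : ∀ i, Measurable (p i)) (h1 : ∀ i, ∫⁻ x, p i x = 1)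
    {f : (ι → State D) → ENNReal} (hf : Measurable f) :
    ∫⁻ x, f x ∂Measure.pi (fun i => volume.withDensity (p i)) = ∫⁻ x, (∏ i, p i (x i)) * f x := by
  have hmeas : Measurable fun x : ι → State D => ∏ i, p i (x i) :=
    Finset.measurable_prod _ fun i _ => (hp i).comp (measurable_pi_apply i)
  have hprob : ∀ i, IsProbabilityMeasure (volume.withDensity (p i)) := fun i =>
    ⟨by rw [withDensity_apply _ MeasurableSet.univ, setLIntegral_univ, h1 i]⟩
  have h : Measure.pi (fun i => volume.withDensity (p i)) =
      (volume : Measure (ι → State D)).withDensity fun x => ∏ i, p i (x i) := by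
    refine Measure.pi_eq fun s hs => ?_
    rw [withDensity_apply _ (MeasurableSet.univ_pi hs), volume_pi, Measure.restrict_pi_pi,
      lintegral_fintype_prod hp]
    exact Finset.prod_congr rfl fun i _ => (withDensity_apply _ (hs i)).symm
  rw [h, lintegral_withDensity_eq_lintegral_mul _ hmeas hf]
  rfl

end MeasureTools

/-! ### Measurability of conditional sequential Monte Carlo -/

namespace ParticleSystem

variable {N D : ℕ} {α : Type*} [MeasurableSpace α] {S : α → ParticleSystem N D}

@[fun_prop]
theorem measurable_refIndex (hS : Measurable S) (t : ℕ) : Measurable fun a => (S a).refIndex t :=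
  (measurable_pi_apply t).comp (measurable_fst.comp hS)

@[fun_prop]
theorem measurable_ancestor (hS : Measurable S) (t : ℕ) (n : Fin (N + 1)) :
    Measurable fun a => (S a).ancestor t n :=
  (measurable_pi_apply n).comp ((measurable_pi_apply t).comp
    (measurable_fst.comp (measurable_snd.comp hS)))

@[fun_prop]
theorem measurable_particle (hS : Measurable S) (t : ℕ) (n : Fin (N + 1)) :
    Measurable fun a => (S a).particle t n :=
  (measurable_pi_apply n).comp ((measurable_pi_apply t).comp
    (measurable_snd.comp (measurable_snd.comp hS)))

@[fun_prop]
theorem measurable_parent (hS : Measurable S) (t : ℕ) (n : Fin (N + 1)) :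
    Measurable fun a => (S a).parent t n := by
  cases t with
  | zero => exact measurable_const
  | succ t =>
    have h := measurable_eval_index (fun j => measurable_particle hS t j) (measurable_ancestor hS t n)
    exact h

@[fun_prop]
theorem measurable_grandparent (hS : Measurable S) (t : ℕ) (n : Fin (N + 1)) :
    Measurable fun a => (S a).grandparent t n := by
  cases t with
  | zero => exact measurable_const
  | succ t =>
    have h := measurable_eval_index (fun j => measurable_parent hS t j) (measurable_ancestor hS t n)
    exact h

/-- The system after an initial step. -/
def init (S : ParticleSystem N D) (k : Fin (N + 1)) (z : Fin (N + 1) → State D) :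
    ParticleSystem N D :=
  (Function.update S.refIndex 0 k, S.ancestor, Function.update S.particle 0 z)

/-- The system after a step to time `t + 1`. -/
def extend (t : ℕ) (S : ParticleSystem N D) (k : Fin (N + 1)) (a : Fin (N + 1) → Fin (N + 1))
    (z : Fin (N + 1) → State D) : ParticleSystem N D :=
  (Function.update S.refIndex (t + 1) k, Function.update S.ancestor t a,
    Function.update S.particle (t + 1) z)

@[fun_prop]
theorem measurable_init (hS : Measurable S) {k : α → Fin (N + 1)} (hk : Measurable k)
    {z : α → Fin (N + 1) → State D} (hz : Measurable z) :
    Measurable fun a => init (S a) (k a) (z a) :=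
  (measurable_update'.comp ((measurable_fst.comp hS).prodMk hk)).prodMk
    ((measurable_fst.comp (measurable_snd.comp hS)).prodMk
      (measurable_update'.comp ((measurable_snd.comp (measurable_snd.comp hS)).prodMk hz)))

@[fun_prop]
theorem measurable_extend (t : ℕ) (hS : Measurable S) {k : α → Fin (N + 1)} (hk : Measurable k)
    {b : α → Fin (N + 1) → Fin (N + 1)} (hb : Measurable b)
    {z : α → Fin (N + 1) → State D} (hz : Measurable z) :
    Measurable fun a => extend t (S a) (k a) (b a) (z a) :=
  (measurable_update'.comp ((measurable_fst.comp hS).prodMk hk)).prodMk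
    ((measurable_update'.comp ((measurable_fst.comp (measurable_snd.comp hS)).prodMk hb)).prodMk
      (measurable_update'.comp ((measurable_snd.comp (measurable_snd.comp hS)).prodMk hz)))

end ParticleSystem

namespace CSMCIngredients

open ParticleSystem

/-- A measurable family of ingredients with positive potentials and backward weights, whose
proposals are probability densities, at times before `T`. -/
structure IsRegular {α : Type*} [MeasurableSpace α] {D : ℕ} (A : α → CSMCIngredients D) (T : ℕ) :
    Prop where
  proposal_nonneg : ∀ a, ∀ t < T, ∀ xp x, 0 ≤ (A a).proposal t xp x
  lintegral_proposal : ∀ a, ∀ t < T, ∀ xp, ∫⁻ x, ENNReal.ofReal ((A a).proposal t xp x) = 1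
  potential_pos : ∀ a, ∀ t < T, ∀ xpp xp x, 0 < (A a).potential t xpp xp x
  backward_pos : ∀ a t, t + 1 < T → ∀ xp x xn xnn, 0 < (A a).backward t xp x xn xnn
  measurable_proposal : ∀ t < T, Measurable fun p : α × State D × State D =>
    (A p.1).proposal t p.2.1 p.2.2
  measurable_potential : ∀ t < T, Measurable fun p : α × State D × State D × State D =>
    (A p.1).potential t p.2.1 p.2.2.1 p.2.2.2
  measurable_backward : ∀ t, t + 1 < T → Measurable
    fun p : α × State D × State D × State D × State D =>
      (A p.1).backward t p.2.1 p.2.2.1 p.2.2.2.1 p.2.2.2.2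

variable {N D T : ℕ} {α : Type*} [MeasurableSpace α] {A : α → CSMCIngredients D}

/-- The parameter of the family can be enlarged by freshly sampled variables, or frozen by a
constant map. Measurability therefore only has to be stated for objects that depend on the one
parameter of the family. -/
theorem IsRegular.comp {β : Type*} [MeasurableSpace β] (hA : IsRegular A T) {φ : β → α}
    (hφ : Measurable φ) : IsRegular (fun b => A (φ b)) T where
  proposal_nonneg b := hA.proposal_nonneg (φ b)
  lintegral_proposal b := hA.lintegral_proposal (φ b)
  potential_pos b := hA.potential_pos (φ b)
  backward_pos b := hA.backward_pos (φ b)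
  measurable_proposal t ht := (hA.measurable_proposal t ht).comp
    ((hφ.comp measurable_fst).prodMk measurable_snd)
  measurable_potential t ht := (hA.measurable_potential t ht).comp
    ((hφ.comp measurable_fst).prodMk measurable_snd)
  measurable_backward t ht := (hA.measurable_backward t ht).comp
    ((hφ.comp measurable_fst).prodMk measurable_snd)

theorem IsRegular.measurable_proposal_comp (hA : IsRegular A T) {t : ℕ} (ht : t < T)
    {f g : α → State D} (hf : Measurable f) (hg : Measurable g) :
    Measurable fun a => (A a).proposal t (f a) (g a) :=
  (hA.measurable_proposal t ht).comp (measurable_id.prodMk (hf.prodMk hg))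

theorem IsRegular.measurable_potential_comp (hA : IsRegular A T) {t : ℕ} (ht : t < T)
    {f g h : α → State D} (hf : Measurable f) (hg : Measurable g) (hh : Measurable h) :
    Measurable fun a => (A a).potential t (f a) (g a) (h a) :=
  (hA.measurable_potential t ht).comp (measurable_id.prodMk (hf.prodMk (hg.prodMk hh)))

theorem IsRegular.measurable_backward_comp (hA : IsRegular A T) {t : ℕ} (ht : t + 1 < T)
    {f g h k : α → State D} (hf : Measurable f) (hg : Measurable g) (hh : Measurable h)
    (hk : Measurable k) : Measurable fun a => (A a).backward t (f a) (g a) (h a) (k a) :=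
  (hA.measurable_backward t ht).comp
    (measurable_id.prodMk (hf.prodMk (hg.prodMk (hh.prodMk hk))))

section Probability

variable (hA : IsRegular A T) (a : α) (S : ParticleSystem N D) {t : ℕ}

include hA

theorem IsRegular.weight_pos (ht : t < T) (n : Fin (N + 1)) : 0 < (A a).weight S t n :=
  hA.potential_pos a t ht _ _ _

theorem IsRegular.sum_weight_pos (ht : t < T) : 0 < ∑ m, (A a).weight S t m :=
  Finset.sum_pos (fun n _ => hA.weight_pos a S ht n) Finset.univ_nonempty

theorem IsRegular.normWeight_pos (ht : t < T) (n : Fin (N + 1)) : 0 < (A a).normWeight S t n :=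
  div_pos (hA.weight_pos a S ht n) (hA.sum_weight_pos a S ht)

theorem IsRegular.sum_normWeight (ht : t < T) : ∑ n, (A a).normWeight S t n = 1 := by
  unfold normWeight
  rw [← Finset.sum_div, div_self (hA.sum_weight_pos a S ht).ne']

/-- A second particle of positive weight exists. This keeps the denominators 1 - W of the forced
move positive. -/
theorem IsRegular.normWeight_lt_one (hN : 1 ≤ N) (ht : t < T) (n : Fin (N + 1)) :
    (A a).normWeight S t n < 1 := by
  obtain ⟨m, hm⟩ : ∃ m : Fin (N + 1), m ≠ n := by
    have : Nontrivial (Fin (N + 1)) := Fin.nontrivial_iff_two_le.2 (by omega)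
    exact exists_ne n
  rw [← hA.sum_normWeight a S ht]
  exact Finset.single_lt_sum hm (Finset.mem_univ n) (Finset.mem_univ m)
    (hA.normWeight_pos a S ht m) fun k _ _ => (hA.normWeight_pos a S ht k).le

theorem IsRegular.isProbabilityMeasure_proposal (ht : t < T) (xp : State D) :
    IsProbabilityMeasure (lawOfDensity ((A a).proposal t xp)) :=
  isProbabilityMeasure_lawOfDensity (hA.lintegral_proposal a t ht xp)

theorem IsRegular.isProbabilityMeasure_particle (ht : t < T) (k : Fin (N + 1)) (x : State D)
    (p : Fin (N + 1) → State D) (n : Fin (N + 1)) : IsProbabilityMeasure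
      (if n = k then Measure.dirac x else lawOfDensity ((A a).proposal t (p n))) := by
  have := hA.isProbabilityMeasure_proposal a ht (p n)
  split_ifs <;> infer_instance

theorem IsRegular.isProbabilityMeasure_particleLaw (ht : t < T) (k : Fin (N + 1)) (x : State D)
    (p : Fin (N + 1) → State D) : IsProbabilityMeasure ((A a).particleLaw t k x p) := by
  have := hA.isProbabilityMeasure_particle a ht k x p
  unfold particleLaw
  infer_instance

theorem IsRegular.isProbabilityMeasure_index (ht : t < T) :
    IsProbabilityMeasure (discreteLaw ((A a).normWeight S t)) :=
  isProbabilityMeasure_discreteLaw (fun i => (hA.normWeight_pos a S ht i).le)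
    (hA.sum_normWeight a S ht)

theorem IsRegular.isProbabilityMeasure_ancestor (ht : t < T) (k n : Fin (N + 1)) :
    IsProbabilityMeasure (if n = k then Measure.dirac (S.refIndex t) else
      discreteLaw ((A a).normWeight S t)) := by
  have := hA.isProbabilityMeasure_index a S ht
  split_ifs <;> infer_instance

theorem IsRegular.isProbabilityMeasure_ancestorLaw (ht : t < T) (k : Fin (N + 1)) :
    IsProbabilityMeasure ((A a).ancestorLaw S t k) := by
  have := hA.isProbabilityMeasure_ancestor a S ht k
  unfold ancestorLaw
  infer_instance

end Probability

theorem isProbabilityMeasure_uniform :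
    IsProbabilityMeasure (discreteLaw fun _ : Fin (N + 1) => 1 / ((N : ℝ) + 1)) := by
  refine isProbabilityMeasure_discreteLaw (fun _ => by positivity) ?_
  have : (N : ℝ) + 1 ≠ 0 := by positivity
  simp [this]

section Measurability

variable (hA : IsRegular A T) {S : α → ParticleSystem N D} (hS : Measurable S) {t : ℕ}

include hA

theorem IsRegular.measurable_particleLaw (ht : t < T) {k : α → Fin (N + 1)} (hk : Measurable k)
    {x : α → State D} (hx : Measurable x) {p : α → Fin (N + 1) → State D} (hp : Measurable p) :
    Measurable fun a => (A a).particleLaw t (k a) (x a) (p a) := by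
  refine Measurable.measure_pi (fun n => ?_)
    fun a n => hA.isProbabilityMeasure_particle a ht (k a) (x a) (p a) n
  refine Measurable.ite (measurableSet_eq_fun measurable_const hk)
    (Measure.measurable_dirac.comp hx) (measurable_lawOfDensity ?_)
  exact (hA.comp measurable_fst).measurable_proposal_comp ht
    (by fun_prop) measurable_snd

include hS

theorem IsRegular.measurable_weight (ht : t < T) (n : Fin (N + 1)) :
    Measurable fun a => (A a).weight (S a) t n :=
  hA.measurable_potential_comp ht (measurable_grandparent hS t n) (measurable_parent hS t n)
    (measurable_particle hS t n)

theorem IsRegular.measurable_normWeight (ht : t < T) (n : Fin (N + 1)) :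
    Measurable fun a => (A a).normWeight (S a) t n :=
  (hA.measurable_weight hS ht n).div
    (Finset.measurable_sum _ fun m _ => hA.measurable_weight hS ht m)

theorem IsRegular.measurable_ancestorLaw (ht : t < T) {k : α → Fin (N + 1)} (hk : Measurable k) :
    Measurable fun a => (A a).ancestorLaw (S a) t (k a) := by
  refine Measurable.measure_pi (fun n => ?_)
    fun a n => hA.isProbabilityMeasure_ancestor a (S a) ht (k a) n
  exact Measurable.ite (measurableSet_eq_fun measurable_const hk)
    (Measure.measurable_dirac.comp (measurable_refIndex hS t))
    (measurable_discreteLaw fun i => hA.measurable_normWeight hS ht i)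

end Measurability

end CSMCIngredients

namespace CSMCIngredients

open ParticleSystem

variable {N D T : ℕ} {α : Type*} [MeasurableSpace α] {A : α → CSMCIngredients D}

/-! #### Forward pass -/

theorem forwardStep_zero (A : CSMCIngredients D) (x : ℕ → State D) (S : ParticleSystem N D) :
    A.forwardStep x 0 S = (discreteLaw fun _ : Fin (N + 1) => 1 / ((N : ℝ) + 1)).bind fun k =>
      (A.particleLaw 0 k (x 0) fun _ => 0).map fun z => init S k z := rfl

theorem forwardStep_succ (A : CSMCIngredients D) (x : ℕ → State D) (t : ℕ)
    (S : ParticleSystem N D) :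
    A.forwardStep x (t + 1) S = (discreteLaw fun _ : Fin (N + 1) => 1 / ((N : ℝ) + 1)).bind fun k =>
      (A.ancestorLaw S t k).bind fun a =>
        (A.particleLaw (t + 1) k (x (t + 1)) fun n => S.particle t (a n)).map fun z =>
          extend t S k a z := rfl

theorem IsRegular.measurable_ancestor_step (hA : IsRegular A T) {t : ℕ} (ht : t + 1 < T)
    {x : α → State D} (hx : Measurable x) {S : α → ParticleSystem N D} (hS : Measurable S)
    {k : α → Fin (N + 1)} (hk : Measurable k)
    {b : α → Fin (N + 1) → Fin (N + 1)} (hb : Measurable b) :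
    Measurable fun a => ((A a).particleLaw (t + 1) (k a) (x a)
      fun n => (S a).particle t (b a n)).map fun z => extend t (S a) (k a) (b a) z := by
  refine Measurable.measure_map (hA.measurable_particleLaw ht hk hx ?_)
    (fun a => hA.isProbabilityMeasure_particleLaw a ht _ _ _) ?_
  · exact measurable_pi_lambda _ fun n => measurable_eval_index
      (fun j => measurable_particle hS t j) ((measurable_pi_apply n).comp hb)
  · fun_prop

theorem IsRegular.measurable_index_step (hA : IsRegular A T) {t : ℕ} (ht : t + 1 < T)
    {x : α → State D} (hx : Measurable x) {S : α → ParticleSystem N D} (hS : Measurable S)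
    {k : α → Fin (N + 1)} (hk : Measurable k) :
    Measurable fun a => ((A a).ancestorLaw (S a) t (k a)).bind fun b =>
      ((A a).particleLaw (t + 1) (k a) (x a)
        fun n => (S a).particle t (b n)).map fun z => extend t (S a) (k a) b z := by
  refine Measurable.measure_bind (hA.measurable_ancestorLaw hS (by omega) hk)
    (fun a => hA.isProbabilityMeasure_ancestorLaw a _ (by omega) _) ?_
  exact (hA.comp measurable_fst).measurable_ancestor_step ht (hx.comp measurable_fst)
    (hS.comp measurable_fst) (hk.comp measurable_fst) measurable_snd

theorem IsRegular.measurable_forwardStep (hA : IsRegular A T) {t : ℕ} (ht : t < T)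
    {x : α → ℕ → State D} (hx : Measurable x) {S : α → ParticleSystem N D} (hS : Measurable S) :
    Measurable fun a => (A a).forwardStep (x a) t (S a) := by
  cases t with
  | zero =>
    simp_rw [forwardStep_zero]
    refine Measurable.measure_bind measurable_const (fun _ => isProbabilityMeasure_uniform) ?_
    refine Measurable.measure_map ((hA.comp measurable_fst).measurable_particleLaw ht
      measurable_snd (by fun_prop) measurable_const)
      (fun p => hA.isProbabilityMeasure_particleLaw p.1 ht _ _ _) ?_
    fun_prop
  | succ t =>
    simp_rw [forwardStep_succ]
    refine Measurable.measure_bind measurable_const (fun _ => isProbabilityMeasure_uniform) ?_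
    exact (hA.comp measurable_fst).measurable_index_step ht (by fun_prop) (hS.comp measurable_fst)
      measurable_snd

theorem lintegral_forwardStep_zero (A : CSMCIngredients D) (x : ℕ → State D)
    (S : ParticleSystem N D) {f : ParticleSystem N D → ENNReal}
    (hf : Measurable f) : ∫⁻ S', f S' ∂A.forwardStep x 0 S =
      ENNReal.ofReal (1 / ((N : ℝ) + 1)) * ∑ k,
        ∫⁻ z, f (init S k z) ∂A.particleLaw 0 k (x 0) fun _ => 0 := by
  have h1 : Measurable fun k : Fin (N + 1) =>
      (A.particleLaw 0 k (x 0) fun _ => 0).map fun z => init S k z := measurable_of_finite _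
  rw [forwardStep_zero, Measure.lintegral_bind h1.aemeasurable hf.aemeasurable,
    lintegral_discreteLaw, Finset.mul_sum]
  refine Finset.sum_congr rfl fun k _ => ?_
  rw [lintegral_map hf (by fun_prop)]

theorem lintegral_forwardStep_succ (A : CSMCIngredients D) (x : ℕ → State D)
    (S : ParticleSystem N D) (t : ℕ)
    {f : ParticleSystem N D → ENNReal}
    (hf : Measurable f) : ∫⁻ S', f S' ∂A.forwardStep x (t + 1) S =
      ENNReal.ofReal (1 / ((N : ℝ) + 1)) * ∑ k, ∫⁻ b, ∫⁻ z, f (extend t S k b z)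
        ∂A.particleLaw (t + 1) k (x (t + 1)) (fun n => S.particle t (b n))
          ∂A.ancestorLaw S t k := by
  have h1 : Measurable fun k : Fin (N + 1) => (A.ancestorLaw S t k).bind fun b =>
      (A.particleLaw (t + 1) k (x (t + 1))
        fun n => S.particle t (b n)).map fun z => extend t S k b z := measurable_of_finite _
  rw [forwardStep_succ, Measure.lintegral_bind h1.aemeasurable hf.aemeasurable,
    lintegral_discreteLaw, Finset.mul_sum]
  refine Finset.sum_congr rfl fun k _ => ?_
  have h2 : Measurable fun b : Fin (N + 1) → Fin (N + 1) =>
      (A.particleLaw (t + 1) k (x (t + 1))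
        fun n => S.particle t (b n)).map fun z => extend t S k b z := measurable_of_finite _
  rw [Measure.lintegral_bind h2.aemeasurable hf.aemeasurable]
  refine congrArg _ (lintegral_congr fun b => ?_)
  rw [lintegral_map hf (by fun_prop)]

section Fixed

variable (hA : IsRegular A T) (a : α) (x : ℕ → State D) (S : ParticleSystem N D)

include hA

theorem IsRegular.isProbabilityMeasure_forwardStep {t : ℕ} (ht : t < T) :
    IsProbabilityMeasure ((A a).forwardStep x t S) := by
  have := isProbabilityMeasure_uniform (N := N)
  cases t with
  | zero =>
    rw [forwardStep_zero]
    refine isProbabilityMeasure_bind (measurable_of_finite _).aemeasurable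
      (Filter.Eventually.of_forall fun k => ?_)
    have := hA.isProbabilityMeasure_particleLaw a ht k (x 0) fun _ => 0
    exact Measure.isProbabilityMeasure_map (by fun_prop)
  | succ t =>
    rw [forwardStep_succ]
    refine isProbabilityMeasure_bind (measurable_of_finite _).aemeasurable
      (Filter.Eventually.of_forall fun k => ?_)
    have := hA.isProbabilityMeasure_ancestorLaw a S (by omega : t < T) k
    refine isProbabilityMeasure_bind (measurable_of_finite _).aemeasurable
      (Filter.Eventually.of_forall fun b => ?_)
    have := hA.isProbabilityMeasure_particleLaw a ht k (x (t + 1)) fun n => S.particle t (b n)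
    exact Measure.isProbabilityMeasure_map (by fun_prop)

end Fixed

theorem IsRegular.measurable_forwardStep_fixed (hA : IsRegular A T) (a : α) (x : ℕ → State D)
    {t : ℕ} (ht : t < T) : Measurable ((A a).forwardStep (N := N) x t) :=
  (hA.comp (measurable_const (a := a))).measurable_forwardStep ht measurable_const measurable_id

theorem IsRegular.isProbabilityMeasure_forwardLaw (hA : IsRegular A T) (a : α) (x : ℕ → State D)
    {t : ℕ} (ht : t ≤ T) : IsProbabilityMeasure ((A a).forwardLaw N x t) := by
  induction t with
  | zero => exact Measure.dirac.isProbabilityMeasure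
  | succ t ih =>
    have := ih (by omega)
    exact isProbabilityMeasure_bind (hA.measurable_forwardStep_fixed a x ht).aemeasurable
      (Filter.Eventually.of_forall fun S => hA.isProbabilityMeasure_forwardStep a x S ht)

theorem IsRegular.measurable_forwardLaw (hA : IsRegular A T) {t : ℕ} (ht : t ≤ T)
    {x : α → ℕ → State D} (hx : Measurable x) :
    Measurable fun a => (A a).forwardLaw N (x a) t := by
  induction t with
  | zero => exact measurable_const
  | succ t ih =>
    refine Measurable.measure_bind (ih (by omega))
      (fun a => hA.isProbabilityMeasure_forwardLaw a _ (by omega)) ?_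
    exact (hA.comp measurable_fst).measurable_forwardStep ht (hx.comp measurable_fst) measurable_snd

/-! #### Final index -/

theorem lintegral_finalIndexLaw (A : CSMCIngredients D) (t : ℕ) (S : ParticleSystem N D)
    (f : Fin (N + 1) → ENNReal) :
    ∫⁻ i, f i ∂A.finalIndexLaw S t =
      ∑ i, ENNReal.ofReal (if i = S.refIndex t then 0 else
        A.normWeight S t i / (1 - A.normWeight S t (S.refIndex t))) *
        (ENNReal.ofReal (min 1 ((1 - A.normWeight S t (S.refIndex t)) /
          (1 - A.normWeight S t i))) * f i +
        ENNReal.ofReal (1 - min 1 ((1 - A.normWeight S t (S.refIndex t)) /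
          (1 - A.normWeight S t i))) * f (S.refIndex t)) := by
  rw [finalIndexLaw, Measure.lintegral_bind (measurable_of_finite _).aemeasurable
    (measurable_of_finite _).aemeasurable, lintegral_discreteLaw]
  refine Finset.sum_congr rfl fun i _ => ?_
  rw [lintegral_add_measure, lintegral_smul_measure, lintegral_smul_measure, lintegral_dirac,
    lintegral_dirac, smul_eq_mul, smul_eq_mul]

section Final

variable (hA : IsRegular A T) {t : ℕ}

include hA

theorem IsRegular.acceptance_mem (hN : 1 ≤ N) (ht : t < T) (a : α) (S : ParticleSystem N D)
    (i k : Fin (N + 1)) :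
    0 ≤ min 1 ((1 - (A a).normWeight S t k) / (1 - (A a).normWeight S t i)) ∧
    min 1 ((1 - (A a).normWeight S t k) / (1 - (A a).normWeight S t i)) ≤ 1 := by
  have h1 := hA.normWeight_lt_one a S hN ht i
  have h2 := hA.normWeight_lt_one a S hN ht k
  exact ⟨le_min zero_le_one (div_nonneg (by linarith) (by linarith)), min_le_left _ _⟩

theorem IsRegular.sum_proposal_finalIndex (hN : 1 ≤ N) (ht : t < T) (a : α)
    (S : ParticleSystem N D) (k : Fin (N + 1)) :
    ∑ i, (if i = k then 0 else (A a).normWeight S t i / (1 - (A a).normWeight S t k)) = 1 := by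
  have h2 := hA.normWeight_lt_one a S hN ht k
  have h3 := hA.sum_normWeight a S ht
  rw [← Finset.add_sum_erase _ _ (Finset.mem_univ k)] at h3 ⊢
  rw [if_pos rfl, zero_add, Finset.sum_congr rfl fun i hi => if_neg (Finset.ne_of_mem_erase hi),
    ← Finset.sum_div, div_eq_one_iff_eq (by linarith)]
  linarith

theorem IsRegular.isProbabilityMeasure_finalIndexLaw (hN : 1 ≤ N) (ht : t < T) (a : α)
    (S : ParticleSystem N D) : IsProbabilityMeasure ((A a).finalIndexLaw S t) := by
  constructor
  rw [← lintegral_one, lintegral_finalIndexLaw]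
  have h2 := hA.normWeight_lt_one a S hN ht (S.refIndex t)
  calc _ = ∑ i, ENNReal.ofReal (if i = S.refIndex t then 0 else
        (A a).normWeight S t i / (1 - (A a).normWeight S t (S.refIndex t))) := by
        refine Finset.sum_congr rfl fun i _ => ?_
        obtain ⟨h3, h4⟩ := hA.acceptance_mem hN ht a S i (S.refIndex t)
        rw [mul_one, mul_one, ← ENNReal.ofReal_add h3 (by linarith), add_sub_cancel,
          ENNReal.ofReal_one, mul_one]
    _ = 1 := by
        rw [← ENNReal.ofReal_sum_of_nonneg, hA.sum_proposal_finalIndex hN ht, ENNReal.ofReal_one]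
        intro i _
        have := hA.normWeight_pos a S ht i
        split_ifs
        · exact le_rfl
        · exact div_nonneg this.le (by linarith)

theorem IsRegular.measurable_finalIndexLaw (ht : t < T) {S : α → ParticleSystem N D}
    (hS : Measurable S) : Measurable fun a => (A a).finalIndexLaw (S a) t := by
  refine Measure.measurable_of_measurable_coe _ fun s hs => ?_
  simp_rw [← lintegral_indicator_one hs, lintegral_finalIndexLaw]
  have hW := fun i => hA.measurable_normWeight hS ht i
  have hk := measurable_refIndex hS t
  have hWk : Measurable fun a => (A a).normWeight (S a) t ((S a).refIndex t) :=
    measurable_eval_index hW hk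
  refine Finset.measurable_sum _ fun i _ => ?_
  have hm : Measurable fun a => min 1 ((1 - (A a).normWeight (S a) t ((S a).refIndex t)) /
      (1 - (A a).normWeight (S a) t i)) :=
    measurable_const.min ((measurable_const.sub hWk).div (measurable_const.sub (hW i)))
  refine Measurable.mul (Measurable.ennreal_ofReal (Measurable.ite
    (measurableSet_eq_fun measurable_const hk) measurable_const
      ((hW i).div (measurable_const.sub hWk)))) ?_
  have hs' : Measurable fun a => s.indicator (1 : Fin (N + 1) → ENNReal) ((S a).refIndex t) :=
    (measurable_of_finite (s.indicator 1)).comp hk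
  exact (hm.ennreal_ofReal.mul_const _).add ((measurable_const.sub hm).ennreal_ofReal.mul hs')

/-- The forced move leaves the weights invariant. -/
theorem IsRegular.sum_normWeight_mul_finalIndexLaw (hN : 1 ≤ N) (ht : t < T) (a : α)
    (S : Fin (N + 1) → ParticleSystem N D) (W : Fin (N + 1) → ℝ)
    (hS : ∀ k, (S k).refIndex t = k) (hW : ∀ k i, (A a).normWeight (S k) t i = W i)
    (f : Fin (N + 1) → ENNReal) :
    ∑ k, ENNReal.ofReal (W k) * ∫⁻ i, f i ∂(A a).finalIndexLaw (S k) t =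
      ∑ k, ENNReal.ofReal (W k) * f k := by
  have hW0 : ∀ i, 0 < W i := fun i => by rw [← hW 0]; exact hA.normWeight_pos a _ ht i
  have hW1 : ∀ i, W i < 1 := fun i => by rw [← hW 0]; exact hA.normWeight_lt_one a _ hN ht i
  set α := fun k i => min 1 ((1 - W k) / (1 - W i)) with hα
  set r := fun k i => if i = k then 0 else W i / (1 - W k) with hr
  have hα0 : ∀ k i, 0 ≤ α k i ∧ α k i ≤ 1 := by
    intro k i; have := hA.acceptance_mem hN ht a (S 0) i k; simpa only [hW] using this
  have hr0 : ∀ k i, 0 ≤ r k i := by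
    intro k i
    simp only [hr]
    split_ifs
    · exact le_rfl
    · exact div_nonneg (hW0 i).le (by linarith [hW1 k])
  have hr1 : ∀ k, ∑ i, r k i = 1 := by
    intro k; have := hA.sum_proposal_finalIndex hN ht a (S 0) k; simpa only [hW] using this
  -- Detailed balance: for i ≠ k both sides equal W_k W_i / max(1 - W_k, 1 - W_i).
  have hsymm : ∀ k i, W k * (r k i * α k i) = W i * (r i k * α i k) := by
    intro k i
    by_cases h : i = k
    · rw [h]
    have h1 : 0 < 1 - W k := by linarith [hW1 k]
    have h2 : 0 < 1 - W i := by linarith [hW1 i]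
    simp only [hr, hα, if_neg h, if_neg (Ne.symm h)]
    rcases le_total (1 - W k) (1 - W i) with h3 | h3
    · rw [min_eq_right ((div_le_one h2).2 h3), min_eq_left ((one_le_div h1).2 h3)]
      field_simp
    · rw [min_eq_left ((one_le_div h2).2 h3), min_eq_right ((div_le_one h1).2 h3)]
      field_simp
  have e1 : ∀ k, ∫⁻ i, f i ∂(A a).finalIndexLaw (S k) t =
      ∑ i, (ENNReal.ofReal (r k i * α k i) * f i + ENNReal.ofReal (r k i * (1 - α k i)) * f k) := by
    intro k
    rw [lintegral_finalIndexLaw]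
    simp only [hS, hW]
    refine Finset.sum_congr rfl fun i _ => ?_
    rw [mul_add, ← mul_assoc, ← mul_assoc, ← ENNReal.ofReal_mul (hr0 k i),
      ← ENNReal.ofReal_mul (hr0 k i)]
  simp_rw [e1, Finset.sum_add_distrib, mul_add, Finset.sum_add_distrib, Finset.mul_sum]
  -- Collect everything multiplying f k: the accepted moves into k, which by detailed balance have
  -- the mass of the accepted moves out of k, and the rejected moves at k. Together they make up
  -- W_k.
  rw [Finset.sum_comm, ← Finset.sum_add_distrib]
  refine Finset.sum_congr rfl fun k _ => ?_
  have e2 : ∀ i, ENNReal.ofReal (W i) * (ENNReal.ofReal (r i k * α i k) * f k) =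
      ENNReal.ofReal (W k * (r k i * α k i)) * f k := by
    intro i; rw [← mul_assoc, ← ENNReal.ofReal_mul (hW0 i).le, hsymm]
  have e3 : ∀ i, ENNReal.ofReal (W k) * (ENNReal.ofReal (r k i * (1 - α k i)) * f k) =
      ENNReal.ofReal (W k * (r k i * (1 - α k i))) * f k := by
    intro i; rw [← mul_assoc, ← ENNReal.ofReal_mul (hW0 k).le]
  simp_rw [e2, e3]
  rw [← Finset.sum_mul, ← Finset.sum_mul, ← add_mul, ← ENNReal.ofReal_sum_of_nonneg,
    ← ENNReal.ofReal_sum_of_nonneg, ← ENNReal.ofReal_add, ← Finset.sum_add_distrib]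
  · congr 2
    calc _ = ∑ i, W k * r k i := Finset.sum_congr rfl fun i _ => by ring
      _ = W k := by rw [← Finset.mul_sum, hr1, mul_one]
  all_goals
    have h5 : ∀ i, 0 ≤ W k * (r k i * α k i) := fun i =>
      mul_nonneg (hW0 k).le (mul_nonneg (hr0 k i) (hα0 k i).1)
    have h6 : ∀ i, 0 ≤ W k * (r k i * (1 - α k i)) := fun i =>
      mul_nonneg (hW0 k).le (mul_nonneg (hr0 k i) (by linarith [(hα0 k i).2]))
    first
      | exact Finset.sum_nonneg fun i _ => h5 i
      | exact Finset.sum_nonneg fun i _ => h6 i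
      | exact fun i _ => h5 i
      | exact fun i _ => h6 i

end Final

end CSMCIngredients

namespace CSMCIngredients

open ParticleSystem

variable {N D T : ℕ} {α : Type*} [MeasurableSpace α] {A : α → CSMCIngredients D}

/-! #### Backward pass -/

theorem lintegral_backwardLaw_succ (A : CSMCIngredients D) (S : ParticleSystem N D) (t : ℕ)
    (l : ℕ → Fin (N + 1)) {f : (ℕ → Fin (N + 1)) → ENNReal} (hf : Measurable f) :
    ∫⁻ l', f l' ∂A.backwardLaw S (t + 1) l =
      ∑ i, ENNReal.ofReal (A.backwardWeight S l t i / ∑ n, A.backwardWeight S l t n) *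
        ∫⁻ l', f l' ∂A.backwardLaw S t (Function.update l t i) := by
  rw [backwardLaw, Measure.lintegral_bind (measurable_of_finite _).aemeasurable hf.aemeasurable,
    lintegral_discreteLaw]

theorem IsRegular.backwardWeight_pos (hA : IsRegular A T) {t : ℕ} (ht : t + 1 < T) (a : α)
    (S : ParticleSystem N D) (l : ℕ → Fin (N + 1)) (i : Fin (N + 1)) :
    0 < (A a).backwardWeight S l t i :=
  mul_pos (hA.normWeight_pos a S (by omega) i) (hA.backward_pos a t ht _ _ _ _)

theorem IsRegular.isProbabilityMeasure_backwardIndex (hA : IsRegular A T) {t : ℕ} (ht : t + 1 < T)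
    (a : α) (S : ParticleSystem N D) (l : ℕ → Fin (N + 1)) :
    IsProbabilityMeasure (discreteLaw fun i =>
      (A a).backwardWeight S l t i / ∑ n, (A a).backwardWeight S l t n) := by
  have h := hA.backwardWeight_pos ht a S l
  have hs : 0 < ∑ n, (A a).backwardWeight S l t n :=
    Finset.sum_pos (fun n _ => h n) Finset.univ_nonempty
  refine isProbabilityMeasure_discreteLaw (fun i => (div_pos (h i) hs).le) ?_
  rw [← Finset.sum_div, div_self hs.ne']

theorem IsRegular.isProbabilityMeasure_backwardLaw (hA : IsRegular A T) {t : ℕ} (ht : t < T)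
    (a : α) (S : ParticleSystem N D) (l : ℕ → Fin (N + 1)) :
    IsProbabilityMeasure ((A a).backwardLaw S t l) := by
  induction t generalizing l with
  | zero => exact Measure.dirac.isProbabilityMeasure
  | succ t ih =>
    have := hA.isProbabilityMeasure_backwardIndex ht a S l
    exact isProbabilityMeasure_bind (measurable_of_finite _).aemeasurable
      (Filter.Eventually.of_forall fun i => ih (by omega) _)

theorem IsRegular.measurable_backwardWeight (hA : IsRegular A T) {t : ℕ} (ht : t + 1 < T)
    {S : α → ParticleSystem N D} (hS : Measurable S) {l : α → ℕ → Fin (N + 1)} (hl : Measurable l)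
    (i : Fin (N + 1)) : Measurable fun a => (A a).backwardWeight (S a) (l a) t i := by
  have h : ∀ s, Measurable fun a => (S a).particle s (l a s) := fun s =>
    measurable_eval_index (fun j => measurable_particle hS s j) ((measurable_pi_apply s).comp hl)
  exact (hA.measurable_normWeight hS (by omega) i).mul (hA.measurable_backward_comp ht
    (measurable_parent hS t i) (measurable_particle hS t i) (h (t + 1)) (h (t + 2)))

theorem IsRegular.measurable_backwardLaw {α : Type*} [MeasurableSpace α] {A : α → CSMCIngredients D}
    (hA : IsRegular A T) {t : ℕ} (ht : t < T)
    {S : α → ParticleSystem N D} (hS : Measurable S) {l : α → ℕ → Fin (N + 1)}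
    (hl : Measurable l) : Measurable fun a => (A a).backwardLaw (S a) t (l a) := by
  -- The parameter space varies in the induction, because the recursive call also depends on the
  -- index just sampled.
  induction t generalizing α with
  | zero => exact Measure.measurable_dirac.comp hl
  | succ t ih =>
    refine Measurable.measure_bind (measurable_discreteLaw fun i => ?_)
      (fun a => hA.isProbabilityMeasure_backwardIndex ht a _ _) ?_
    · exact (hA.measurable_backwardWeight ht hS hl i).div
        (Finset.measurable_sum _ fun n _ => hA.measurable_backwardWeight ht hS hl n)
    · refine ih (hA.comp measurable_fst) (by omega) (hS.comp measurable_fst) ?_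
      exact measurable_update'.comp ((hl.comp measurable_fst).prodMk measurable_snd)

/-! #### Output -/

theorem measurable_outputPath {S : α → ParticleSystem N D} (hS : Measurable S)
    {l : α → ℕ → Fin (N + 1)} (hl : Measurable l) :
    Measurable fun a (t : ℕ) => (S a).particle t (l a t) :=
  measurable_pi_lambda _ fun t => measurable_eval_index (fun j => measurable_particle hS t j)
    ((measurable_pi_apply t).comp hl)

theorem measurable_outputPath_fin {S : α → ParticleSystem N D} (hS : Measurable S)
    {l : α → ℕ → Fin (N + 1)} (hl : Measurable l) :
    Measurable fun a (t : Fin T) => (S a).particle t (l a t) :=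
  measurable_pi_lambda _ fun t => (measurable_pi_apply (t : ℕ)).comp (measurable_outputPath hS hl)

theorem IsRegular.measurable_outputLaw_index (hA : IsRegular A T) {t : ℕ} (ht : t < T)
    {S : α → ParticleSystem N D} (hS : Measurable S)
    {i : α → Fin (N + 1)} (hi : Measurable i) :
    Measurable fun a => ((A a).backwardLaw (S a) t (Function.update (fun _ => 0) t (i a))).map
      fun l (t : Fin T) => (S a).particle t (l t) := by
  refine Measurable.measure_map (hA.measurable_backwardLaw ht hS ?_)
    (fun a => hA.isProbabilityMeasure_backwardLaw ht a _ _) ?_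
  · have h := (measurable_update (fun _ : ℕ => (0 : Fin (N + 1))) (a := t)).comp hi
    exact h
  · exact measurable_outputPath_fin (hS.comp measurable_fst) measurable_snd

theorem IsRegular.measurable_outputLaw_system (hA : IsRegular A T) (hN : 1 ≤ N) {t : ℕ}
    (ht : t < T) {S : α → ParticleSystem N D} (hS : Measurable S) :
    Measurable fun a => ((A a).finalIndexLaw (S a) t).bind fun i =>
      ((A a).backwardLaw (S a) t (Function.update (fun _ => 0) t i)).map
        fun l (t : Fin T) => (S a).particle t (l t) :=
  Measurable.measure_bind (hA.measurable_finalIndexLaw ht hS)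
    (fun a => hA.isProbabilityMeasure_finalIndexLaw hN ht a _)
    ((hA.comp measurable_fst).measurable_outputLaw_index ht (hS.comp measurable_fst) measurable_snd)

theorem IsRegular.measurable_outputLaw (hA : IsRegular A T) (hN : 1 ≤ N) (hT : 1 ≤ T)
    {x : α → Fin T → State D} (hx : Measurable x) :
    Measurable fun a => (A a).outputLaw N (x a) :=
  Measurable.measure_bind (hA.measurable_forwardLaw le_rfl (measurable_extendPath.comp hx))
    (fun a => hA.isProbabilityMeasure_forwardLaw a _ le_rfl)
    ((hA.comp measurable_fst).measurable_outputLaw_system hN (by omega) measurable_snd)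

theorem IsRegular.isProbabilityMeasure_outputLaw (hA : IsRegular A T) (hN : 1 ≤ N) (hT : 1 ≤ T)
    (a : α) (x : Fin T → State D) : IsProbabilityMeasure ((A a).outputLaw N x) := by
  have hT' : T - 1 < T := by omega
  have := hA.isProbabilityMeasure_forwardLaw (N := N) a (extendPath x) le_rfl
  refine isProbabilityMeasure_bind ((hA.comp (measurable_const (a := a))).measurable_outputLaw_system
    hN hT' measurable_id).aemeasurable (Filter.Eventually.of_forall fun S => ?_)
  have := hA.isProbabilityMeasure_finalIndexLaw hN hT' a S
  refine isProbabilityMeasure_bind (measurable_of_finite _).aemeasurable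
    (Filter.Eventually.of_forall fun i => ?_)
  have := hA.isProbabilityMeasure_backwardLaw hT' a S (Function.update (fun _ => 0) (T - 1) i)
  exact Measure.isProbabilityMeasure_map
    (measurable_outputPath_fin measurable_const measurable_id).aemeasurable

theorem IsRegular.lintegral_outputLaw (hA : IsRegular A T) (hN : 1 ≤ N) (hT : 1 ≤ T)
    (a : α) (x : Fin T → State D) {f : (Fin T → State D) → ENNReal} (hf : Measurable f) :
    ∫⁻ y, f y ∂(A a).outputLaw N x = ∫⁻ S, ∫⁻ i, ∫⁻ l, f fun t => S.particle t (l t)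
      ∂(A a).backwardLaw S (T - 1) (Function.update (fun _ => 0) (T - 1) i)
      ∂(A a).finalIndexLaw S (T - 1) ∂(A a).forwardLaw N (extendPath x) T := by
  have h := (hA.comp (measurable_const (a := a))).measurable_outputLaw_system (N := N) hN
    (by omega : T - 1 < T) measurable_id
  simp only [id] at h
  rw [outputLaw, Measure.lintegral_bind h.aemeasurable hf.aemeasurable]
  refine lintegral_congr fun S => ?_
  rw [Measure.lintegral_bind (measurable_of_finite _).aemeasurable hf.aemeasurable]
  refine lintegral_congr fun i => ?_
  have h2 : Measurable fun (l : ℕ → Fin (N + 1)) (t : Fin T) => S.particle t (l t) :=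
    measurable_outputPath_fin measurable_const measurable_id
  rw [lintegral_map hf h2]

end CSMCIngredients

/-! ### Invariance of conditional sequential Monte Carlo -/

namespace ParticleSystem

variable {N D : ℕ} (S : ParticleSystem N D)

/-- Lineages, and with them weights and backward sampling, do not see which particle is the
reference. This is what allows the reference index to be redrawn. -/
theorem parent_withRef (r : ℕ → Fin (N + 1)) (t : ℕ) (n : Fin (N + 1)) :
    parent ((r, S.2) : ParticleSystem N D) t n = S.parent t n := by
  cases t <;> rfl

theorem grandparent_withRef (r : ℕ → Fin (N + 1)) (t : ℕ) (n : Fin (N + 1)) :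
    grandparent ((r, S.2) : ParticleSystem N D) t n = S.grandparent t n := by
  cases t with
  | zero => rfl
  | succ t => exact parent_withRef S r t _

theorem particle_init (k : Fin (N + 1)) (z : Fin (N + 1) → State D) (n : Fin (N + 1)) :
    (init S k z).particle 0 n = z n := by simp [init, particle]

theorem refIndex_init (k : Fin (N + 1)) (z : Fin (N + 1) → State D) :
    (init S k z).refIndex 0 = k := by simp [init, refIndex]

variable (t : ℕ) (k : Fin (N + 1)) (b : Fin (N + 1) → Fin (N + 1)) (z : Fin (N + 1) → State D)

theorem refIndex_extend : (extend t S k b z).refIndex (t + 1) = k := by simp [extend, refIndex]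

theorem particle_extend_self (n : Fin (N + 1)) : (extend t S k b z).particle (t + 1) n = z n := by
  simp [extend, particle]

theorem particle_extend_of_le {s : ℕ} (hs : s ≤ t) (n : Fin (N + 1)) :
    (extend t S k b z).particle s n = S.particle s n := by
  simp [extend, particle, Function.update_of_ne (by omega : s ≠ t + 1)]

theorem ancestor_extend_self : (extend t S k b z).ancestor t = b := by
  simp [extend, ancestor]

theorem ancestor_extend_of_lt {s : ℕ} (hs : s < t) :
    (extend t S k b z).ancestor s = S.ancestor s := by
  simp [extend, ancestor, Function.update_of_ne hs.ne]

theorem parent_extend_self (n : Fin (N + 1)) :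
    (extend t S k b z).parent (t + 1) n = S.particle t (b n) := by
  rw [parent, ancestor_extend_self, particle_extend_of_le _ _ _ _ _ le_rfl]

theorem parent_extend_of_le {s : ℕ} (hs : s ≤ t) (n : Fin (N + 1)) :
    (extend t S k b z).parent s n = S.parent s n := by
  cases s with
  | zero => rfl
  | succ s => rw [parent, parent, ancestor_extend_of_lt _ _ _ _ _ (by omega),
      particle_extend_of_le _ _ _ _ _ (by omega)]

theorem grandparent_extend_self (n : Fin (N + 1)) :
    (extend t S k b z).grandparent (t + 1) n = S.parent t (b n) := by
  rw [grandparent, ancestor_extend_self, parent_extend_of_le _ _ _ _ _ le_rfl]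

theorem grandparent_extend_of_le {s : ℕ} (hs : s ≤ t) (n : Fin (N + 1)) :
    (extend t S k b z).grandparent s n = S.grandparent s n := by
  cases s with
  | zero => rfl
  | succ s => rw [grandparent, grandparent, ancestor_extend_of_lt _ _ _ _ _ (by omega),
      parent_extend_of_le _ _ _ _ _ (by omega)]

end ParticleSystem

namespace CSMCIngredients

open ParticleSystem

variable {N D T : ℕ}

theorem weight_withRef (A : CSMCIngredients D) (S : ParticleSystem N D) (r : ℕ → Fin (N + 1))
    (t : ℕ) (n : Fin (N + 1)) : A.weight (r, S.2) t n = A.weight S t n := by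
  rw [weight, weight, parent_withRef, grandparent_withRef]
  rfl

theorem normWeight_withRef (A : CSMCIngredients D) (S : ParticleSystem N D) (r : ℕ → Fin (N + 1))
    (t : ℕ) (n : Fin (N + 1)) : A.normWeight (r, S.2) t n = A.normWeight S t n := by
  simp only [normWeight, weight_withRef]

theorem weight_extend_self (A : CSMCIngredients D) (S : ParticleSystem N D) (t : ℕ)
    (k : Fin (N + 1)) (b : Fin (N + 1) → Fin (N + 1)) (z : Fin (N + 1) → State D)
    (n : Fin (N + 1)) : A.weight (extend t S k b z) (t + 1) n =
      A.potential (t + 1) (S.parent t (b n)) (S.particle t (b n)) (z n) := by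
  rw [weight, parent_extend_self, grandparent_extend_self, particle_extend_self]

theorem weight_extend_of_le (A : CSMCIngredients D) (S : ParticleSystem N D) (t : ℕ)
    (k : Fin (N + 1)) (b : Fin (N + 1) → Fin (N + 1)) (z : Fin (N + 1) → State D) {s : ℕ}
    (hs : s ≤ t) (n : Fin (N + 1)) : A.weight (extend t S k b z) s n = A.weight S s n := by
  rw [weight, weight, parent_extend_of_le _ _ _ _ _ hs, grandparent_extend_of_le _ _ _ _ _ hs,
    particle_extend_of_le _ _ _ _ _ hs]

theorem forwardStep_congr (A : CSMCIngredients D) {x x' : ℕ → State D} {t : ℕ} (h : x t = x' t)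
    (S : ParticleSystem N D) : A.forwardStep x t S = A.forwardStep x' t S := by
  cases t with
  | zero => rw [forwardStep_zero, forwardStep_zero, h]
  | succ t => rw [forwardStep_succ, forwardStep_succ, h]

theorem forwardLaw_congr (A : CSMCIngredients D) {x x' : ℕ → State D} {t : ℕ}
    (h : ∀ s < t, x s = x' s) : A.forwardLaw N x t = A.forwardLaw N x' t := by
  induction t with
  | zero => rfl
  | succ t ih =>
    have h1 : A.forwardStep (N := N) x t = A.forwardStep x' t :=
      funext fun S => A.forwardStep_congr (h t (by omega)) S
    rw [forwardLaw, forwardLaw, ih fun s hs => h s (by omega), h1]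

variable {α : Type*} [MeasurableSpace α] {A : α → CSMCIngredients D}

section Reference

variable (hA : IsRegular A T) (a : α) (x : ℕ → State D)

theorem measurableSet_reference (t : ℕ) (y y' : State D) : MeasurableSet
    {S : ParticleSystem N D | S.particle t (S.refIndex t) = y ∧ S.parent t (S.refIndex t) = y'} :=
  (measurableSet_eq_fun (measurable_eval_index (fun j => measurable_particle measurable_id t j)
    (measurable_refIndex measurable_id t)) measurable_const).inter
  (measurableSet_eq_fun (measurable_eval_index (fun j => measurable_parent measurable_id t j)
    (measurable_refIndex measurable_id t)) measurable_const)

include hA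

theorem IsRegular.ae_particleLaw {t : ℕ} (ht : t < T) (k : Fin (N + 1)) (y : State D)
    (p : Fin (N + 1) → State D) : ∀ᵐ z ∂(A a).particleLaw t k y p, z k = y :=
  ae_pi_dirac _ (hA.isProbabilityMeasure_particle a ht k y p) k y (if_pos rfl)

theorem IsRegular.ae_forwardStep_zero (ht : 0 < T) (S : ParticleSystem N D) :
    ∀ᵐ S' ∂(A a).forwardStep x 0 S, S'.particle 0 (S'.refIndex 0) = x 0 ∧
      S'.parent 0 (S'.refIndex 0) = 0 := by
  rw [forwardStep_zero]
  refine ae_bind (measurable_of_finite _) (measurableSet_reference 0 _ _)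
    (Filter.Eventually.of_forall fun k => ?_)
  rw [ae_map_iff (by fun_prop) (measurableSet_reference 0 _ _)]
  filter_upwards [hA.ae_particleLaw a ht k (x 0) fun _ => 0] with z hz
  rw [refIndex_init, particle_init, hz]
  exact ⟨rfl, rfl⟩

theorem IsRegular.ae_forwardStep_succ {t : ℕ} (ht : t + 1 < T) (S : ParticleSystem N D) :
    ∀ᵐ S' ∂(A a).forwardStep x (t + 1) S, S'.particle (t + 1) (S'.refIndex (t + 1)) = x (t + 1) ∧
      S'.parent (t + 1) (S'.refIndex (t + 1)) = S.particle t (S.refIndex t) := by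
  rw [forwardStep_succ]
  refine ae_bind (measurable_of_finite _) (measurableSet_reference (t + 1) _ _)
    (Filter.Eventually.of_forall fun k => ?_)
  refine ae_bind (measurable_of_finite _) (measurableSet_reference (t + 1) _ _) ?_
  have hb : ∀ᵐ b ∂(A a).ancestorLaw S t k, b k = S.refIndex t :=
    ae_pi_dirac _ (hA.isProbabilityMeasure_ancestor a S (by omega) k) k _ (if_pos rfl)
  filter_upwards [hb] with b hb
  rw [ae_map_iff (by fun_prop) (measurableSet_reference (t + 1) _ _)]
  filter_upwards [hA.ae_particleLaw a ht k (x (t + 1)) fun n => S.particle t (b n)] with z hz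
  rw [refIndex_extend, particle_extend_self, parent_extend_self, hz, hb]
  exact ⟨rfl, rfl⟩

/-- The reference slot is a Dirac coordinate of each product law. Hence factors of the path density
at time t + 1, which reach back two states, can be rewritten in terms of the reference particle and
its parent inside expectations over the particle system. -/
theorem IsRegular.ae_forwardLaw {t : ℕ} (ht : t < T) :
    ∀ᵐ S ∂(A a).forwardLaw N x (t + 1), S.particle t (S.refIndex t) = x t ∧
      S.parent t (S.refIndex t) = previous x t := by
  induction t with
  | zero =>
    exact ae_bind (hA.measurable_forwardStep_fixed a x ht) (measurableSet_reference 0 _ _)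
      (Filter.Eventually.of_forall fun S => hA.ae_forwardStep_zero a x ht S)
  | succ t ih =>
    refine ae_bind (hA.measurable_forwardStep_fixed a x ht) (measurableSet_reference (t + 1) _ _) ?_
    filter_upwards [ih (by omega)] with S hS
    filter_upwards [hA.ae_forwardStep_succ a x ht S] with S' hS'
    exact ⟨hS'.1, hS'.2.trans hS.1⟩

end Reference

end CSMCIngredients

theorem measurable_previous {D : ℕ} {α : Type*} [MeasurableSpace α] {x : α → ℕ → State D}
    (hx : Measurable x) : Measurable fun a => previous (x a) := by
  refine measurable_pi_lambda _ fun t => ?_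
  cases t with
  | zero => exact measurable_const
  | succ t => exact (measurable_pi_apply t).comp hx

/-! ### One forward step averaged over the reference state -/

namespace CSMCIngredients

open ParticleSystem

variable {N D T : ℕ}

/-- The factor `M'_t G'_t` of the extended path density. -/
def pathFactor (A : CSMCIngredients D) (t : ℕ) (xpp xp x : State D) : ENNReal :=
  ENNReal.ofReal (A.proposal t xp x * A.potential t xpp xp x)

/-- The unnormalised density of the first `s` states of a path. -/
def pathDensity (A : CSMCIngredients D) (x : ℕ → State D) (s : ℕ) : ENNReal :=
  ∏ t ∈ Finset.range s, A.pathFactor t (previous (previous x) t) (previous x t) (x t)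

/-- Expectation of `h` at the reference index after a step to time `t + 1`, where the reference
particle at time `t` is `k` and the reference state at time `t + 1` is `y`. -/
def stepIntegral (A : CSMCIngredients D) (t : ℕ) (h : ParticleSystem N D → Fin (N + 1) → ENNReal)
    (S : ParticleSystem N D) (k : Fin (N + 1)) (y : State D) : ENNReal :=
  ∑ k', ∫⁻ b, ∫⁻ z, h (extend t S k' b z) k'
    ∂A.particleLaw (t + 1) k' y (fun n => S.particle t (b n))
    ∂Measure.pi fun n => if n = k' then Measure.dirac k else discreteLaw (A.normWeight S t)

variable {α : Type*} [MeasurableSpace α] {A : α → CSMCIngredients D}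

theorem IsRegular.measurable_pathFactor (hA : IsRegular A T) {t : ℕ} (ht : t < T)
    {f g h : α → State D} (hf : Measurable f) (hg : Measurable g) (hh : Measurable h) :
    Measurable fun a => (A a).pathFactor t (f a) (g a) (h a) :=
  ((hA.measurable_proposal_comp ht hg hh).mul
    (hA.measurable_potential_comp ht hf hg hh)).ennreal_ofReal

theorem IsRegular.measurable_pathDensity (hA : IsRegular A T) {s : ℕ} (hs : s ≤ T)
    {x : α → ℕ → State D} (hx : Measurable x) :
    Measurable fun a => (A a).pathDensity (x a) s := by
  refine Finset.measurable_prod _ fun t ht => ?_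
  have ht' := Finset.mem_range.1 ht
  have hp := measurable_previous hx
  exact hA.measurable_pathFactor (by omega)
    ((measurable_pi_apply t).comp (measurable_previous hp)) ((measurable_pi_apply t).comp hp)
    ((measurable_pi_apply t).comp hx)

theorem IsRegular.isProbabilityMeasure_stepAncestor (hA : IsRegular A T) {t : ℕ} (ht : t < T)
    (a : α) (S : ParticleSystem N D) (k k' n : Fin (N + 1)) : IsProbabilityMeasure
      (if n = k' then Measure.dirac k else discreteLaw ((A a).normWeight S t)) := by
  have := hA.isProbabilityMeasure_index a S ht
  split_ifs <;> infer_instance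

theorem IsRegular.measurable_stepIntegral (hA : IsRegular A T) {t : ℕ} (ht : t + 1 < T)
    {h : ParticleSystem N D → Fin (N + 1) → ENNReal} (hh : ∀ k, Measurable fun S => h S k)
    {S : α → ParticleSystem N D} (hS : Measurable S) (k : Fin (N + 1))
    {y : α → State D} (hy : Measurable y) :
    Measurable fun a => (A a).stepIntegral t h (S a) k (y a) := by
  refine Finset.measurable_sum _ fun k' _ => ?_
  refine Measurable.lintegral_param (Measurable.measure_pi (fun n => ?_)
    fun a n => hA.isProbabilityMeasure_stepAncestor (by omega) a (S a) k k' n) (fun a => ?_) ?_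
  · split_ifs
    · exact measurable_const
    · exact measurable_discreteLaw fun i => hA.measurable_normWeight hS (by omega) i
  · have := hA.isProbabilityMeasure_stepAncestor (by omega : t < T) a (S a) k k'
    infer_instance
  · refine Measurable.lintegral_param ((hA.comp measurable_fst).measurable_particleLaw ht
      measurable_const (hy.comp measurable_fst) ?_)
      (fun p => hA.isProbabilityMeasure_particleLaw p.1 ht _ _ _) ?_
    · exact measurable_pi_lambda _ fun n => measurable_eval_index
        (fun j => measurable_particle (hS.comp measurable_fst) t j)
        ((measurable_pi_apply n).comp measurable_snd)
    · exact (hh k').comp (measurable_extend t (hS.comp (measurable_fst.comp measurable_fst))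
        measurable_const (measurable_snd.comp measurable_fst) measurable_snd)

theorem stepIntegral_withRef (A : CSMCIngredients D) (t : ℕ)
    {h : ParticleSystem N D → Fin (N + 1) → ENNReal} (hr : ∀ S r k, h (r, S.2) k = h S k)
    (S : ParticleSystem N D) (r : ℕ → Fin (N + 1)) (k : Fin (N + 1)) (y : State D) :
    A.stepIntegral t h (r, S.2) k y = A.stepIntegral t h S k y := by
  have h1 : A.normWeight (r, S.2) t = A.normWeight S t := funext fun n => A.normWeight_withRef S r t n
  unfold stepIntegral
  rw [h1]
  refine Finset.sum_congr rfl fun k' _ => lintegral_congr fun b => lintegral_congr fun z => ?_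
  rw [← hr (extend t S k' b z) (Function.update r (t + 1) k')]
  rfl

/-- Integrating the reference state against the proposal density turns the conditional law of the
particles into a product law. -/
theorem IsRegular.lintegral_particleLaw (hA : IsRegular A T) (a : α) {t : ℕ} (ht : t < T)
    (k : Fin (N + 1)) (xpp : State D) (p : Fin (N + 1) → State D)
    {H : (Fin (N + 1) → State D) → ENNReal} (hH : Measurable H) :
    ∫⁻ y, (A a).pathFactor t xpp (p k) y * ∫⁻ z, H z ∂(A a).particleLaw t k y p =
      ∫⁻ z, ENNReal.ofReal ((A a).potential t xpp (p k) (z k)) * H z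
        ∂Measure.pi fun n => lawOfDensity ((A a).proposal t (p n)) := by
  have hA' : IsRegular (fun _ : State D => A a) T := hA.comp measurable_const
  have hg : Measurable fun y => ENNReal.ofReal ((A a).potential t xpp (p k) y) :=
    (hA'.measurable_potential_comp ht measurable_const measurable_const
      measurable_id).ennreal_ofReal
  have hpm : Measurable fun y => (A a).proposal t (p k) y :=
    hA'.measurable_proposal_comp ht measurable_const measurable_id
  have hI : Measurable fun y => ∫⁻ z, H z ∂(A a).particleLaw t k y p :=
    Measurable.lintegral_param (hA'.measurable_particleLaw ht measurable_const measurable_id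
      measurable_const) (fun y => hA.isProbabilityMeasure_particleLaw a ht _ _ _)
      (hH.comp measurable_snd)
  have hgz : Measurable fun z : Fin (N + 1) → State D =>
      ENNReal.ofReal ((A a).potential t xpp (p k) (z k)) := hg.comp (measurable_pi_apply k)
  calc _ = ∫⁻ y, ENNReal.ofReal ((A a).proposal t (p k) y) *
        ∫⁻ z, ENNReal.ofReal ((A a).potential t xpp (p k) (z k)) * H z
          ∂(A a).particleLaw t k y p := by
        refine lintegral_congr fun y => ?_
        -- Slot k holds y almost surely, so the potential at y may be evaluated at z k and moved
        -- under the integral.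
        have h1 : ∫⁻ z, ENNReal.ofReal ((A a).potential t xpp (p k) (z k)) * H z
            ∂(A a).particleLaw t k y p = ENNReal.ofReal ((A a).potential t xpp (p k) y) *
              ∫⁻ z, H z ∂(A a).particleLaw t k y p := by
          rw [← lintegral_const_mul _ hH]
          refine lintegral_congr_ae ?_
          filter_upwards [hA.ae_particleLaw a ht k y p] with z hz
          rw [hz]
        rw [h1, pathFactor, ENNReal.ofReal_mul (hA.proposal_nonneg a t ht _ _), mul_assoc]
    _ = ∫⁻ y, ∫⁻ z, ENNReal.ofReal ((A a).potential t xpp (p k) (z k)) * H z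
          ∂(A a).particleLaw t k y p ∂lawOfDensity ((A a).proposal t (p k)) := by
        rw [lintegral_lawOfDensity hpm]
        exact Measurable.lintegral_param (hA'.measurable_particleLaw ht measurable_const
          measurable_id measurable_const)
          (fun y => hA.isProbabilityMeasure_particleLaw a ht _ _ _)
          ((hgz.mul hH).comp measurable_snd)
    _ = _ := lintegral_pi_dirac (fun n => lawOfDensity ((A a).proposal t (p n)))
        (fun n => hA.isProbabilityMeasure_proposal a ht (p n)) k (hgz.mul hH)

/-- The induction step of the exchangeability argument. Averaging the reference ancestor k over W_t
makes all ancestors i.i.d., and integrating y against the proposal makes all particles independent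
proposals. The potential survives as the weight of the new reference slot k', so the right side
involves h only through its weighted sum over all slots at time t + 1. -/
theorem IsRegular.sum_normWeight_mul_stepIntegral (hA : IsRegular A T) (a : α) {t : ℕ}
    (ht : t + 1 < T) {h : ParticleSystem N D → Fin (N + 1) → ENNReal}
    (hh : ∀ k, Measurable fun S => h S k) (hr : ∀ S r k, h (r, S.2) k = h S k)
    (S : ParticleSystem N D) :
    ∑ k, ENNReal.ofReal ((A a).normWeight S t k) *
      ∫⁻ y, (A a).pathFactor (t + 1) (S.parent t k) (S.particle t k) y *
        (A a).stepIntegral t h S k y =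
      ∫⁻ b, ∫⁻ z, ∑ k', ENNReal.ofReal ((A a).weight (extend t S 0 b z) (t + 1) k') *
          h (extend t S 0 b z) k'
        ∂Measure.pi (fun n => lawOfDensity ((A a).proposal (t + 1) (S.particle t (b n))))
        ∂Measure.pi (fun _ => discreteLaw ((A a).normWeight S t)) := by
  have hW := hA.isProbabilityMeasure_index a S (by omega : t < T)
  have hA' : IsRegular (fun _ : State D => A a) T := hA.comp measurable_const
  -- Since h ignores the stored reference indices, the index recorded by the step can be set to the
  -- default 0, so that one and the same system serves for all k'.
  have hext : ∀ k' b z, h (extend t S k' b z) k' = h (extend t S 0 b z) k' := fun k' b z =>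
    (hr (extend t S 0 b z) (extend t S k' b z).1 k')
  have hhz : ∀ b k', Measurable fun z => h (extend t S 0 b z) k' := fun b k' =>
    (hh k').comp (measurable_extend t measurable_const measurable_const measurable_const
      measurable_id)
  set J : Fin (N + 1) → (Fin (N + 1) → Fin (N + 1)) → ENNReal := fun k' b =>
    ∫⁻ z, ENNReal.ofReal ((A a).weight (extend t S 0 b z) (t + 1) k') * h (extend t S 0 b z) k'
      ∂Measure.pi (fun n => lawOfDensity ((A a).proposal (t + 1) (S.particle t (b n)))) with hJ
  have hfac : ∀ k, Measurable fun y =>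
      (A a).pathFactor (t + 1) (S.parent t k) (S.particle t k) y := fun k =>
    hA'.measurable_pathFactor ht measurable_const measurable_const measurable_id
  have hin : ∀ k' b, Measurable fun y => ∫⁻ z, h (extend t S 0 b z) k'
      ∂(A a).particleLaw (t + 1) k' y (fun n => S.particle t (b n)) := fun k' b =>
    Measurable.lintegral_param (hA'.measurable_particleLaw ht measurable_const measurable_id
      measurable_const) (fun y => hA.isProbabilityMeasure_particleLaw a ht _ _ _)
      ((hhz b k').comp measurable_snd)
  have hinner : ∀ k, ∫⁻ y, (A a).pathFactor (t + 1) (S.parent t k) (S.particle t k) y *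
        (A a).stepIntegral t h S k y =
      ∑ k', ∫⁻ b, J k' b ∂Measure.pi fun n => if n = k' then Measure.dirac k else
        discreteLaw ((A a).normWeight S t) := by
    intro k
    have hprob := hA.isProbabilityMeasure_stepAncestor (by omega : t < T) a S k
    simp_rw [stepIntegral, hext, Finset.mul_sum]
    rw [lintegral_finsetSum]
    · refine Finset.sum_congr rfl fun k' _ => ?_
      have hp' := hprob k'
      have hmul : ∀ y, (A a).pathFactor (t + 1) (S.parent t k) (S.particle t k) y *
          ∫⁻ b, ∫⁻ z, h (extend t S 0 b z) k'
            ∂(A a).particleLaw (t + 1) k' y (fun n => S.particle t (b n))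
            ∂Measure.pi (fun n => if n = k' then Measure.dirac k else
              discreteLaw ((A a).normWeight S t)) =
          ∫⁻ b, (A a).pathFactor (t + 1) (S.parent t k) (S.particle t k) y *
            ∫⁻ z, h (extend t S 0 b z) k'
              ∂(A a).particleLaw (t + 1) k' y (fun n => S.particle t (b n))
            ∂Measure.pi (fun n => if n = k' then Measure.dirac k else
              discreteLaw ((A a).normWeight S t)) :=
        fun y => (lintegral_const_mul' _ _ ENNReal.ofReal_ne_top).symm
      simp_rw [hmul]
      -- With the ancestors fixed, the reference state can be integrated out first; almost surely
      -- the ancestor of slot k' is k, so the path factor has the parents seen by that slot.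
      rw [lintegral_lintegral_swap]
      · refine lintegral_congr_ae ?_
        have hb := ae_pi_dirac _ hp' k' k (if_pos rfl)
        filter_upwards [hb] with b hb
        rw [← hb, hA.lintegral_particleLaw a ht k' _ (fun n => S.particle t (b n)) (hhz b k')]
        simp_rw [hJ, weight_extend_self]
      · refine Measurable.aemeasurable ?_
        exact measurable_from_prod_countable_left fun b => (hfac k).mul (hin k' b)
    · intro k' _
      have hp' := hprob k'
      refine (hfac k).mul ?_
      simp_rw [lintegral_fintype]
      exact Finset.measurable_sum _ fun b _ => (hin k' b).mul_const _
  simp_rw [hinner, Finset.mul_sum]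
  rw [Finset.sum_comm]
  -- A Dirac coordinate at k, averaged over k with probabilities W_t^k, is an ordinary draw from
  -- W_t.
  have hmerge : ∀ k', ∑ k, ENNReal.ofReal ((A a).normWeight S t k) *
      ∫⁻ b, J k' b ∂Measure.pi (fun n => if n = k' then Measure.dirac k else
        discreteLaw ((A a).normWeight S t)) =
      ∫⁻ b, J k' b ∂Measure.pi (fun _ => discreteLaw ((A a).normWeight S t)) := by
    intro k'
    rw [← lintegral_pi_dirac (fun _ => discreteLaw ((A a).normWeight S t)) (fun _ => hW) k'
      (measurable_of_finite _), lintegral_discreteLaw]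
  simp_rw [hmerge]
  rw [← lintegral_finsetSum _ fun k' _ => measurable_of_finite _]
  refine lintegral_congr fun b => ?_
  rw [lintegral_finsetSum]
  intro k' _
  refine Measurable.mul (Measurable.ennreal_ofReal ?_) (hhz b k')
  exact (hA.comp measurable_const).measurable_weight (measurable_extend t measurable_const
    measurable_const measurable_const measurable_id) ht k'

end CSMCIngredients

/-! ### Initial segments of paths -/

section Path

variable {D : ℕ}

theorem previous_congr {x x' : ℕ → State D} {s : ℕ} (h : ∀ r < s, x r = x' r) :
    previous x s = previous x' s := by
  cases s with
  | zero => rfl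
  | succ s => exact h s (by omega)

theorem extendPath_update {T t : ℕ} (ht : t < T) (x : Fin T → State D) (y : State D) :
    extendPath (Function.update x ⟨t, ht⟩ y) = Function.update (extendPath x) t y := by
  funext s
  by_cases hs : s < T
  · rw [extendPath_of_lt _ hs]
    by_cases h : s = t
    · subst h; simp
    · rw [Function.update_of_ne h, Function.update_of_ne (by simpa [Fin.ext_iff] using h),
        extendPath_of_lt _ hs]
  · rw [Function.update_of_ne (by omega)]
    simp [extendPath, hs]

/-- The times up to `t`. -/
def upTo (T t : ℕ) : Finset (Fin T) := Finset.univ.filter fun i => i.val ≤ t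

theorem upTo_zero {T : ℕ} (hT : 0 < T) : upTo T 0 = {⟨0, hT⟩} := by
  ext i; simp [upTo, Fin.ext_iff]

theorem upTo_succ {T t : ℕ} (ht : t + 1 < T) : upTo T (t + 1) = insert ⟨t + 1, ht⟩ (upTo T t) := by
  ext i; simp [upTo, Fin.ext_iff]; omega

theorem notMem_upTo {T t : ℕ} (ht : t + 1 < T) : ⟨t + 1, ht⟩ ∉ upTo T t := by
  simp [upTo]

end Path

namespace CSMCIngredients

open ParticleSystem

variable {N D T : ℕ}

theorem pathDensity_congr (A : CSMCIngredients D) {x x' : ℕ → State D} {s : ℕ}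
    (h : ∀ r < s, x r = x' r) : A.pathDensity x s = A.pathDensity x' s := by
  refine Finset.prod_congr rfl fun t ht => ?_
  have ht' := Finset.mem_range.1 ht
  have h1 : ∀ r ≤ t, previous x r = previous x' r := fun r hr =>
    previous_congr fun q hq => h q (by omega)
  rw [h t ht', h1 t le_rfl, previous_congr fun q hq => h1 q (by omega)]

theorem pathDensity_succ (A : CSMCIngredients D) (x : ℕ → State D) (s : ℕ) :
    A.pathDensity x (s + 1) = A.pathDensity x s *
      A.pathFactor s (previous (previous x) s) (previous x s) (x s) := Finset.prod_range_succ _ _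

variable {α : Type*} [MeasurableSpace α] {A : α → CSMCIngredients D}

theorem IsRegular.measurable_forward_expectation (hA : IsRegular A T) (a : α) {t : ℕ} (ht : t < T)
    {h : (Fin T → State D) → ParticleSystem N D → Fin (N + 1) → ENNReal}
    (hh : ∀ k, Measurable fun p : (Fin T → State D) × ParticleSystem N D => h p.1 p.2 k) :
    Measurable fun x : Fin T → State D => (A a).pathDensity (extendPath x) (t + 1) *
      ∫⁻ S, h x S (S.refIndex t) ∂(A a).forwardLaw N (extendPath x) (t + 1) := by
  have hA' : IsRegular (fun _ : Fin T → State D => A a) T := hA.comp measurable_const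
  refine (hA'.measurable_pathDensity ht measurable_extendPath).mul ?_
  refine Measurable.lintegral_param (hA'.measurable_forwardLaw ht measurable_extendPath)
    (fun x => hA.isProbabilityMeasure_forwardLaw a _ ht) ?_
  exact measurable_eval_index hh (measurable_refIndex measurable_snd t)

/-- One forward step, with the reference state `y`. -/
theorem IsRegular.lintegral_forwardLaw_update (hA : IsRegular A T) (a : α) {t : ℕ} (ht : t + 1 < T)
    {h : ParticleSystem N D → Fin (N + 1) → ENNReal} (hh : ∀ k, Measurable fun S => h S k)
    (x : ℕ → State D) (y : State D) :
    ∫⁻ S, h S (S.refIndex (t + 1)) ∂(A a).forwardLaw N (Function.update x (t + 1) y) (t + 1 + 1) =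
      ENNReal.ofReal (1 / ((N : ℝ) + 1)) * ∫⁻ S, (A a).stepIntegral t h S (S.refIndex t) y
        ∂(A a).forwardLaw N x (t + 1) := by
  have hm : Measurable fun S : ParticleSystem N D => h S (S.refIndex (t + 1)) :=
    measurable_eval_index hh (measurable_refIndex measurable_id _)
  rw [forwardLaw, Measure.lintegral_bind
    (hA.measurable_forwardStep_fixed a _ ht).aemeasurable hm.aemeasurable,
    forwardLaw_congr (x' := x) (A a) fun s hs => Function.update_of_ne (by omega) _ _,
    ← lintegral_const_mul' _ _ ENNReal.ofReal_ne_top]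
  refine lintegral_congr fun S => ?_
  rw [lintegral_forwardStep_succ _ _ _ _ hm]
  simp_rw [refIndex_extend, Function.update_self]
  rfl

/-- Integrating out the reference state at time t + 1 leaves an expression of the same shape at time
t, with h replaced by the function of system and reference index in parentheses. This makes the
induction over time possible. -/
theorem IsRegular.lintegral_forward_succ (hA : IsRegular A T) (a : α) {t : ℕ} (ht : t + 1 < T)
    {h : ParticleSystem N D → Fin (N + 1) → ENNReal} (hh : ∀ k, Measurable fun S => h S k)
    (x : ℕ → State D) :
    ∫⁻ y, (A a).pathDensity (Function.update x (t + 1) y) (t + 1 + 1) *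
      ∫⁻ S, h S (S.refIndex (t + 1))
        ∂(A a).forwardLaw N (Function.update x (t + 1) y) (t + 1 + 1) =
    (A a).pathDensity x (t + 1) * ∫⁻ S, (ENNReal.ofReal (1 / ((N : ℝ) + 1)) *
      ∫⁻ y, (A a).pathFactor (t + 1) (S.parent t (S.refIndex t))
        (S.particle t (S.refIndex t)) y * (A a).stepIntegral t h S (S.refIndex t) y)
      ∂(A a).forwardLaw N x (t + 1) := by
  have hA' : IsRegular (fun _ : State D => A a) T := hA.comp measurable_const
  have hA2 : IsRegular (fun _ : State D × ParticleSystem N D => A a) T := hA.comp measurable_const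
  have hprob := hA.isProbabilityMeasure_forwardLaw (N := N) a x (by omega : t + 1 ≤ T)
  have hpd : ∀ y, (A a).pathDensity (Function.update x (t + 1) y) (t + 1 + 1) =
      (A a).pathDensity x (t + 1) * (A a).pathFactor (t + 1) (previous x t) (x t) y := by
    intro y
    have h1 : ∀ r ≤ t, Function.update x (t + 1) y r = x r := fun r hr =>
      Function.update_of_ne (by omega) _ _
    rw [pathDensity_succ, Function.update_self,
      pathDensity_congr (x' := x) _ fun r hr => h1 r (by omega)]
    change _ * (A a).pathFactor (t + 1) (previous (Function.update x (t + 1) y) t)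
      (Function.update x (t + 1) y t) y = _
    rw [previous_congr (x' := x) fun r hr => h1 r (by omega), h1 t le_rfl]
  have hstep : Measurable fun p : State D × ParticleSystem N D =>
      (A a).stepIntegral t h p.2 (p.2.refIndex t) p.1 := by
    have h1 : ∀ k, Measurable fun p : State D × ParticleSystem N D =>
        (A a).stepIntegral t h p.2 k p.1 := fun k =>
      hA2.measurable_stepIntegral ht hh measurable_snd k measurable_fst
    have h2 : Measurable fun p : State D × ParticleSystem N D => p.2.refIndex t :=
      measurable_refIndex measurable_snd t
    have h3 := measurable_eval_index h1 h2
    exact h3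
  have hfac : Measurable fun y => (A a).pathFactor (t + 1) (previous x t) (x t) y :=
    hA'.measurable_pathFactor ht measurable_const measurable_const measurable_id
  have hpdt : (A a).pathDensity x (t + 1) ≠ ⊤ :=
    ENNReal.prod_ne_top fun _ _ => ENNReal.ofReal_ne_top
  simp_rw [hpd, hA.lintegral_forwardLaw_update a ht hh, mul_assoc]
  rw [lintegral_const_mul' _ _ hpdt, lintegral_const_mul' _ _ ENNReal.ofReal_ne_top]
  refine congrArg _ ?_
  simp_rw [mul_left_comm _ (ENNReal.ofReal (1 / ((N : ℝ) + 1)))]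
  rw [lintegral_const_mul' _ _ ENNReal.ofReal_ne_top]
  refine congrArg _ ?_
  have hmul : ∀ y, (A a).pathFactor (t + 1) (previous x t) (x t) y *
      ∫⁻ S, (A a).stepIntegral t h S (S.refIndex t) y ∂(A a).forwardLaw N x (t + 1) =
      ∫⁻ S, (A a).pathFactor (t + 1) (previous x t) (x t) y *
        (A a).stepIntegral t h S (S.refIndex t) y ∂(A a).forwardLaw N x (t + 1) :=
    fun y => (lintegral_const_mul' _ _ ENNReal.ofReal_ne_top).symm
  simp_rw [hmul]
  have hun : Measurable fun p : State D × ParticleSystem N D =>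
      (A a).pathFactor (t + 1) (previous x t) (x t) p.1 *
        (A a).stepIntegral t h p.2 (p.2.refIndex t) p.1 := by
    have h1 : Measurable fun p : State D × ParticleSystem N D =>
        (A a).pathFactor (t + 1) (previous x t) (x t) p.1 := hfac.comp measurable_fst
    exact h1.mul hstep
  have hswap := lintegral_lintegral_swap (μ := volume) (ν := (A a).forwardLaw N x (t + 1))
    (f := fun y S => (A a).pathFactor (t + 1) (previous x t) (x t) y *
        (A a).stepIntegral t h S (S.refIndex t) y) hun.aemeasurable
  rw [hswap]
  refine lintegral_congr_ae ?_
  -- Replaces the reference states in the path factor by the states of the reference particle and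
  -- its parent.
  filter_upwards [hA.ae_forwardLaw a x (by omega : t < T)] with S hS
  rw [hS.1, hS.2]

theorem IsRegular.sum_weight_mul (hA : IsRegular A T) (a : α) {t : ℕ} (ht : t < T)
    (S : ParticleSystem N D) (g : Fin (N + 1) → ENNReal) :
    ∑ k, ENNReal.ofReal ((A a).weight S t k) * g k = ENNReal.ofReal (∑ m, (A a).weight S t m) *
      ∑ k, ENNReal.ofReal ((A a).normWeight S t k) * g k := by
  have hs := hA.sum_weight_pos a S ht
  rw [Finset.mul_sum]
  refine Finset.sum_congr rfl fun k _ => ?_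
  rw [← mul_assoc, ← ENNReal.ofReal_mul hs.le, normWeight, mul_div_cancel₀ _ hs.ne']

/-- Averaged over the reference path up to time `t`, the forward pass depends on a function of the
particle system and the reference index only through its weighted sum over all indices. -/
theorem IsRegular.lmarginal_forwardLaw_congr (hA : IsRegular A T) (a : α) {t : ℕ} (ht : t < T)
    {h h' : ParticleSystem N D → Fin (N + 1) → ENNReal}
    (hh : ∀ k, Measurable fun S => h S k) (hh' : ∀ k, Measurable fun S => h' S k)
    (hr : ∀ S r k, h (r, S.2) k = h S k) (hr' : ∀ S r k, h' (r, S.2) k = h' S k)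
    (heq : ∀ S, ∑ k, ENNReal.ofReal ((A a).weight S t k) * h S k =
      ∑ k, ENNReal.ofReal ((A a).weight S t k) * h' S k) :
    (∫⋯∫⁻_upTo T t, (fun x => (A a).pathDensity (extendPath x) (t + 1) *
      ∫⁻ S, h S (S.refIndex t) ∂(A a).forwardLaw N (extendPath x) (t + 1)) ∂fun _ => volume) =
    ∫⋯∫⁻_upTo T t, (fun x => (A a).pathDensity (extendPath x) (t + 1) *
      ∫⁻ S, h' S (S.refIndex t) ∂(A a).forwardLaw N (extendPath x) (t + 1)) ∂fun _ => volume := by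
  induction t generalizing h h' with
  | zero =>
    -- At the initial time, integrating the reference state turns all particles into independent
    -- draws from the initial proposal, and only the weighted sum of h is left.
    have key : ∀ h : ParticleSystem N D → Fin (N + 1) → ENNReal,
        (∀ k, Measurable fun S => h S k) → (∀ S r k, h (r, S.2) k = h S k) →
        ∀ x : ℕ → State D, ∫⁻ y, (A a).pathDensity (Function.update x 0 y) (0 + 1) *
          ∫⁻ S, h S (S.refIndex 0) ∂(A a).forwardLaw N (Function.update x 0 y) (0 + 1) =
        ENNReal.ofReal (1 / ((N : ℝ) + 1)) *
          ∫⁻ z, ∑ k, ENNReal.ofReal ((A a).weight (init empty 0 z) 0 k) * h (init empty 0 z) k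
            ∂Measure.pi fun _ => lawOfDensity ((A a).proposal 0 0) := by
      intro h hh hr x
      have hA' : IsRegular (fun _ : State D => A a) T := hA.comp measurable_const
      have hm : Measurable fun S : ParticleSystem N D => h S (S.refIndex 0) :=
        measurable_eval_index hh (measurable_refIndex measurable_id _)
      have hinit : ∀ k z, h (init empty k z) k = h (init empty 0 z) k := fun k z =>
        hr (init empty 0 z) (init empty k z).1 k
      have hz : ∀ k, Measurable fun z => h (init empty 0 z) k := fun k =>
        (hh k).comp (by fun_prop)
      have hw : ∀ k, Measurable fun z => ENNReal.ofReal ((A a).weight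
          (init (empty : ParticleSystem N D) 0 z) 0 k) := fun k =>
        ((hA.comp measurable_const).measurable_weight (measurable_init measurable_const
          measurable_const measurable_id) ht k).ennreal_ofReal
      have hfwd : ∀ y, (A a).forwardLaw N (Function.update x 0 y) (0 + 1) =
          (A a).forwardStep (Function.update x 0 y) 0 empty := fun y =>
        Measure.dirac_bind (hA.measurable_forwardStep_fixed a _ ht) _
      have hpd : ∀ y, (A a).pathDensity (Function.update x 0 y) (0 + 1) =
          (A a).pathFactor 0 0 0 y := by
        intro y
        rw [pathDensity, Finset.prod_range_one, Function.update_self]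
        rfl
      simp_rw [hpd, hfwd, lintegral_forwardStep_zero _ _ _ hm, refIndex_init,
        Function.update_self, hinit, mul_left_comm _ (ENNReal.ofReal (1 / ((N : ℝ) + 1)))]
      have hsum : ∫⁻ z, ∑ k, ENNReal.ofReal ((A a).weight (init (empty : ParticleSystem N D) 0 z) 0 k) *
            h (init empty 0 z) k ∂Measure.pi (fun _ => lawOfDensity ((A a).proposal 0 0)) =
          ∑ k, ∫⁻ z, ENNReal.ofReal ((A a).weight (init (empty : ParticleSystem N D) 0 z) 0 k) *
            h (init empty 0 z) k ∂Measure.pi (fun _ => lawOfDensity ((A a).proposal 0 0)) :=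
        lintegral_finsetSum _ fun k _ => (hw k).mul (hz k)
      rw [lintegral_const_mul' _ _ ENNReal.ofReal_ne_top, hsum]
      refine congrArg _ ?_
      simp_rw [Finset.mul_sum]
      rw [lintegral_finsetSum]
      · refine Finset.sum_congr rfl fun k _ => ?_
        rw [hA.lintegral_particleLaw a ht k 0 (fun _ => 0) (hz k)]
        refine lintegral_congr fun z => ?_
        rw [weight, particle_init]
        rfl
      · intro k _
        refine (hA'.measurable_pathFactor ht measurable_const measurable_const measurable_id).mul ?_
        exact Measurable.lintegral_param (hA'.measurable_particleLaw ht measurable_const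
          measurable_id measurable_const) (fun y => hA.isProbabilityMeasure_particleLaw a ht _ _ _)
          ((hz k).comp measurable_snd)
    rw [upTo_zero ht, lmarginal_singleton, lmarginal_singleton]
    funext x
    simp_rw [extendPath_update ht]
    rw [key h hh hr, key h' hh' hr']
    simp_rw [heq]
  | succ t ih =>
    have ht' : t < T := by omega
    rw [upTo_succ ht, lmarginal_insert' _ (hA.measurable_forward_expectation a ht
      fun k => (hh k).comp measurable_snd) (notMem_upTo ht),
      lmarginal_insert' _ (hA.measurable_forward_expectation a ht
      fun k => (hh' k).comp measurable_snd) (notMem_upTo ht)]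
    simp_rw [extendPath_update ht, hA.lintegral_forward_succ a ht hh,
      hA.lintegral_forward_succ a ht hh']
    have hA' : IsRegular (fun _ : ParticleSystem N D × State D => A a) T := hA.comp measurable_const
    have meas : ∀ h : ParticleSystem N D → Fin (N + 1) → ENNReal,
        (∀ k, Measurable fun S => h S k) → ∀ k, Measurable fun S : ParticleSystem N D =>
        ENNReal.ofReal (1 / ((N : ℝ) + 1)) * ∫⁻ y, (A a).pathFactor (t + 1) (S.parent t k)
          (S.particle t k) y * (A a).stepIntegral t h S k y := by
      intro h hh k
      refine Measurable.const_mul (Measurable.lintegral_prod_right' (f := fun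
        p : ParticleSystem N D × State D => (A a).pathFactor (t + 1) (p.1.parent t k)
          (p.1.particle t k) p.2 * (A a).stepIntegral t h p.1 k p.2) ?_) _
      exact (hA'.measurable_pathFactor ht (measurable_parent measurable_fst t k)
        (measurable_particle measurable_fst t k) measurable_snd).mul
        (hA'.measurable_stepIntegral ht hh measurable_fst k measurable_snd)
    have ref : ∀ h : ParticleSystem N D → Fin (N + 1) → ENNReal,
        (∀ S r k, h (r, S.2) k = h S k) → ∀ (S : ParticleSystem N D) (r) (k : Fin (N + 1)),
        ENNReal.ofReal (1 / ((N : ℝ) + 1)) * ∫⁻ y, (A a).pathFactor (t + 1)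
          (parent (r, S.2) t k) (particle (r, S.2) t k) y * (A a).stepIntegral t h (r, S.2) k y =
        ENNReal.ofReal (1 / ((N : ℝ) + 1)) * ∫⁻ y, (A a).pathFactor (t + 1) (S.parent t k)
          (S.particle t k) y * (A a).stepIntegral t h S k y := by
      intro h hr S r k
      simp_rw [stepIntegral_withRef (A a) t hr, parent_withRef]
      rfl
    -- The induction hypothesis is applied to the two functions produced by integrating out time t +
    -- 1. Their weighted sums at time t are integrals of the weighted sums of h and h' at time t +
    -- 1, which agree.
    refine ih ht' (meas h hh) (meas h' hh') (ref h hr) (ref h' hr') fun S => ?_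
    rw [hA.sum_weight_mul a ht', hA.sum_weight_mul a ht']
    simp_rw [mul_left_comm _ (ENNReal.ofReal (1 / ((N : ℝ) + 1))), ← Finset.mul_sum,
      hA.sum_normWeight_mul_stepIntegral a ht hh hr, hA.sum_normWeight_mul_stepIntegral a ht hh' hr',
      heq]

end CSMCIngredients

/-! ### Backward sampling in terms of the selected states -/

namespace CSMCIngredients

open ParticleSystem

variable {N D T : ℕ}

/-- The backward-sampling weight of index `i` at time `t`, given the later states `X`. -/
def pathBackwardWeight (A : CSMCIngredients D) (S : ParticleSystem N D) (X : ℕ → State D) (t : ℕ)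
    (i : Fin (N + 1)) : ℝ :=
  A.normWeight S t i *
    A.backward t (S.parent t i) (S.particle t i) (X (t + 1)) (X (t + 2))

/-- The normalised backward-sampling weight of index `i` at time `t`, given the later states `X`. -/
def pathBackwardProb (A : CSMCIngredients D) (S : ParticleSystem N D) (X : ℕ → State D) (t : ℕ)
    (i : Fin (N + 1)) : ENNReal :=
  ENNReal.ofReal (A.pathBackwardWeight S X t i / ∑ n, A.pathBackwardWeight S X t n)

/-- Expectation of `f` under backward sampling of the states before time `s`, given the states `X`
from time `s` on. -/
def pathBackward (A : CSMCIngredients D) (f : (ℕ → State D) → ENNReal) (S : ParticleSystem N D) :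
    ℕ → (ℕ → State D) → ENNReal
  | 0, X => f X
  | s + 1, X => ∑ i, A.pathBackwardProb S X s i *
      pathBackward A f S s (Function.update X s (S.particle s i))

/-- Only the states picked by the later indices matter. After this translation backward sampling can
also be started from later states that need not be particles, in particular from the reference path.
-/
theorem lintegral_backwardLaw (A : CSMCIngredients D) {f : (ℕ → State D) → ENNReal}
    (hf : Measurable f) (S : ParticleSystem N D) (s : ℕ) (l : ℕ → Fin (N + 1)) :
    ∫⁻ l', f (fun t => S.particle t (l' t)) ∂A.backwardLaw S s l =
      A.pathBackward f S s fun t => S.particle t (l t) := by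
  have hm : Measurable fun l' : ℕ → Fin (N + 1) => f fun t => S.particle t (l' t) :=
    hf.comp (measurable_outputPath measurable_const measurable_id)
  induction s generalizing l with
  | zero => exact lintegral_dirac' _ hm
  | succ s ih =>
    rw [lintegral_backwardLaw_succ _ _ _ _ hm, pathBackward]
    refine Finset.sum_congr rfl fun i _ => ?_
    have h : (fun t => S.particle t (Function.update l s i t)) =
        Function.update (fun t => S.particle t (l t)) s (S.particle s i) := by
      funext t
      by_cases ht : t = s
      · subst ht; simp
      · simp [Function.update_of_ne ht]
    rw [ih, h]
    rfl

/-- Backward weights look two steps ahead; `hlast` guarantees that they never read a value at or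
beyond the horizon T. -/
theorem pathBackward_congr (A : CSMCIngredients D)
    (hlast : ∀ t, T ≤ t + 2 → ∀ xp x xn xnn xnn',
      A.backward t xp x xn xnn = A.backward t xp x xn xnn')
    {f : (ℕ → State D) → ENNReal} (hf : ∀ X X' : ℕ → State D, (∀ t < T, X t = X' t) → f X = f X')
    (S : ParticleSystem N D) {s : ℕ} (hs : s < T) {X X' : ℕ → State D}
    (hX : ∀ t, s ≤ t → t < T → X t = X' t) :
    A.pathBackward f S s X = A.pathBackward f S s X' := by
  induction s generalizing X X' with
  | zero => exact hf X X' fun t ht => hX t (by omega) ht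
  | succ s ih =>
    have hw : A.pathBackwardWeight S X s = A.pathBackwardWeight S X' s := by
      funext i
      rw [pathBackwardWeight, pathBackwardWeight, hX (s + 1) le_rfl hs]
      by_cases h : s + 2 < T
      · rw [hX (s + 2) (by omega) h]
      · rw [hlast s (by omega) _ _ _ (X (s + 2)) (X' (s + 2))]
    refine Finset.sum_congr rfl fun i _ => ?_
    rw [pathBackwardProb, pathBackwardProb, hw]
    refine congrArg _ (ih (by omega) fun t h1 h2 => ?_)
    by_cases ht : t = s
    · subst ht; simp
    · rw [Function.update_of_ne ht, Function.update_of_ne ht, hX t (by omega) h2]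

theorem pathBackward_withRef (A : CSMCIngredients D) (f : (ℕ → State D) → ENNReal)
    (S : ParticleSystem N D) (r : ℕ → Fin (N + 1)) (s : ℕ) (X : ℕ → State D) :
    A.pathBackward f ((r, S.2) : ParticleSystem N D) s X = A.pathBackward f S s X := by
  induction s generalizing X with
  | zero => rfl
  | succ s ih =>
    have hw : A.pathBackwardWeight (r, S.2) X s = A.pathBackwardWeight S X s := by
      funext i
      rw [pathBackwardWeight, pathBackwardWeight, normWeight_withRef, parent_withRef]
      rfl
    refine Finset.sum_congr rfl fun i _ => ?_
    rw [pathBackwardProb, pathBackwardProb, hw, ih]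
    rfl

/-- Sampling the states before s uses particles at times below s only, so particles created at t + 1
≥ s are invisible. -/
theorem pathBackward_extend (A : CSMCIngredients D) (f : (ℕ → State D) → ENNReal)
    (S : ParticleSystem N D) (t : ℕ) (k : Fin (N + 1)) (b : Fin (N + 1) → Fin (N + 1))
    (z : Fin (N + 1) → State D) {s : ℕ} (hs : s ≤ t + 1) (X : ℕ → State D) :
    A.pathBackward f (extend t S k b z) s X = A.pathBackward f S s X := by
  induction s generalizing X with
  | zero => rfl
  | succ s ih =>
    have hs' : s ≤ t := by omega
    have hw : A.pathBackwardWeight (extend t S k b z) X s = A.pathBackwardWeight S X s := by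
      funext i
      rw [pathBackwardWeight, pathBackwardWeight, parent_extend_of_le _ _ _ _ _ hs',
        particle_extend_of_le _ _ _ _ _ hs', normWeight, normWeight,
        weight_extend_of_le _ _ _ _ _ _ hs']
      simp_rw [weight_extend_of_le A S t k b z hs']
    refine Finset.sum_congr rfl fun i _ => ?_
    rw [pathBackwardProb, pathBackwardProb, hw, ih (by omega),
      particle_extend_of_le _ _ _ _ _ hs']

variable {α : Type*} [MeasurableSpace α] {A : α → CSMCIngredients D}

theorem IsRegular.pathBackwardWeight_pos (hA : IsRegular A T) (a : α) {t : ℕ} (ht : t + 1 < T)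
    (S : ParticleSystem N D) (X : ℕ → State D) (i : Fin (N + 1)) :
    0 < (A a).pathBackwardWeight S X t i :=
  mul_pos (hA.normWeight_pos a S (by omega) i) (hA.backward_pos a t ht _ _ _ _)

theorem IsRegular.measurable_pathBackwardWeight (hA : IsRegular A T) {t : ℕ} (ht : t + 1 < T)
    {S : α → ParticleSystem N D} (hS : Measurable S) {X : α → ℕ → State D} (hX : Measurable X)
    (i : Fin (N + 1)) : Measurable fun a => (A a).pathBackwardWeight (S a) (X a) t i :=
  (hA.measurable_normWeight hS (by omega) i).mul (hA.measurable_backward_comp ht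
    (measurable_parent hS t i) (measurable_particle hS t i) ((measurable_pi_apply _).comp hX)
    ((measurable_pi_apply _).comp hX))

theorem IsRegular.measurable_pathBackwardProb (hA : IsRegular A T) {t : ℕ} (ht : t + 1 < T)
    {S : α → ParticleSystem N D} (hS : Measurable S) {X : α → ℕ → State D} (hX : Measurable X)
    (i : Fin (N + 1)) : Measurable fun a => (A a).pathBackwardProb (S a) (X a) t i :=
  ((hA.measurable_pathBackwardWeight ht hS hX i).div (Finset.measurable_sum _ fun n _ =>
    hA.measurable_pathBackwardWeight ht hS hX n)).ennreal_ofReal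

theorem IsRegular.measurable_pathBackward (hA : IsRegular A T) {s : ℕ} (hs : s < T)
    {f : (ℕ → State D) → ENNReal} (hf : Measurable f)
    {S : α → ParticleSystem N D} (hS : Measurable S) {X : α → ℕ → State D} (hX : Measurable X) :
    Measurable fun a => (A a).pathBackward f (S a) s (X a) := by
  induction s generalizing X with
  | zero => exact hf.comp hX
  | succ s ih =>
    exact Finset.measurable_sum _ fun i _ => (hA.measurable_pathBackwardProb hs hS hX i).mul
      (ih (by omega) (measurable_update'.comp (hX.prodMk (measurable_particle hS s i))))

/-- A forward step does not change the past. -/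
theorem IsRegular.lintegral_forwardStep_pathBackward (hA : IsRegular A T) (a : α) {t : ℕ}
    (ht : t < T) {f : (ℕ → State D) → ENNReal} (hf : Measurable f) (x : ℕ → State D)
    (S : ParticleSystem N D) (X : ℕ → State D) :
    ∫⁻ S', (A a).pathBackward f S' t X ∂(A a).forwardStep x t S = (A a).pathBackward f S t X := by
  have hprob := hA.isProbabilityMeasure_forwardStep a x S ht
  have hm : Measurable fun S' : ParticleSystem N D => (A a).pathBackward f S' t X :=
    (hA.comp measurable_const).measurable_pathBackward ht hf measurable_id measurable_const
  have hset : MeasurableSet {S' : ParticleSystem N D |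
      (A a).pathBackward f S' t X = (A a).pathBackward f S t X} :=
    measurableSet_eq_fun hm measurable_const
  have hae : ∀ᵐ S' ∂(A a).forwardStep x t S,
      (A a).pathBackward f S' t X = (A a).pathBackward f S t X := by
    cases t with
    | zero => exact Filter.Eventually.of_forall fun S' => rfl
    | succ t =>
      rw [forwardStep_succ]
      refine ae_bind (measurable_of_finite _) hset (Filter.Eventually.of_forall fun k => ?_)
      refine ae_bind (measurable_of_finite _) hset (Filter.Eventually.of_forall fun b => ?_)
      rw [ae_map_iff (by fun_prop) hset]
      exact Filter.Eventually.of_forall fun z => pathBackward_extend _ _ _ _ _ _ _ le_rfl _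
  rw [lintegral_congr_ae hae, lintegral_const, measure_univ, mul_one]

end CSMCIngredients

/-! ### Factorising the path density at a given time -/

namespace CSMCIngredients

open ParticleSystem

variable {N D T : ℕ}

/-- The backward factors agree, up to factors depending only on later states, with those factors of
the path density that involve the current state and a later one. -/
structure IsCompatible (A : CSMCIngredients D) (T : ℕ) : Prop where
  backward_last : ∀ t, T ≤ t + 2 → ∀ xp x xn xnn xnn',
    A.backward t xp x xn xnn = A.backward t xp x xn xnn'
  pathFactor_mul : ∀ t, t + 1 < T → ∃ c : State D × State D → ENNReal, Measurable c ∧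
    (∀ p, c p ≠ ⊤) ∧ ∀ xp x xn xnn,
      A.pathFactor (t + 1) xp x xn * (if t + 2 < T then A.pathFactor (t + 2) x xn xnn else 1) =
        ENNReal.ofReal (A.backward t xp x xn xnn) * c (xn, xnn)

variable {α : Type*} [MeasurableSpace α] {A : α → CSMCIngredients D}

/-- The exchangeability of the reference index, now for functions that may also depend on the
reference states after t. Those states are held fixed while the earlier ones are integrated out. -/
theorem IsRegular.lintegral_forwardLaw_congr (hA : IsRegular A T) (a : α) {t : ℕ} (ht : t < T)
    {h h' : (Fin T → State D) → ParticleSystem N D → Fin (N + 1) → ENNReal}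
    (hh : ∀ k, Measurable fun p : (Fin T → State D) × ParticleSystem N D => h p.1 p.2 k)
    (hh' : ∀ k, Measurable fun p : (Fin T → State D) × ParticleSystem N D => h' p.1 p.2 k)
    (hr : ∀ x S r k, h x (r, S.2) k = h x S k) (hr' : ∀ x S r k, h' x (r, S.2) k = h' x S k)
    (hx : ∀ x x' : Fin T → State D, (∀ i : Fin T, t < i → x i = x' i) → h x = h x')
    (hx' : ∀ x x' : Fin T → State D, (∀ i : Fin T, t < i → x i = x' i) → h' x = h' x')
    (heq : ∀ x S, ∑ k, ENNReal.ofReal ((A a).weight S t k) * h x S k =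
      ∑ k, ENNReal.ofReal ((A a).weight S t k) * h' x S k) :
    ∫⁻ x : Fin T → State D, (A a).pathDensity (extendPath x) (t + 1) *
      ∫⁻ S, h x S (S.refIndex t) ∂(A a).forwardLaw N (extendPath x) (t + 1) =
    ∫⁻ x : Fin T → State D, (A a).pathDensity (extendPath x) (t + 1) *
      ∫⁻ S, h' x S (S.refIndex t) ∂(A a).forwardLaw N (extendPath x) (t + 1) := by
  refine lintegral_eq_of_lmarginal_eq (μ := fun _ => volume) (upTo T t)
    (hA.measurable_forward_expectation a ht hh) (hA.measurable_forward_expectation a ht hh') ?_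
  -- Integrating over the times up to t leaves the later coordinates at those of x₀, and h depends
  -- on no others.
  have freeze : ∀ h : (Fin T → State D) → ParticleSystem N D → Fin (N + 1) → ENNReal,
      (∀ x x' : Fin T → State D, (∀ i : Fin T, t < i → x i = x' i) → h x = h x') → ∀ x₀,
      (∫⋯∫⁻_upTo T t, (fun x => (A a).pathDensity (extendPath x) (t + 1) *
        ∫⁻ S, h x S (S.refIndex t) ∂(A a).forwardLaw N (extendPath x) (t + 1))
          ∂fun _ => volume) x₀ =
      (∫⋯∫⁻_upTo T t, (fun x => (A a).pathDensity (extendPath x) (t + 1) *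
        ∫⁻ S, h x₀ S (S.refIndex t) ∂(A a).forwardLaw N (extendPath x) (t + 1))
          ∂fun _ => volume) x₀ := by
    intro h hx x₀
    refine lintegral_congr fun y => ?_
    have h1 : h (Function.updateFinset x₀ (upTo T t) y) = h x₀ := by
      refine hx _ _ fun i hi => ?_
      rw [Function.updateFinset, dif_neg]
      simp only [upTo, Finset.mem_filter, Finset.mem_univ, true_and]
      omega
    dsimp only
    rw [h1]
  funext x₀
  rw [freeze h hx x₀, freeze h' hx' x₀]
  exact congrFun (hA.lmarginal_forwardLaw_congr a ht (fun k => (hh k).comp measurable_prodMk_left)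
    (fun k => (hh' k).comp measurable_prodMk_left) (hr x₀) (hr' x₀) (heq x₀)) x₀

/-- Factors up to time t involve no later state, the factors at t + 1 and t + 2 are given by the
backward weight and c, and from t + 3 on no factor reaches back to time t. Hence the remainder R is
constant when a state at time t is redrawn. -/
theorem IsCompatible.pathDensity_eq {A : CSMCIngredients D} (hc : A.IsCompatible T) {t : ℕ}
    (ht : t + 1 < T) (hm : ∀ s < T, Measurable fun p : State D × State D × State D =>
      A.pathFactor s p.1 p.2.1 p.2.2) :
    ∃ R : (Fin T → State D) → ENNReal, Measurable R ∧ (∀ x, R x ≠ ⊤) ∧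
      (∀ x x' : Fin T → State D, (∀ i : Fin T, t < i → x i = x' i) → R x = R x') ∧
      ∀ x, A.pathDensity (extendPath x) T = A.pathDensity (extendPath x) (t + 1) *
        (ENNReal.ofReal (A.backward t (previous (extendPath x) t) (extendPath x t)
          (extendPath x (t + 1)) (extendPath x (t + 2))) * R x) := by
  obtain ⟨c, hcm, hct, h⟩ := hc.pathFactor_mul t ht
  have hX : ∀ s, Measurable fun x : Fin T → State D => extendPath x s := fun s => by fun_prop
  have hext : ∀ x x' : Fin T → State D, (∀ i : Fin T, t < i → x i = x' i) → ∀ s, t < s →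
      extendPath x s = extendPath x' s := by
    intro x x' hx s hs
    by_cases hsT : s < T
    · rw [extendPath_of_lt _ hsT, extendPath_of_lt _ hsT, hx _ hs]
    · simp [extendPath, hsT]
  let P : (Fin T → State D) → ℕ → ENNReal := fun x s => A.pathFactor s
    (previous (previous (extendPath x)) s) (previous (extendPath x) s) (extendPath x s)
  have hP : ∀ s, t + 3 ≤ s → ∀ x, P x s = A.pathFactor s (extendPath x (s - 2))
      (extendPath x (s - 1)) (extendPath x s) := by
    intro s hs x
    obtain ⟨r, rfl⟩ : ∃ r, s = r + 2 := ⟨s - 2, by omega⟩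
    rfl
  refine ⟨fun x => c (extendPath x (t + 1), extendPath x (t + 2)) *
    ∏ s ∈ Finset.Ico (t + 3) T, P x s, ?_, ?_, ?_, ?_⟩
  · refine (hcm.comp ((hX _).prodMk (hX _))).mul (Finset.measurable_prod _ fun s hs => ?_)
    have hs' := Finset.mem_Ico.1 hs
    simp_rw [hP s hs'.1]
    exact (hm s hs'.2).comp ((hX _).prodMk ((hX _).prodMk (hX _)))
  · exact fun x => ENNReal.mul_ne_top (hct _)
      (ENNReal.prod_ne_top fun _ _ => ENNReal.ofReal_ne_top)
  · intro x x' hx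
    have h1 := hext x x' hx
    dsimp only
    rw [h1 (t + 1) (by omega), h1 (t + 2) (by omega)]
    refine congrArg _ (Finset.prod_congr rfl fun s hs => ?_)
    have hs' := (Finset.mem_Ico.1 hs).1
    rw [hP s hs', hP s hs', h1 s (by omega), h1 (s - 1) (by omega), h1 (s - 2) (by omega)]
  · intro x
    dsimp only
    rw [← mul_assoc (ENNReal.ofReal _), ← h]
    have h2 : A.pathDensity (extendPath x) (t + 2) = A.pathDensity (extendPath x) (t + 1) *
      A.pathFactor (t + 1) (previous (extendPath x) t) (extendPath x t) (extendPath x (t + 1)) :=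
      pathDensity_succ _ _ _
    rw [← mul_assoc, ← mul_assoc, ← h2]
    split_ifs with h3
    · have h4 : A.pathDensity (extendPath x) (t + 3) = A.pathDensity (extendPath x) (t + 2) *
        A.pathFactor (t + 2) (extendPath x t) (extendPath x (t + 1)) (extendPath x (t + 2)) :=
        pathDensity_succ _ _ _
      rw [← h4]
      exact (Finset.prod_range_mul_prod_Ico (P x) h3).symm
    -- Here t + 1 is the final time, so there is no factor at t + 2 and no remaining product.
    · rw [Finset.Ico_eq_empty (by omega), Finset.prod_empty, mul_one, mul_one]
      exact congrArg _ (show T = t + 2 by omega)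

end CSMCIngredients

/-! ### Invariance under backward sampling and the forced move -/

namespace CSMCIngredients

open ParticleSystem

variable {N D T : ℕ}

theorem IsCompatible.pathBackward_update_congr {A : CSMCIngredients D} (hc : A.IsCompatible T)
    {f : (ℕ → State D) → ENNReal} (hf : ∀ X X' : ℕ → State D, (∀ t < T, X t = X' t) → f X = f X')
    (S : ParticleSystem N D) {t : ℕ} (ht : t < T) {x x' : Fin T → State D}
    (hx : ∀ i : Fin T, t < i → x i = x' i) (y : State D) :
    A.pathBackward f S t (Function.update (extendPath x) t y) =
      A.pathBackward f S t (Function.update (extendPath x') t y) := by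
  refine pathBackward_congr A hc.backward_last hf S ht fun s h1 h2 => ?_
  by_cases h : s = t
  · subst h; simp
  · rw [Function.update_of_ne h, Function.update_of_ne h, extendPath_of_lt _ h2,
      extendPath_of_lt _ h2, hx _ (by simpa using by omega)]

variable {α : Type*} [MeasurableSpace α] {A : α → CSMCIngredients D}

theorem extendPath_congr_of_lt {x x' : Fin T → State D} {t : ℕ}
    (hx : ∀ i : Fin T, t < i → x i = x' i) {s : ℕ} (hs : t < s) :
    extendPath x s = extendPath x' s := by
  by_cases hsT : s < T
  · rw [extendPath_of_lt _ hsT, extendPath_of_lt _ hsT, hx _ hs]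
  · simp [extendPath, hsT]

/-- Backward sampling of a single state: selecting by `W b` and selecting by the backward
probabilities have the same total mass. -/
theorem IsRegular.sum_weight_mul_pathBackwardProb (hA : IsRegular A T) (a : α) {t : ℕ}
    (ht : t + 1 < T) (S : ParticleSystem N D) (X : ℕ → State D) (g : Fin (N + 1) → ENNReal) :
    ∑ k, ENNReal.ofReal ((A a).normWeight S t k) * (ENNReal.ofReal ((A a).backward t
        (S.parent t k) (S.particle t k) (X (t + 1)) (X (t + 2))) *
          ∑ i, (A a).pathBackwardProb S X t i * g i) =
      ∑ k, ENNReal.ofReal ((A a).normWeight S t k) * (ENNReal.ofReal ((A a).backward t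
        (S.parent t k) (S.particle t k) (X (t + 1)) (X (t + 2))) * g k) := by
  have hpos := hA.pathBackwardWeight_pos a ht S X
  have hsum : 0 < ∑ n, (A a).pathBackwardWeight S X t n :=
    Finset.sum_pos (fun n _ => hpos n) Finset.univ_nonempty
  have hk : ∀ k, ENNReal.ofReal ((A a).normWeight S t k) * ENNReal.ofReal ((A a).backward t
      (S.parent t k) (S.particle t k) (X (t + 1)) (X (t + 2))) =
      ENNReal.ofReal ((A a).pathBackwardWeight S X t k) := fun k =>
    (ENNReal.ofReal_mul (hA.normWeight_pos a S (by omega) k).le).symm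
  simp_rw [← mul_assoc, hk]
  rw [← Finset.sum_mul, ← ENNReal.ofReal_sum_of_nonneg fun k _ => (hpos k).le, Finset.mul_sum]
  refine Finset.sum_congr rfl fun i _ => ?_
  rw [pathBackwardProb, ← mul_assoc, ← ENNReal.ofReal_mul hsum.le, mul_div_cancel₀ _ hsum.ne']

/-- A forward pass followed by backward sampling of the states before time `s` given the reference
path from time `s` on leaves the path density invariant. -/
theorem IsRegular.lintegral_pathBackward (hA : IsRegular A T) (a : α) (hc : (A a).IsCompatible T)
    {f : (ℕ → State D) → ENNReal} (hf : Measurable f)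
    (hfT : ∀ X X' : ℕ → State D, (∀ t < T, X t = X' t) → f X = f X') {s : ℕ} (hs : s < T) :
    ∫⁻ x : Fin T → State D, (A a).pathDensity (extendPath x) T *
      ∫⁻ S : ParticleSystem N D, (A a).pathBackward f S s (extendPath x)
        ∂(A a).forwardLaw N (extendPath x) s =
    ∫⁻ x : Fin T → State D, (A a).pathDensity (extendPath x) T * f (extendPath x) := by
  induction s with
  | zero =>
    refine lintegral_congr fun x => ?_
    simp only [pathBackward, lintegral_const]
    rw [forwardLaw, measure_univ, mul_one]
  | succ t ih =>
    have ht : t < T := by omega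
    have hX : ∀ r, Measurable fun p : (Fin T → State D) × ParticleSystem N D =>
        extendPath p.1 r := fun r => by fun_prop
    have hX' : Measurable fun p : (Fin T → State D) × ParticleSystem N D => extendPath p.1 :=
      measurable_extendPath.comp measurable_fst
    have hA' : IsRegular (fun _ : (Fin T → State D) × ParticleSystem N D => A a) T :=
      hA.comp measurable_const
    have hpf : ∀ s < T, Measurable fun p : State D × State D × State D =>
        (A a).pathFactor s p.1 p.2.1 p.2.2 := fun s hs =>
      (hA.comp (φ := fun _ => a) measurable_const).measurable_pathFactor hs measurable_fst
        (measurable_fst.comp measurable_snd) (measurable_snd.comp measurable_snd)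
    obtain ⟨R, hRm, hRt, hRx, hR⟩ := hc.pathDensity_eq hs hpf
    let b : (Fin T → State D) → ParticleSystem N D → Fin (N + 1) → ENNReal := fun x S k =>
      ENNReal.ofReal ((A a).backward t (S.parent t k) (S.particle t k) (extendPath x (t + 1))
        (extendPath x (t + 2)))
    let Φ : (Fin T → State D) → ParticleSystem N D → Fin (N + 1) → ENNReal := fun x S i =>
      (A a).pathBackward f S t (Function.update (extendPath x) t (S.particle t i))
    let Ψ : (Fin T → State D) → ParticleSystem N D → ENNReal := fun x S =>
      ∑ i, (A a).pathBackwardProb S (extendPath x) t i * Φ x S i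
    have hb : ∀ k, Measurable fun p : (Fin T → State D) × ParticleSystem N D => b p.1 p.2 k :=
      fun k => (hA'.measurable_backward_comp hs (measurable_parent measurable_snd t k)
        (measurable_particle measurable_snd t k) (hX _) (hX _)).ennreal_ofReal
    have hΦ : ∀ k, Measurable fun p : (Fin T → State D) × ParticleSystem N D => Φ p.1 p.2 k :=
      fun k => hA'.measurable_pathBackward ht hf measurable_snd
        (measurable_update'.comp (hX'.prodMk (measurable_particle measurable_snd t k)))
    have hΨ : Measurable fun p : (Fin T → State D) × ParticleSystem N D => Ψ p.1 p.2 :=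
      Finset.measurable_sum _ fun i _ =>
        (hA'.measurable_pathBackwardProb hs measurable_snd hX' i).mul (hΦ i)
    have hRm' : Measurable fun p : (Fin T → State D) × ParticleSystem N D => R p.1 :=
      hRm.comp measurable_fst
    have hbx : ∀ x x' : Fin T → State D, (∀ i : Fin T, t < i → x i = x' i) → b x = b x' := by
      intro x x' h
      funext S k
      simp only [b, extendPath_congr_of_lt h (show t < t + 1 by omega),
        extendPath_congr_of_lt h (show t < t + 2 by omega)]
    have hΦx : ∀ x x' : Fin T → State D, (∀ i : Fin T, t < i → x i = x' i) → Φ x = Φ x' := by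
      intro x x' h
      funext S k
      exact hc.pathBackward_update_congr hfT S ht h _
    have hΨx : ∀ x x' : Fin T → State D, (∀ i : Fin T, t < i → x i = x' i) → Ψ x = Ψ x' := by
      intro x x' h
      funext S
      simp only [Ψ, hΦx x x' h, pathBackwardProb, pathBackwardWeight,
        extendPath_congr_of_lt h (show t < t + 1 by omega),
        extendPath_congr_of_lt h (show t < t + 2 by omega)]
    have hbr : ∀ x S r k, b x (r, S.2) k = b x S k := by
      intro x S r k
      simp only [b, parent_withRef]
      rfl
    have hΦr : ∀ x S r k, Φ x (r, S.2) k = Φ x S k := fun x S r k =>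
      pathBackward_withRef _ _ _ _ _ _
    have hΨr : ∀ x S r, Ψ x (r, S.2) = Ψ x S := by
      intro x S r
      simp only [Ψ, hΦr, pathBackwardProb, pathBackwardWeight, normWeight_withRef, parent_withRef]
      rfl
    -- On the left the state at time t is redrawn by backward sampling; on the right it is that of
    -- the reference index. The weighted sums agree because the redraw preserves W_t times the
    -- backward factor b.
    have key := hA.lintegral_forwardLaw_congr (N := N) a ht
      (h := fun x S k => R x * (b x S k * Ψ x S)) (h' := fun x S k => R x * (b x S k * Φ x S k))
      (fun k => hRm'.mul ((hb k).mul hΨ)) (fun k => hRm'.mul ((hb k).mul (hΦ k)))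
      (fun x S r k => by simp only [hbr, hΨr]) (fun x S r k => by simp only [hbr, hΦr])
      (fun x x' h => by simp only [hRx x x' h, hbx x x' h, hΨx x x' h])
      (fun x x' h => by simp only [hRx x x' h, hbx x x' h, hΦx x x' h])
      (fun x S => by
        rw [hA.sum_weight_mul a ht, hA.sum_weight_mul a ht]
        simp_rw [mul_left_comm _ (R x), ← Finset.mul_sum]
        exact congrArg _ (congrArg _ (hA.sum_weight_mul_pathBackwardProb a hs S (extendPath x)
          (Φ x S))))
    -- Evaluated at the reference index, b is almost surely the backward factor of the reference
    -- path, so R and b complete the density up to time t to the full path density.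
    have hae : ∀ (x : Fin T → State D) (g : ParticleSystem N D → Fin (N + 1) → ENNReal)
        (g' : ParticleSystem N D → ENNReal), Measurable g' →
        (∀ S : ParticleSystem N D, S.particle t (S.refIndex t) = extendPath x t →
          g S (S.refIndex t) = g' S) →
        (A a).pathDensity (extendPath x) (t + 1) * ∫⁻ S, R x * (b x S (S.refIndex t) *
          g S (S.refIndex t)) ∂(A a).forwardLaw N (extendPath x) (t + 1) =
        (A a).pathDensity (extendPath x) T *
          ∫⁻ S, g' S ∂(A a).forwardLaw N (extendPath x) (t + 1) := by
      intro x g g' hg' hgg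
      rw [hR, mul_assoc, mul_comm (ENNReal.ofReal _) (R x), ← lintegral_const_mul _ hg']
      refine congrArg _ (lintegral_congr_ae ?_)
      filter_upwards [hA.ae_forwardLaw a (extendPath x) ht] with S hS
      simp only [b]
      rw [hgg S hS.1, hS.1, hS.2, mul_assoc]
    have h1 : ∀ x : Fin T → State D, (A a).pathDensity (extendPath x) (t + 1) *
        ∫⁻ S, R x * (b x S (S.refIndex t) * Ψ x S)
          ∂(A a).forwardLaw N (extendPath x) (t + 1) =
        (A a).pathDensity (extendPath x) T * ∫⁻ S : ParticleSystem N D,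
          (A a).pathBackward f S (t + 1) (extendPath x)
            ∂(A a).forwardLaw N (extendPath x) (t + 1) := fun x =>
      hae x (fun S _ => Ψ x S) (Ψ x) (hΨ.of_uncurry_left (x := x)) fun S _ => rfl
    have h2 : ∀ x : Fin T → State D, (A a).pathDensity (extendPath x) (t + 1) *
        ∫⁻ S, R x * (b x S (S.refIndex t) * Φ x S (S.refIndex t))
          ∂(A a).forwardLaw N (extendPath x) (t + 1) =
        (A a).pathDensity (extendPath x) T * ∫⁻ S : ParticleSystem N D,
          (A a).pathBackward f S t (extendPath x)
            ∂(A a).forwardLaw N (extendPath x) t := by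
      intro x
      have hm : Measurable fun S : ParticleSystem N D =>
          (A a).pathBackward f S t (extendPath x) :=
        (hA.comp measurable_const).measurable_pathBackward ht hf measurable_id measurable_const
      -- The reference particle carries the reference state, so writing it into the reference path
      -- changes nothing. Afterwards the particles of time t are not used, and the last forward step
      -- can be dropped.
      rw [hae x (Φ x) _ hm fun S hS => by simp only [Φ, hS, Function.update_eq_self]]
      rw [forwardLaw, Measure.lintegral_bind
        (hA.measurable_forwardStep_fixed a (extendPath x) ht).aemeasurable hm.aemeasurable]
      simp_rw [hA.lintegral_forwardStep_pathBackward a ht hf]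
    simp_rw [h1, h2] at key
    rw [key, ih ht]

/-- Conditional sequential Monte Carlo leaves the path density invariant. -/
theorem IsRegular.lintegral_outputLaw_pathDensity (hA : IsRegular A T) (a : α)
    (hc : (A a).IsCompatible T) (hN : 1 ≤ N) (hT : 1 ≤ T) {f : (Fin T → State D) → ENNReal}
    (hf : Measurable f) :
    ∫⁻ x : Fin T → State D, (A a).pathDensity (extendPath x) T *
      ∫⁻ y, f y ∂(A a).outputLaw N x =
    ∫⁻ x : Fin T → State D, (A a).pathDensity (extendPath x) T * f x := by
  obtain ⟨t, rfl⟩ : ∃ t, T = t + 1 := ⟨T - 1, by omega⟩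
  have ht : t < t + 1 := by omega
  let f' : (ℕ → State D) → ENNReal := fun X => f fun i : Fin (t + 1) => X i
  have hf' : Measurable f' := hf.comp (measurable_pi_lambda _ fun i => measurable_pi_apply _)
  have hfT : ∀ X X' : ℕ → State D, (∀ s < t + 1, X s = X' s) → f' X = f' X' := fun X X' h =>
    congrArg f (funext fun i => h i i.2)
  have hfx : ∀ x : Fin (t + 1) → State D, f' (extendPath x) = f x := fun x =>
    congrArg f (funext fun i => extendPath_val x i)
  have hX' : Measurable fun p : (Fin (t + 1) → State D) × ParticleSystem N D => extendPath p.1 :=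
    measurable_extendPath.comp measurable_fst
  have hA' : IsRegular (fun _ : (Fin (t + 1) → State D) × ParticleSystem N D => A a) (t + 1) :=
    hA.comp measurable_const
  let Φ : (Fin (t + 1) → State D) → ParticleSystem N D → Fin (N + 1) → ENNReal := fun x S i =>
    (A a).pathBackward f' S t (Function.update (extendPath x) t (S.particle t i))
  -- The forced move reads the stored reference index. Overwriting it by an explicit k gives a
  -- function that no longer depends on the stored indices, as exchangeability requires.
  let setRef : ParticleSystem N D → Fin (N + 1) → ParticleSystem N D := fun S k =>
    (Function.update S.refIndex t k, S.2)
  let Ψ : (Fin (t + 1) → State D) → ParticleSystem N D → Fin (N + 1) → ENNReal := fun x S k =>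
    ∫⁻ i, Φ x S i ∂(A a).finalIndexLaw (setRef S k) t
  have hΦ : ∀ k, Measurable fun p : (Fin (t + 1) → State D) × ParticleSystem N D =>
      Φ p.1 p.2 k := fun k => hA'.measurable_pathBackward ht hf' measurable_snd
    (measurable_update'.comp (hX'.prodMk (measurable_particle measurable_snd t k)))
  have hΨ : ∀ k, Measurable fun p : (Fin (t + 1) → State D) × ParticleSystem N D =>
      Ψ p.1 p.2 k := by
    intro k
    refine Measurable.lintegral_param (hA'.measurable_finalIndexLaw ht ?_)
      (fun p => hA.isProbabilityMeasure_finalIndexLaw hN ht a _)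
      (measurable_from_prod_countable_left hΦ)
    exact (measurable_update'.comp ((measurable_fst.comp measurable_snd).prodMk
      measurable_const)).prodMk (measurable_snd.comp measurable_snd)
  have hΦx : ∀ x x' : Fin (t + 1) → State D, (∀ i : Fin (t + 1), t < i → x i = x' i) →
      Φ x = Φ x' := by
    intro x x' h
    funext S k
    exact hc.pathBackward_update_congr hfT S ht h _
  have hΦr : ∀ x S r k, Φ x (r, S.2) k = Φ x S k := fun x S r k =>
    pathBackward_withRef _ _ _ _ _ _
  have hΨx : ∀ x x' : Fin (t + 1) → State D, (∀ i : Fin (t + 1), t < i → x i = x' i) →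
      Ψ x = Ψ x' := by
    intro x x' h
    funext S k
    simp only [Ψ, hΦx x x' h]
  have hlaw : ∀ (S S' : ParticleSystem N D), S.refIndex t = S'.refIndex t → S.2 = S'.2 →
      (A a).finalIndexLaw S t = (A a).finalIndexLaw S' t := by
    intro S S' h1 h2
    have h3 : (A a).normWeight S t = (A a).normWeight S' t := by
      funext n
      rw [← normWeight_withRef (A a) S' S.1, ← h2]
    rw [finalIndexLaw, finalIndexLaw, h1, h3]
  have hΨr : ∀ x S r k, Ψ x (r, S.2) k = Ψ x S k := by
    intro x S r k
    simp only [Ψ, hΦr]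
    rw [hlaw (setRef (r, S.2) k) (setRef S k) (by simp [setRef, refIndex]) rfl]
  -- The forced move preserves the final weights, so the final index may be replaced by the
  -- reference index.
  have key := hA.lintegral_forwardLaw_congr (N := N) a ht hΨ hΦ hΨr hΦr hΨx hΦx fun x S => by
    rw [hA.sum_weight_mul a ht, hA.sum_weight_mul a ht]
    exact congrArg _ (hA.sum_normWeight_mul_finalIndexLaw hN ht a (setRef S)
      ((A a).normWeight S t) (fun k => by simp [setRef, refIndex])
      (fun k i => normWeight_withRef _ _ _ _ _) (Φ x S))
  have h1 : ∀ x : Fin (t + 1) → State D, ∫⁻ y, f y ∂(A a).outputLaw N x =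
      ∫⁻ S, Ψ x S (S.refIndex t) ∂(A a).forwardLaw N (extendPath x) (t + 1) := by
    intro x
    rw [hA.lintegral_outputLaw hN hT a x hf]
    refine lintegral_congr fun S => ?_
    simp only [Ψ, Nat.add_sub_cancel]
    rw [hlaw (setRef S (S.refIndex t)) S (by simp [setRef, refIndex]) rfl]
    refine lintegral_congr fun i => ?_
    rw [show (∫⁻ l, f (fun s => S.particle s (l s))
      ∂(A a).backwardLaw S t (Function.update (fun _ => 0) t i)) = _ from
      lintegral_backwardLaw (A a) hf' S t _]
    -- The default index 0 used before backward sampling is harmless: among the times from t up to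
    -- the horizon there is only t itself.
    refine pathBackward_congr (A a) hc.backward_last hfT S ht fun s hs hs' => ?_
    obtain rfl : s = t := by omega
    simp
  have h2 : ∀ x : Fin (t + 1) → State D,
      ∫⁻ S, Φ x S (S.refIndex t) ∂(A a).forwardLaw N (extendPath x) (t + 1) =
      ∫⁻ S : ParticleSystem N D, (A a).pathBackward f' S t (extendPath x)
        ∂(A a).forwardLaw N (extendPath x) t := by
    intro x
    have hm : Measurable fun S : ParticleSystem N D =>
        (A a).pathBackward f' S t (extendPath x) :=
      (hA.comp measurable_const).measurable_pathBackward ht hf' measurable_id measurable_const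
    have h3 : ∫⁻ S, Φ x S (S.refIndex t) ∂(A a).forwardLaw N (extendPath x) (t + 1) =
        ∫⁻ S : ParticleSystem N D, (A a).pathBackward f' S t (extendPath x)
          ∂(A a).forwardLaw N (extendPath x) (t + 1) := by
      refine lintegral_congr_ae ?_
      filter_upwards [hA.ae_forwardLaw a (extendPath x) ht] with S hS
      simp only [Φ]
      rw [hS.1, Function.update_eq_self]
    rw [h3, forwardLaw, Measure.lintegral_bind
      (hA.measurable_forwardStep_fixed a (extendPath x) ht).aemeasurable hm.aemeasurable]
    simp_rw [hA.lintegral_forwardStep_pathBackward a ht hf']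
  simp_rw [h1]
  rw [key]
  simp_rw [h2]
  rw [hA.lintegral_pathBackward a hc hf' hfT ht]
  simp_rw [hfx]

end CSMCIngredients

/-- Auxiliary-variable kernels: draw `u` from a law with conditional density `r x` given `x`, then
draw from a kernel that leaves the conditional density of `x` given `u` invariant. -/
theorem exists_kernel_invariant_of_joint {E U : Type*} [MeasurableSpace E] [MeasurableSpace U]
    {ν : Measure E} {υ : Measure U} [SFinite ν] [SFinite υ] {p : E → ENNReal} (hp : Measurable p)
    {r : E → U → ENNReal} (hr : Measurable fun z : E × U => r z.1 z.2)
    {ρ : E → Measure U} (hρ : Measurable ρ) (hρ1 : ∀ x, IsProbabilityMeasure (ρ x))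
    (hρr : ∀ x, ∀ g : U → ENNReal, Measurable g → ∫⁻ u, g u ∂ρ x = ∫⁻ u, r x u * g u ∂υ)
    {O : U → E → Measure E} (hO : Measurable fun z : E × U => O z.2 z.1)
    (hO1 : ∀ u x, IsProbabilityMeasure (O u x))
    (hinv : ∀ u, ∀ f : E → ENNReal, Measurable f →
      ∫⁻ x, (p x * r x u) * ∫⁻ y, f y ∂O u x ∂ν = ∫⁻ x, (p x * r x u) * f x ∂ν)
    (c : ENNReal) :
    ∃ P : Kernel E E, IsMarkovKernel P ∧ (∀ x, P x = (ρ x).bind fun u => O u x) ∧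
      P.Invariant (c • ν.withDensity p) := by
  have hx : ∀ x, Measurable fun u => O u x := fun x => hO.comp measurable_prodMk_left
  let P : Kernel E E := ⟨_, Measurable.measure_bind (κ := fun x u => O u x) hρ hρ1 hO⟩
  have hP : ∀ x, P x = (ρ x).bind fun u => O u x := fun x => rfl
  have hMarkov : IsMarkovKernel P := ⟨fun x => by
    rw [hP]
    exact isProbabilityMeasure_bind (hx x).aemeasurable
      (Filter.Eventually.of_forall fun u => hO1 u x)⟩
  refine ⟨P, hMarkov, hP, Measure.ext fun s hs => ?_⟩
  let f : E → ENNReal := s.indicator 1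
  have hf : Measurable f := measurable_one.indicator hs
  have hfm : Measurable fun z : E × U => ∫⁻ y, f y ∂O z.2 z.1 :=
    Measurable.lintegral_param hO (fun z => hO1 z.2 z.1) (hf.comp measurable_snd)
  have hpr : Measurable fun z : E × U => p z.1 * r z.1 z.2 := (hp.comp measurable_fst).mul hr
  have hint : ∫⁻ x, p x * P x s ∂ν = ∫⁻ x, p x * f x ∂ν := by
    calc ∫⁻ x, p x * P x s ∂ν
        = ∫⁻ x, ∫⁻ u, (p x * r x u) * ∫⁻ y, f y ∂O u x ∂υ ∂ν := by
          refine lintegral_congr fun x => ?_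
          have h1 := hρr x (fun u => ∫⁻ y, f y ∂O u x)
            (hfm.comp (measurable_prodMk_left (x := x)))
          have h2 : Measurable fun u => r x u * ∫⁻ y, f y ∂O u x :=
            (hr.mul hfm).comp (measurable_prodMk_left (x := x))
          rw [← lintegral_indicator_one hs, hP, Measure.lintegral_bind (hx x).aemeasurable
            hf.aemeasurable, h1, ← lintegral_const_mul _ h2]
          simp only [mul_assoc]
      -- Tonelli moves the integral over x inside, where invariance for fixed u applies; a second
      -- exchange then integrates u out.
      _ = ∫⁻ u, ∫⁻ x, (p x * r x u) * ∫⁻ y, f y ∂O u x ∂ν ∂υ :=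
          lintegral_lintegral_swap (hpr.mul hfm).aemeasurable
      _ = ∫⁻ u, ∫⁻ x, (p x * r x u) * f x ∂ν ∂υ := lintegral_congr fun u => hinv u f hf
      _ = ∫⁻ x, ∫⁻ u, (p x * r x u) * f x ∂υ ∂ν :=
          (lintegral_lintegral_swap (hpr.mul (hf.comp measurable_fst)).aemeasurable).symm
      _ = ∫⁻ x, p x * f x ∂ν := by
          refine lintegral_congr fun x => ?_
          -- Testing `hρr` with the constant 1 shows that r x is a probability density.
          have h1 : ∫⁻ u, r x u ∂υ = 1 := by
            have h := hρr x 1 measurable_one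
            simpa using h.symm
          have h2 : Measurable (r x) := hr.comp (measurable_prodMk_left (x := x))
          calc ∫⁻ u, (p x * r x u) * f x ∂υ = ∫⁻ u, (p x * f x) * r x u ∂υ :=
                lintegral_congr fun u => mul_right_comm _ _ _
            _ = p x * f x := by rw [lintegral_const_mul _ h2, h1, mul_one]
  rw [Measure.bind_apply hs P.measurable.aemeasurable, lintegral_smul_measure,
    lintegral_withDensity_eq_lintegral_mul _ hp (P.measurable_coe hs), Measure.smul_apply,
    withDensity_apply _ hs, ← lintegral_indicator hs]
  refine congrArg _ (hint.trans (lintegral_congr fun x => ?_))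
  by_cases h : x ∈ s <;> simp [f, h]

/-! ### Conditional SMC with auxiliary variables -/

namespace CSMCIngredients

variable {N D T : ℕ}

/-- Conditional sequential Monte Carlo in an extended model: if the auxiliary variables `u` have
conditional density `∏ q` given the path and the joint density of path and auxiliary variables is
the path density of the ingredients `A u`, then the target density `p` is left invariant. -/
theorem IsRegular.exists_kernel_invariant {A : (Fin T → State D) → CSMCIngredients D}
    (hA : IsRegular A T) (hc : ∀ u, (A u).IsCompatible T) (hN : 1 ≤ N) (hT : 1 ≤ T)
    {p : (Fin T → State D) → ENNReal} (hp : Measurable p)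
    {q : (Fin T → State D) → Fin T → State D → ℝ}
    (hq : ∀ t, Measurable fun z : (Fin T → State D) × State D => q z.1 t z.2)
    (hq1 : ∀ x t, ∫⁻ u, ENNReal.ofReal (q x t u) = 1)
    (hdens : ∀ u x, (A u).pathDensity (extendPath x) T =
      p x * ∏ t, ENNReal.ofReal (q x t (u t))) (c : ENNReal) :
    ∃ P : Kernel (Fin T → State D) (Fin T → State D), IsMarkovKernel P ∧
      (∀ x, P x = (Measure.pi fun t => lawOfDensity (q x t)).bind fun u => (A u).outputLaw N x) ∧
      P.Invariant (c • volume.withDensity p) := by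
  have hqp : ∀ x t, IsProbabilityMeasure (lawOfDensity (q x t)) := fun x t =>
    isProbabilityMeasure_lawOfDensity (hq1 x t)
  have hqx : ∀ x t, Measurable fun u => ENNReal.ofReal (q x t u) := fun x t => by
    have h := ((hq t).comp (measurable_prodMk_left (x := x))).ennreal_ofReal
    exact h
  have hq' : ∀ t, Measurable fun z : (Fin T → State D) × (Fin T → State D) =>
      ENNReal.ofReal (q z.1 t (z.2 t)) := by
    intro t
    have h1 : Measurable fun z : (Fin T → State D) × (Fin T → State D) => (z.1, z.2 t) := by
      fun_prop
    have h2 := ((hq t).comp h1).ennreal_ofReal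
    exact h2
  refine exists_kernel_invariant_of_joint (O := fun u x => (A u).outputLaw N x)
    (r := fun x (u : Fin T → State D) => ∏ t, ENNReal.ofReal (q x t (u t))) (υ := volume) hp
    (Finset.measurable_prod _ fun t _ => hq' t)
    (Measurable.measure_pi (fun t => measurable_lawOfDensity (hq t)) hqp)
    (fun x => inferInstance)
    (fun x g hg => lintegral_pi_withDensity (hqx x) (hq1 x) hg)
    ((hA.comp measurable_snd).measurable_outputLaw hN hT measurable_fst)
    (fun u x => hA.isProbabilityMeasure_outputLaw hN hT u x) (fun u f hf => ?_) c
  simp_rw [← hdens]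
  exact hA.lintegral_outputLaw_pathDensity u (hc u) hN hT hf

end CSMCIngredients

/-! ### Measurability of gradients and auxiliary densities -/

theorem measurable_gradient_with_param {E F : Type*} [TopologicalSpace E] [MeasurableSpace E]
    [OpensMeasurableSpace E] [NormedAddCommGroup F] [InnerProductSpace ℝ F]
    [FiniteDimensional ℝ F] [MeasurableSpace F] [BorelSpace F] [SecondCountableTopologyEither E F]
    [CompleteSpace F]
    {f : E → F → ℝ} (hf : Continuous f.uncurry) :
    Measurable fun p : E × F => gradient (f p.1) p.2 := by
  have := FiniteDimensional.proper_real F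
  -- The gradient is the derivative transported by the Riesz isometry, and the derivative is
  -- measurable jointly with the parameter, without assuming that it is continuous.
  exact (InnerProductSpace.toDual ℝ F).symm.continuous.measurable.comp
    (measurable_fderiv_with_param ℝ hf)

namespace AffineGaussianModel

variable {D T : ℕ} {M : AffineGaussianModel D}

section Auxiliary

theorem auxDensity_pos (hδ : ∀ t < T, 0 < M.δ t) {t : ℕ} (ht : t < T) (x g u : State D) :
    0 < M.auxDensity t x g u :=
  gaussianDensity_pos (posDef_auxCov hδ ht) _ _

theorem lintegral_auxDensity (hδ : ∀ t < T, 0 < M.δ t) {t : ℕ} (ht : t < T) (x g : State D) :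
    ∫⁻ u, ENNReal.ofReal (M.auxDensity t x g u) = 1 :=
  lintegral_gaussianDensity (posDef_auxCov hδ ht) _

variable {α : Type*} [MeasurableSpace α] {w x y z u : α → State D}

@[fun_prop]
theorem measurable_auxDensity (hx : Measurable x) (hy : Measurable y) (hu : Measurable u) (t : ℕ) :
    Measurable fun a => M.auxDensity t (x a) (y a) (u a) := by
  have h : Measurable fun a => x a + (M.κ * (M.δ t / 2)) • y a := by fun_prop
  exact measurable_gaussianDensity hu h _

variable (hGpos : ∀ t < T, ∀ xp x : State D, 0 < M.G t xp x)
  (hG : ∀ t < T, Continuous fun p : State D × State D => M.G t p.1 p.2)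

include hG

theorem measurable_G {t : ℕ} (ht : t < T) (hx : Measurable x) (hy : Measurable y) :
    Measurable fun a => M.G t (x a) (y a) := by
  have h := (hG t ht).measurable.comp (hx.prodMk hy)
  exact h

theorem measurable_Q {t : ℕ} (ht : t < T) (hx : Measurable x) (hy : Measurable y) :
    Measurable fun a => M.Q t (x a) (y a) :=
  (M.measurable_transition hx hy t).mul (measurable_G hG ht hx hy)

include hGpos

theorem measurable_filterGradient {t : ℕ} (ht : t < T) (hx : Measurable x) (hy : Measurable y) :
    Measurable fun a => M.filterGradient t (x a) (y a) := by
  have h : Continuous (Function.uncurry fun (xp : State D) (y : State D) =>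
      Real.log (M.G t xp y)) :=
    (hG t ht).log fun p => (hGpos t ht _ _).ne'
  have h' := (measurable_gradient_with_param h).comp (hx.prodMk hy)
  exact h'

theorem measurable_smoothingGradient {t : ℕ} (ht : t < T) (hx : Measurable x) (hy : Measurable y)
    (hz : Measurable z) : Measurable fun a => M.smoothingGradient T t (x a) (y a) (z a) := by
  have h : Continuous (Function.uncurry fun (q : State D × State D) (y : State D) =>
      Real.log (M.G t q.1 y) + if t + 1 < T then Real.log (M.G (t + 1) y q.2) else 0) := by
    refine Continuous.add ?_ ?_
    · exact ((hG t ht).log fun p => (hGpos t ht _ _).ne').comp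
        ((continuous_fst.comp continuous_fst).prodMk continuous_snd)
    · split_ifs with h
      · exact ((hG _ h).log fun p => (hGpos _ h _ _).ne').comp
          (continuous_snd.prodMk (continuous_snd.comp continuous_fst))
      · exact continuous_const
  have h' := (measurable_gradient_with_param h).comp ((hx.prodMk hz).prodMk hy)
  exact h'

end Auxiliary

end AffineGaussianModel

/-! ### The two twisted algorithms as conditional SMC -/

namespace AffineGaussianModel

open CSMCIngredients

variable {D T : ℕ} {M : AffineGaussianModel D}
  (hC : ∀ t < T, (M.C t).PosDef) (hδ : ∀ t < T, 0 < M.δ t)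
  (hGpos : ∀ t < T, ∀ xp x : State D, 0 < M.G t xp x)

theorem twistedQPlus_succ (u : ℕ → State D) (t : ℕ) (xpp xp x : State D) :
    M.twistedQPlus T u (t + 1) xpp xp x = M.twistedQ T u (t + 1) xp x *
      (M.auxDensity t xp (M.smoothingGradient T t xpp xp x) (u t) /
        M.auxDensity t xp (M.filterGradient t xpp xp) (u t)) :=
  (mul_assoc _ _ _).symm

include hC in
theorem Q_pos (hGpos : ∀ t < T, ∀ xp x : State D, 0 < M.G t xp x) {t : ℕ} (ht : t < T)
    (xp x : State D) : 0 < M.Q t xp x :=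
  mul_pos (transition_pos hC ht xp x) (hGpos t ht xp x)

include hC hδ

theorem twistedProposal_pos (u : ℕ → State D) {t : ℕ} (ht : t < T) (xp x : State D) :
    0 < M.twistedProposal T u t xp x := by
  rw [twistedProposal_eq hC hδ u ht]
  exact gaussianDensity_pos (posDef_twistedC hC hδ u ht) _ _

theorem lintegral_twistedProposal (u : ℕ → State D) {t : ℕ} (ht : t < T) (xp : State D) :
    ∫⁻ x, ENNReal.ofReal (M.twistedProposal T u t xp x) = 1 := by
  simp_rw [twistedProposal_eq hC hδ u ht]
  exact lintegral_gaussianDensity (posDef_twistedC hC hδ u ht) _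

/-- The potential is an importance weight, so the proposal cancels. Its positivity, which permits
the cancellation, comes from the Kalman form. -/
theorem twistedQ_eq (u : ℕ → State D) {t : ℕ} (ht : t < T) (xp x : State D) :
    M.twistedQ T u t xp x =
      M.Q t xp x * M.auxDensity t x (M.filterGradient t xp x) (u t) :=
  mul_div_cancel₀ _ (twistedProposal_pos hC hδ u ht xp x).ne'

include hGpos

theorem twistedPotential_pos (u : ℕ → State D) {t : ℕ} (ht : t < T) (xp x : State D) :
    0 < M.twistedPotential T u t xp x :=
  div_pos (mul_pos (Q_pos hC hGpos ht xp x) (auxDensity_pos hδ ht _ _ _))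
    (twistedProposal_pos hC hδ u ht xp x)

theorem twistedPotentialPlus_pos (u : ℕ → State D) {t : ℕ} (ht : t < T) (xpp xp x : State D) :
    0 < M.twistedPotentialPlus T u t xpp xp x := by
  have h := twistedPotential_pos hC hδ hGpos u ht xp x
  cases t with
  | zero => exact h
  | succ t =>
    have ht' : t < T := by omega
    exact mul_pos h (div_pos (auxDensity_pos hδ ht' _ _ _) (auxDensity_pos hδ ht' _ _ _))

theorem twistedQ_pos (u : ℕ → State D) {t : ℕ} (ht : t < T) (xp x : State D) :
    0 < M.twistedQ T u t xp x :=
  mul_pos (twistedProposal_pos hC hδ u ht xp x) (twistedPotential_pos hC hδ hGpos u ht xp x)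

theorem twistedQPlus_pos (u : ℕ → State D) {t : ℕ} (ht : t < T) (xpp xp x : State D) :
    0 < M.twistedQPlus T u t xpp xp x :=
  mul_pos (twistedProposal_pos hC hδ u ht xp x)
    (twistedPotentialPlus_pos hC hδ hGpos u ht xpp xp x)

omit hC hδ

variable (hG : ∀ t < T, Continuous fun p : State D × State D => M.G t p.1 p.2)

section Measurability

variable {α : Type*} [MeasurableSpace α] {x y z : α → State D} {u : α → ℕ → State D}

include hG

theorem measurable_twistedPotential (hu : Measurable u) (hx : Measurable x) (hy : Measurable y)
    {t : ℕ} (ht : t < T) : Measurable fun a => M.twistedPotential T (u a) t (x a) (y a) :=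
  ((measurable_Q hG ht hx hy).mul (measurable_auxDensity hy
    (measurable_filterGradient hGpos hG ht hx hy) ((measurable_pi_apply t).comp hu) t)).div
    (M.measurable_twistedProposal hu hx hy T t)

theorem measurable_twistedQ (hu : Measurable u) (hx : Measurable x) (hy : Measurable y)
    {t : ℕ} (ht : t < T) : Measurable fun a => M.twistedQ T (u a) t (x a) (y a) :=
  (M.measurable_twistedProposal hu hx hy T t).mul
    (measurable_twistedPotential hGpos hG hu hx hy ht)

theorem measurable_twistedPotentialPlus (hu : Measurable u) (hx : Measurable x)
    (hy : Measurable y) (hz : Measurable z) {t : ℕ} (ht : t < T) :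
    Measurable fun a => M.twistedPotentialPlus T (u a) t (x a) (y a) (z a) := by
  have h := measurable_twistedPotential hGpos hG hu hy hz ht
  cases t with
  | zero => exact h
  | succ t =>
    have ht' : t < T := by omega
    have hut : Measurable fun a => u a t := (measurable_pi_apply t).comp hu
    exact h.mul ((measurable_auxDensity hy
      (measurable_smoothingGradient hGpos hG ht' hx hy hz) hut t).div
      (measurable_auxDensity hy (measurable_filterGradient hGpos hG ht' hx hy) hut t))

theorem measurable_twistedQPlus (hu : Measurable u) (hx : Measurable x)
    (hy : Measurable y) (hz : Measurable z) {t : ℕ} (ht : t < T) :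
    Measurable fun a => M.twistedQPlus T (u a) t (x a) (y a) (z a) :=
  (M.measurable_twistedProposal hu hy hz T t).mul
    (measurable_twistedPotentialPlus hGpos hG hu hx hy hz ht)

omit hGpos in
theorem measurable_unnormalizedTarget : Measurable (M.unnormalizedTarget T) := by
  refine Finset.measurable_prod _ fun t ht => ?_
  have h : Measurable (extendPath : (Fin T → State D) → ℕ → State D) := measurable_extendPath
  exact measurable_Q hG (Finset.mem_range.1 ht)
    ((measurable_pi_apply t).comp (measurable_previous h)) ((measurable_pi_apply t).comp h)

end Measurability

include hC hδ hG

theorem isRegular_twistedIngredients :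
    IsRegular (fun u : Fin T → State D => M.twistedIngredients T (extendPath u)) T where
  proposal_nonneg u t ht xp x := (twistedProposal_pos hC hδ _ ht xp x).le
  lintegral_proposal u t ht xp := lintegral_twistedProposal hC hδ _ ht xp
  potential_pos u t ht _ xp x := twistedPotential_pos hC hδ hGpos _ ht xp x
  backward_pos u t ht _ x xn _ := twistedQ_pos hC hδ hGpos _ ht x xn
  measurable_proposal t ht := M.measurable_twistedProposal
    (measurable_extendPath.comp measurable_fst) (by fun_prop) (by fun_prop) T t
  measurable_potential t ht := measurable_twistedPotential hGpos hG
    (measurable_extendPath.comp measurable_fst) (by fun_prop) (by fun_prop) ht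
  measurable_backward t ht := measurable_twistedQ hGpos hG
    (measurable_extendPath.comp measurable_fst) (by fun_prop) (by fun_prop) ht

theorem isRegular_twistedIngredientsPlus :
    IsRegular (fun u : Fin T → State D => M.twistedIngredientsPlus T (extendPath u)) T where
  proposal_nonneg u t ht xp x := (twistedProposal_pos hC hδ _ ht xp x).le
  lintegral_proposal u t ht xp := lintegral_twistedProposal hC hδ _ ht xp
  potential_pos u t ht xpp xp x := twistedPotentialPlus_pos hC hδ hGpos _ ht xpp xp x
  backward_pos u t ht xp x xn xnn := by
    refine mul_pos (twistedQPlus_pos hC hδ hGpos _ ht xp x xn) ?_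
    split_ifs with h
    · exact twistedQPlus_pos hC hδ hGpos _ h x xn xnn
    · exact one_pos
  measurable_proposal t ht := M.measurable_twistedProposal
    (measurable_extendPath.comp measurable_fst) (by fun_prop) (by fun_prop) T t
  measurable_potential t ht := measurable_twistedPotentialPlus hGpos hG
    (measurable_extendPath.comp measurable_fst) (by fun_prop) (by fun_prop) (by fun_prop) ht
  measurable_backward t ht := by
    refine Measurable.mul (measurable_twistedQPlus hGpos hG
      (measurable_extendPath.comp measurable_fst) (by fun_prop) (by fun_prop) (by fun_prop) ht) ?_
    split_ifs with h
    · exact measurable_twistedQPlus hGpos hG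
        (measurable_extendPath.comp measurable_fst) (by fun_prop) (by fun_prop) (by fun_prop) h
    · exact measurable_const

omit hC hδ in
theorem isCompatible_twistedIngredients (u : ℕ → State D) :
    (M.twistedIngredients T u).IsCompatible T where
  backward_last _ _ _ _ _ _ _ := rfl
  pathFactor_mul t ht := by
    -- Without gradients of the next potential, the factor at t + 2 does not involve the state at
    -- time t and can be moved entirely into c.
    refine ⟨fun p => if t + 2 < T then ENNReal.ofReal (M.twistedQ T u (t + 2) p.1 p.2) else 1,
      ?_, fun p => ?_, fun _ _ _ _ => rfl⟩
    · split_ifs with h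
      · exact (measurable_twistedQ hGpos hG measurable_const measurable_fst measurable_snd
          h).ennreal_ofReal
      · exact measurable_const
    · split_ifs
      · exact ENNReal.ofReal_ne_top
      · exact ENNReal.one_ne_top

omit hG in
-- The factors at t + 1 and t + 2 both involve the state at time t, the latter through the
-- correction for u_{t+1}. The backward weight is their full product, so c = 1.
theorem isCompatible_twistedIngredientsPlus (u : ℕ → State D) :
    (M.twistedIngredientsPlus T u).IsCompatible T where
  backward_last t ht xp x xn xnn xnn' := by
    simp only [twistedIngredientsPlus, if_neg (show ¬ t + 2 < T by omega)]
  pathFactor_mul t ht := by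
    refine ⟨fun _ => 1, measurable_const, fun _ => ENNReal.one_ne_top, fun xp x xn xnn => ?_⟩
    have h := (twistedQPlus_pos hC hδ hGpos u ht xp x xn).le
    simp only [twistedIngredientsPlus, pathFactor]
    rw [mul_one, ENNReal.ofReal_mul h]
    refine congrArg _ ?_
    split_ifs
    · rfl
    · exact ENNReal.ofReal_one.symm

omit hG

theorem pathDensity_twistedIngredients (u x : Fin T → State D) :
    (M.twistedIngredients T (extendPath u)).pathDensity (extendPath x) T =
      ENNReal.ofReal (M.unnormalizedTarget T x) * ∏ t : Fin T, ENNReal.ofReal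
        (M.auxDensity t (x t) (M.filterGradient t (previous (extendPath x) t) (x t)) (u t)) := by
  rw [unnormalizedTarget, ENNReal.ofReal_prod_of_nonneg fun t ht =>
    (Q_pos hC hGpos (Finset.mem_range.1 ht) _ _).le, Finset.prod_range, pathDensity,
    Finset.prod_range, ← Finset.prod_mul_distrib]
  refine Finset.prod_congr rfl fun t _ => ?_
  rw [← ENNReal.ofReal_mul (Q_pos hC hGpos t.2 _ _).le, ← extendPath_val x, ← extendPath_val u,
    ← twistedQ_eq hC hδ (extendPath u) t.2]
  rfl

omit hC hδ hGpos in
-- This accounts for the density of the final auxiliary variable, which no later potential corrects.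
theorem smoothingGradient_of_last {t : ℕ} (ht : T ≤ t + 1) (xp x xn : State D) :
    M.smoothingGradient T t xp x xn = M.filterGradient t xp x := by
  simp only [smoothingGradient, filterGradient, if_neg (not_lt.2 ht), add_zero]

omit hGpos in
/-- The correction factors of the potentials of aGRAD+ turn the densities of the auxiliary
variables for filter gradients into those for smoothing gradients. -/
theorem prod_twistedQPlus (u x : ℕ → State D) {s : ℕ} (hs : s < T) :
    ∏ t ∈ Finset.range (s + 1),
        M.twistedQPlus T u t (previous (previous x) t) (previous x t) (x t) =
      (∏ t ∈ Finset.range (s + 1), M.Q t (previous x t) (x t)) *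
        ((∏ t ∈ Finset.range s, M.auxDensity t (x t)
          (M.smoothingGradient T t (previous x t) (x t) (x (t + 1))) (u t)) *
          M.auxDensity s (x s) (M.filterGradient s (previous x s) (x s)) (u s)) := by
  induction s with
  | zero =>
    simp only [zero_add, Finset.prod_range_one, Finset.range_zero, Finset.prod_empty, one_mul]
    exact twistedQ_eq hC hδ u hs _ _
  | succ s ih =>
    have hs' : s < T := by omega
    -- The correction in the potential at s + 1 divides out the filter-gradient density of u_s, the
    -- last factor left by the induction hypothesis, and puts the smoothing-gradient density in its
    -- place.
    have h := (auxDensity_pos hδ hs' (x s) (M.filterGradient s (previous x s) (x s)) (u s)).ne'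
    rw [Finset.prod_range_succ, ih hs', twistedQPlus_succ u s, twistedQ_eq hC hδ u hs,
      Finset.prod_range_succ (fun t => M.Q t (previous x t) (x t)) (s + 1),
      Finset.prod_range_succ (fun t => M.auxDensity t (x t)
        (M.smoothingGradient T t (previous x t) (x t) (x (t + 1))) (u t)) s]
    have e1 : previous x (s + 1) = x s := rfl
    have e2 : previous (previous x) (s + 1) = previous x s := rfl
    rw [e1, e2]
    field_simp

theorem pathDensity_twistedIngredientsPlus (hT : 1 ≤ T) (u x : Fin T → State D) :
    (M.twistedIngredientsPlus T (extendPath u)).pathDensity (extendPath x) T =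
      ENNReal.ofReal (M.unnormalizedTarget T x) * ∏ t : Fin T, ENNReal.ofReal
        (M.auxDensity t (x t) (M.smoothingGradient T t (previous (extendPath x) t) (x t)
          (extendPath x (t + 1))) (u t)) := by
  have h : ∏ t ∈ Finset.range T, M.twistedQPlus T (extendPath u) t
      (previous (previous (extendPath x)) t) (previous (extendPath x) t) (extendPath x t) =
      M.unnormalizedTarget T x * ∏ t ∈ Finset.range T, M.auxDensity t (extendPath x t)
        (M.smoothingGradient T t (previous (extendPath x) t) (extendPath x t)
          (extendPath x (t + 1))) (extendPath u t) := by
    obtain ⟨s, rfl⟩ : ∃ s, T = s + 1 := ⟨T - 1, by omega⟩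
    rw [prod_twistedQPlus hC hδ _ _ (Nat.lt_succ_self s), Finset.prod_range_succ
      (fun t => M.auxDensity t (extendPath x t) (M.smoothingGradient (s + 1) t
        (previous (extendPath x) t) (extendPath x t) (extendPath x (t + 1))) (extendPath u t)) s,
      smoothingGradient_of_last le_rfl, unnormalizedTarget]
  have hpos : 0 ≤ M.unnormalizedTarget T x :=
    Finset.prod_nonneg fun t ht => (Q_pos hC hGpos (Finset.mem_range.1 ht) _ _).le
  calc _ = ENNReal.ofReal (∏ t ∈ Finset.range T, M.twistedQPlus T (extendPath u) t
      (previous (previous (extendPath x)) t) (previous (extendPath x) t) (extendPath x t)) :=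
        (ENNReal.ofReal_prod_of_nonneg fun t ht =>
          (twistedQPlus_pos hC hδ hGpos _ (Finset.mem_range.1 ht) _ _ _).le).symm
    _ = _ := by
        rw [h, ENNReal.ofReal_mul hpos, ENNReal.ofReal_prod_of_nonneg fun t ht =>
          (auxDensity_pos hδ (Finset.mem_range.1 ht) _ _ _).le, Finset.prod_range]
        simp only [extendPath_val]

end AffineGaussianModel

end

theorem mainTheorem10 (D T N : ℕ) (hT : 1 ≤ T) (hN : 1 ≤ N) (M : AffineGaussianModel D)
    (hC : ∀ t < T, (M.C t).PosDef)
    (hδ : ∀ t < T, 0 < M.δ t)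
    (hκ : M.κ = 0 ∨ M.κ = 1)
    (hGpos : ∀ t < T, ∀ xp x : State D, 0 < M.G t xp x)
    (hGdiff : ∀ t < T, Differentiable ℝ fun p : State D × State D => M.G t p.1 p.2)
    (hint : Integrable (M.unnormalizedTarget T)) :
    (∀ (u : Fin T → State D), ∀ t < T,
      (M.twistedC T (extendPath u) t).PosDef ∧
      ∀ xp x : State D,
        M.twistedProposal T (extendPath u) t xp x =
          gaussianDensity x
            (matVec (M.twistedF T (extendPath u) t) xp + M.twistedb T (extendPath u) t)
            (M.twistedC T (extendPath u) t)) ∧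
    (∃ P : Kernel (Fin T → State D) (Fin T → State D),
      IsMarkovKernel P ∧ (∀ x, P x = M.twistedParticleAGRAD N x) ∧
        P.Invariant (M.target T)) ∧
    (∃ P : Kernel (Fin T → State D) (Fin T → State D),
      IsMarkovKernel P ∧ (∀ x, P x = M.twistedParticleAGRADPlus N x) ∧
        P.Invariant (M.target T)) := by
  have hG : ∀ t < T, Continuous fun p : State D × State D => M.G t p.1 p.2 := fun t ht =>
    (hGdiff t ht).continuous
  have hp : Measurable fun x => ENNReal.ofReal (M.unnormalizedTarget T x) :=
    (AffineGaussianModel.measurable_unnormalizedTarget hG).ennreal_ofReal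
  have hX : ∀ t, Measurable fun z : (Fin T → State D) × State D => extendPath z.1 t :=
    fun t => by fun_prop
  have hprev : ∀ t, Measurable fun z : (Fin T → State D) × State D =>
      previous (extendPath z.1) t := fun t =>
    (measurable_pi_apply t).comp (measurable_previous (measurable_extendPath.comp measurable_fst))
  have hx : ∀ t : Fin T, Measurable fun z : (Fin T → State D) × State D => z.1 t :=
    fun t => by fun_prop
  refine ⟨fun u t ht => ⟨AffineGaussianModel.posDef_twistedC hC hδ _ ht,
    AffineGaussianModel.twistedProposal_eq hC hδ _ ht⟩, ?_, ?_⟩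
  · exact (AffineGaussianModel.isRegular_twistedIngredients hC hδ hGpos hG).exists_kernel_invariant
      (fun u => AffineGaussianModel.isCompatible_twistedIngredients hGpos hG _) hN hT hp
      (fun t => AffineGaussianModel.measurable_auxDensity (hx t)
        (AffineGaussianModel.measurable_filterGradient hGpos hG t.2 (hprev t) (hx t))
        measurable_snd t)
      (fun x t => AffineGaussianModel.lintegral_auxDensity hδ t.2 _ _)
      (AffineGaussianModel.pathDensity_twistedIngredients hC hδ hGpos) _
  · exact
      (AffineGaussianModel.isRegular_twistedIngredientsPlus hC hδ hGpos hG).exists_kernel_invariant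
      (fun u => AffineGaussianModel.isCompatible_twistedIngredientsPlus hC hδ hGpos _) hN hT hp
      (fun t => AffineGaussianModel.measurable_auxDensity (hx t)
        (AffineGaussianModel.measurable_smoothingGradient hGpos hG t.2 (hprev t) (hx t)
          (hX (t + 1))) measurable_snd t)
      (fun x t => AffineGaussianModel.lintegral_auxDensity hδ t.2 _ _)
      (AffineGaussianModel.pathDensity_twistedIngredientsPlus hC hδ hGpos hT) _
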